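/- Let $d\ge 2$, $1\le m\le d+1$, and let $\mathbf N$ be the space of locally finite counting measures on $\mathbb R^d$ with the $\sigma$-field generated by $\mu\mapsto\mu(B)$, $B$ Borel. For $\mathbf x=(x_1,\dots,x_k)$ put $\delta_{\mathbf x}=\delta_{x_1}+\dots+\delta_{x_k}$ and $\mu_{\mathbf x}=\mu+\delta_{\mathbf x}$; $\mu_B$ is the restriction of $\mu$ to $B$; for $\mu=\sum_i\delta_{x_i}\in\mathbf N$, $\mu^{(m)}$ is the sum of $\delta_{(x_{i_1},\dots,x_{i_m})}$ over pairwise distinct indices $i_1,\dots,i_m$. For $\mathbf x\in(\mathbb R^d)^m$ let $z(\mathbf x)$ be the point of the affine hull of $x_1,\dots,x_m$ equidistant to all $x_i$ if the $x_i$ are affinely independent, and $z(\mathbf x)=0$ otherwise. $B(z,r)$ is the closed ball, $B(z,\infty)=\mathbb R^d$. Let $\eta$ be a Poisson process on $\mathbb R^d$ with locally finite intensity measure $\lambda$, let $t>0$, $W_t=[0,t^{1/d}]^d$, and let $g_t:(\mathbb R^d)^m\times\mathbf N\to\{0,1\}$ be measurable and symmetric in its first $m$ arguments. Assume that $g_t$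 is stabilizing with stabilization radius $R_t$, i.e. $R_t:\mathbb R^d\times\mathbf N\to[0,\infty]$ is measurable and, with $S_{\mathbf x}(\mu)=B(z(\mathbf x),R_t(z(\mathbf x),\mu_{\mathbf x}))$, 1. for $\lambda^m$-a.e. $\mathbf x$, $R_t(z(\mathbf x),\eta_{\mathbf x})<\infty$ a.s.; 2. $g_t(\mathbf x,\mu)=g_t(\mathbf x,\mu_{S_{\mathbf x}(\mu)}+\chi_{S_{\mathbf x}(\mu)^c})$ for all $\mathbf x$ and all $\mu,\chi\in\mathbf N$; 3. for all $\mathbf x$, $\mu\mapsto S_{\mathbf x}(\mu)$ is a stopping set: it is measurable into the closed sets (with the $\sigma$-field generated by $\{F:F\cap K\ne\emptyset\}$, $K$ compact), and $\{\mu: S_{\mathbf x}(\mu)\subset F\}$ belongs to the $\sigma$-field generated by $\mu\mapsto\mu(B\cap F)$, $B$ Borel, for every closed $F$; 4. for $\lambda^m$-a.e. $\mathbf x$, $x_1,\dots,x_m\in S_{\mathbf x}(\eta)$ a.s. Let $$\xi_t=\frac1{m!}\sum_{\mathbf x\in\eta^{(m)}}\mathbf 1\{z(\mathbf x)\in W_t\}\,g_t(\mathbf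 x,\eta-\delta_{\mathbf x})\,\delta_{z(\mathbf x)},$$ let $t^{-1/d}\xi_t$ be its image under $z\mapsto t^{-1/d}z$, and let $\mathbb E\xi_t$ denote its intensity measure. Let $\eta_t^z$, $z\in\mathbb R^d$, be Palm processes of $\eta$ with respect to $\xi_t$ (their distributions form a probability kernel with $\mathbb E\int f(z,\eta)\,\xi_t(\mathrm dz)=\int\mathbb E f(z,\eta_t^z)\,\mathbb E\xi_t(\mathrm dz)$ for all measurable $f\ge0$). Let $\nu$ be a Poisson process with locally finite intensity measure $\mathbb E\nu$, and let $b_t:\mathbb R^d\to[0,\infty)$ be measurable. Then $$d_{TV}(t^{-1/d}\xi_t,\nu)\le\|\mathbb E(t^{-1/d}\xi_t)-\mathbb E\nu\|+C_1+C_2+C_3+\iint\Big(2\,\mathbb P(R_t(z,\eta_t^z)>b_t(z))+\mathbf 1\{|w-z|\le b_t(w)+b_t(z)\}\Big)\,\mathbb E\xi_t(\mathrm dw)\,\mathbb E\xi_t(\mathrm dz),$$ where $d_{TV}(\xi,\nu)=\sup_A|\mathbb P(\xi\in A)-\mathbb P(\nu\in A)|$ over measurable sets $A$ of configurations, $\|\pi-\pi'\|=\sup_B(\pi(B)-\pi'(B))_++\sup_B(\pi'(B)-\pi(B))_+$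 over Borel sets $B$ is the total variation norm (possibly $\infty$; $\infty-\infty:=0$ here), and $$C_1=\sum_{\ell=1}^{m-1}\binom m\ell\frac1{m!\,\ell!}\,\mathbb E\iiint\mathbf 1\{z(\mathbf x,\mathbf u)\in W_t\}\mathbf 1\{z(\mathbf y,\mathbf u)\in W_t\}\,g_t((\mathbf x,\mathbf u),\eta_{\mathbf y})\,g_t((\mathbf y,\mathbf u),\eta_{\mathbf x})\,\lambda^\ell(\mathrm d\mathbf y)\,\lambda^{m-\ell}(\mathrm d\mathbf u)\,\lambda^\ell(\mathrm d\mathbf x),$$ $$C_2=\frac1{(m!)^2}\,\mathbb E\iint\mathbf 1\{z(\mathbf x)\in W_t\}\mathbf 1\{z(\mathbf y)\in W_t\}\,g_t(\mathbf x,\eta_{\mathbf y})\,g_t(\mathbf y,\eta_{\mathbf x})\,\mathbf 1\{|z(\mathbf x)-z(\mathbf y)|\le b_t(z(\mathbf x))+b_t(z(\mathbf y))\}\,\lambda^m(\mathrm d\mathbf y)\,\lambda^m(\mathrm d\mathbf x),$$ $$C_3=\frac2{(m!)^2}\,\mathbb E\iint\mathbf 1\{z(\mathbf x)\in W_t\}\mathbf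 1\{z(\mathbf y)\in W_t\}\,g_t(\mathbf x,\eta_{\mathbf y})\,g_t(\mathbf y,\eta_{\mathbf x})\,\mathbf 1\{R_t(z(\mathbf x),\eta_{\mathbf x,\mathbf y})>b_t(z(\mathbf x))\}\,\lambda^m(\mathrm d\mathbf y)\,\lambda^m(\mathrm d\mathbf x).$$ -/

import Mathlib

open MeasureTheory ProbabilityTheory TopologicalSpace
open scoped NNReal ENNReal

/-- `d`-dimensional Euclidean space. -/
abbrev E (d : ℕ) := EuclideanSpace ℝ (Fin d)

/-- The space `𝐍` of locally finite counting measures on `ℝ^d`, with the `σ`-field generated by the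
evaluations `μ ↦ μ B`, `B` Borel (the trace of Mathlib's `σ`-field on `Measure (E d)`). -/
abbrev Config (d : ℕ) := {μ : Measure (E d) //
  (∀ K : Set (E d), IsCompact K → μ K < ∞) ∧
    ∀ B : Set (E d), MeasurableSet B → ∃ n : ℕ∞, μ B = (n : ℝ≥0∞)}

section Helpers

variable {d : ℕ}

theorem Config.exists_enat (μ : Config d) (B : Set (E d)) : ∃ n : ℕ∞, μ.1 B = (n : ℝ≥0∞) := by
  rw [← measure_toMeasurable B]
  exact μ.2.2 _ (measurableSet_toMeasurable _ _)

theorem sum_dirac_apply_nat {k : ℕ} (x : Fin k → E d) {B : Set (E d)} (hB : MeasurableSet B) :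
    ∃ n : ℕ, (∑ i, Measure.dirac (x i)) B = (n : ℝ≥0∞) := by
  classical
  refine ⟨∑ i, if x i ∈ B then 1 else 0, ?_⟩
  rw [Measure.finsetSum_apply, Nat.cast_sum]
  refine Finset.sum_congr rfl fun i _ => ?_
  rw [Measure.dirac_apply' _ hB]
  by_cases h : x i ∈ B <;> simp [h]

end Helpers

noncomputable section

/-- `μ_𝐱 = μ + δ_{x_1} + ⋯ + δ_{x_k}`. -/
def Config.addPts {d k : ℕ} (μ : Config d) (x : Fin k → E d) : Config d :=
  ⟨μ.1 + ∑ i, Measure.dirac (x i), by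
    refine ⟨fun K hK => ?_, fun B hB => ?_⟩
    · rw [Measure.add_apply]
      exact ENNReal.add_lt_top.2 ⟨μ.2.1 K hK, measure_lt_top _ _⟩
    · obtain ⟨n, hn⟩ := μ.2.2 B hB
      obtain ⟨k, hk⟩ := sum_dirac_apply_nat x hB
      exact ⟨n + k, by rw [Measure.add_apply, hn, hk]; simp⟩⟩

open Classical in
/-- `μ - δ_𝐱 = μ - δ_{x_1} - ⋯ - δ_{x_k}`; only used when `δ_𝐱 ≤ μ` (it is `μ` otherwise). -/
def Config.removePts {d k : ℕ} (μ : Config d) (x : Fin k → E d) : Config d :=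
  if h : ∑ i, Measure.dirac (x i) ≤ μ.1 then
    ⟨μ.1 - ∑ i, Measure.dirac (x i), by
      refine ⟨fun K hK => (Measure.sub_le K).trans_lt (μ.2.1 K hK), fun B hB => ?_⟩
      obtain ⟨n, hn⟩ := μ.2.2 B hB
      obtain ⟨k, hk⟩ := sum_dirac_apply_nat x hB
      exact ⟨n - k, by rw [Measure.sub_apply hB h, hn, hk]; simp⟩⟩
  else μ

/-- The restriction `μ_B` of `μ` to `B`. -/
def Config.restr {d : ℕ} (μ : Config d) (B : Set (E d)) : Config d :=
  ⟨μ.1.restrict B, by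
    refine ⟨fun K hK => (Measure.restrict_le_self K).trans_lt (μ.2.1 K hK), fun A hA => ?_⟩
    rw [Measure.restrict_apply hA]
    exact μ.exists_enat _⟩

/-- The sum of two configurations. -/
def Config.add {d : ℕ} (μ χ : Config d) : Config d :=
  ⟨μ.1 + χ.1, by
    refine ⟨fun K hK => ?_, fun B hB => ?_⟩
    · rw [Measure.add_apply]
      exact ENNReal.add_lt_top.2 ⟨μ.2.1 K hK, χ.2.1 K hK⟩
    · obtain ⟨n, hn⟩ := μ.2.2 B hB
      obtain ⟨k, hk⟩ := χ.2.2 B hB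
      exact ⟨n + k, by rw [Measure.add_apply, hn, hk]; simp⟩⟩

/-- The points of `μ` listed with multiplicity: `x` occurs as `(x, 0), …, (x, μ {x} - 1)`, so that
`μ` is the sum of `δ_{p.1.1}` over `p : μ.Points`. -/
def Config.Points {d : ℕ} (μ : Config d) :=
  {p : E d × ℕ // (p.2 : ℝ≥0∞) < μ.1 {p.1}}

/-- The locations of an `m`-tuple of points of `μ` with pairwise different indices. The factorial
measure `μ^(m)` is the sum of the Dirac measures in `tupleOf f` over all `f : Fin m ↪ μ.Points`. -/
def Config.tupleOf {d m : ℕ} {μ : Config d} (f : Fin m ↪ μ.Points) : Fin m → E d :=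
  fun i => (f i).1.1

open Classical in
/-- `z(𝐱)`: the circumcentre of the simplex with vertices `x_1, …, x_m` (the point of their affine
hull that is equidistant to all of them) if they are affinely independent, and `0` otherwise. -/
def center {d : ℕ} : {m : ℕ} → (Fin m → E d) → E d
  | 0, _ => 0
  | _ + 1, x => if h : AffineIndependent ℝ x then
      (⟨x, h⟩ : Affine.Simplex ℝ (E d) _).circumcenter else 0

/-- The window `W_t = [0, t^{1/d}]^d`. -/
def window (d : ℕ) (t : ℝ) : Set (E d) :=
  {z | ∀ i, 0 ≤ z i ∧ z i ≤ t ^ (1 / (d : ℝ))}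

open Classical in
/-- The indicator of a proposition. -/
def ind (p : Prop) : ℝ≥0∞ := if p then 1 else 0

/-- `η` is a Poisson process with intensity measure `lam` on the probability space `(Ω, P)`. -/
structure IsPoissonProcess {d : ℕ} {Ω : Type*} [MeasurableSpace Ω] (P : Measure Ω)
    (η : Ω → Config d) (lam : Measure (E d)) : Prop where
  measurable : Measurable η
  law_finite : ∀ B : Set (E d), MeasurableSet B → lam B ≠ ∞ →
    P.map (fun ω => (η ω).1 B) =
      (poissonMeasure (lam B).toNNReal).map (fun n : ℕ => (n : ℝ≥0∞))
  law_infinite : ∀ B : Set (E d), MeasurableSet B → lam B = ∞ → ∀ᵐ ω ∂P, (η ω).1 B = ∞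
  indep : ∀ (n : ℕ) (B : Fin n → Set (E d)), (∀ i, MeasurableSet (B i)) →
    Pairwise (fun i j => Disjoint (B i) (B j)) →
    iIndepFun (fun i ω => (η ω).1 (B i)) P

/-- The `σ`-field on the system of closed sets generated by the sets `{F | F ∩ K ≠ ∅}`, `K`
compact. -/
abbrev closedsSigma (d : ℕ) : MeasurableSpace (Closeds (E d)) :=
  MeasurableSpace.generateFrom
    {A | ∃ K : Set (E d), IsCompact K ∧ A = {F : Closeds (E d) | ((F : Set (E d)) ∩ K).Nonempty}}

/-- The `σ`-field `𝒩_F` on `𝐍` generated by the maps `μ ↦ μ (B ∩ F)`, `B` Borel. -/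
abbrev sigmaOn {d : ℕ} (F : Set (E d)) : MeasurableSpace (Config d) :=
  ⨆ (B : Set (E d)) (_ : MeasurableSet B),
    MeasurableSpace.comap (fun μ : Config d => μ.1 (B ∩ F)) inferInstance

/-- Stopping sets. -/
def IsStoppingSet {d : ℕ} (S : Config d → Closeds (E d)) : Prop :=
  Measurable[inferInstance, closedsSigma d] S ∧
    ∀ F : Closeds (E d), MeasurableSet[sigmaOn (F : Set (E d))] {μ | S μ ≤ F}

/-- The closed ball `B(z, r)` with centre `z` and radius `r ∈ [0, ∞]`. -/
def cball {d : ℕ} (z : E d) (r : ℝ≥0∞) : Closeds (E d) :=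
  ⟨{y | edist y z ≤ r}, isClosed_le (by fun_prop) continuous_const⟩

/-- `S(z(𝐱), μ_𝐱) = B(z(𝐱), R(z(𝐱), μ_𝐱))`. -/
def stabBall {d m : ℕ} (R : E d → Config d → ℝ≥0∞) (x : Fin m → E d) (μ : Config d) :
    Closeds (E d) :=
  cball (center x) (R (center x) (μ.addPts x))

/-- `g` is stabilizing with stabilization radius `R`, with respect to a process `η` on `(Ω, P)`
with intensity measure `lam`. -/
structure IsStabilizing {d m : ℕ} {Ω : Type*} [MeasurableSpace Ω] (P : Measure Ω)
    (η : Ω → Config d) (lam : Measure (E d))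
    (g : (Fin m → E d) → Config d → ℝ≥0) (R : E d → Config d → ℝ≥0∞) : Prop where
  measurable_radius : Measurable (Function.uncurry R)
  radius_finite : ∀ᵐ x ∂(Measure.pi fun _ : Fin m => lam), ∀ᵐ ω ∂P,
    R (center x) ((η ω).addPts x) < ∞
  local_dependence : ∀ (x : Fin m → E d) (μ χ : Config d),
    g x μ = g x ((μ.restr (stabBall R x μ)).add (χ.restr (stabBall R x μ : Set (E d))ᶜ))
  stopping : ∀ x : Fin m → E d, IsStoppingSet (stabBall R x)
  points_mem : ∀ᵐ x ∂(Measure.pi fun _ : Fin m => lam), ∀ᵐ ω ∂P,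
    ∀ i, x i ∈ stabBall R x (η ω)

/-- `ξ_t(μ) = (1/m!) ∑_{𝐱 ∈ μ^(m)} 1{z(𝐱) ∈ W_t} g(𝐱, μ - δ_𝐱) δ_{z(𝐱)}`. -/
def xiProc {d m : ℕ} (t : ℝ) (g : (Fin m → E d) → Config d → ℝ≥0) (μ : Config d) :
    Measure (E d) :=
  ((m.factorial : ℝ≥0∞)⁻¹) • Measure.sum fun f : Fin m ↪ μ.Points =>
    (ind (center (Config.tupleOf f) ∈ window d t) *
      (g (Config.tupleOf f) (μ.removePts (Config.tupleOf f)) : ℝ≥0∞)) •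
        Measure.dirac (center (Config.tupleOf f))

/-- The rescaled random measure `t^{-1/d} ξ`: every point `z` is moved to `t^{-1/d} z`. -/
def rescale {d : ℕ} (t : ℝ) (ξ : Measure (E d)) : Measure (E d) :=
  ξ.map fun z => (t ^ (-(1 / (d : ℝ)))) • z

/-- The intensity measure `B ↦ 𝔼 ξ(B)` of a random measure `ξ`. -/
def intensity {d : ℕ} {Ω : Type*} [MeasurableSpace Ω] (P : Measure Ω)
    (ξ : Ω → Measure (E d)) : Measure (E d) :=
  P.bind ξ

/-- `κ` is a version of the family of Palm distributions `z ↦ ℙ(η^z ∈ ·)` of `η` with respect to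
the random measure `ξ`. -/
def IsPalmKernel {d : ℕ} {Ω : Type*} [MeasurableSpace Ω] (P : Measure Ω)
    (η : Ω → Config d) (ξ : Ω → Measure (E d)) (κ : Kernel (E d) (Config d)) : Prop :=
  IsMarkovKernel κ ∧ ∀ f : E d × Config d → ℝ≥0∞, Measurable f →
    ∫⁻ ω, ∫⁻ z, f (z, η ω) ∂(ξ ω) ∂P = ∫⁻ z, ∫⁻ μ, f (z, μ) ∂(κ z) ∂(intensity P ξ)

/-- The total variation distance `sup_A |ℙ(X ∈ A) - ℙ(Y ∈ A)|` of two random measures. If both take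
values in `𝐍`, then the events `{X ∈ A}`, `A` measurable in `Measure (E d)`, are those with `A`
measurable in `𝐍`. -/
def dTV {d : ℕ} {Ω Ω' : Type*} [MeasurableSpace Ω] [MeasurableSpace Ω']
    (P : Measure Ω) (P' : Measure Ω') (X : Ω → Measure (E d)) (Y : Ω' → Measure (E d)) : ℝ≥0∞ :=
  ⨆ (A : Set (Measure (E d))) (_ : MeasurableSet A),
    ENNReal.ofReal |P.real (X ⁻¹' A) - P'.real (Y ⁻¹' A)|

/-- The total variation norm `‖μ - ν‖ = (μ - ν)_+(ℝ^d) + (μ - ν)_-(ℝ^d)`, where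
`(μ - ν)_+(ℝ^d) = sup_B (μ B - ν B)`. It is infinite if one of the measures is infinite on a set
where the other one is finite. -/
def tvNorm {d : ℕ} (μ ν : Measure (E d)) : ℝ≥0∞ :=
  (⨆ (B : Set (E d)) (_ : MeasurableSet B), (μ B - ν B)) +
    ⨆ (B : Set (E d)) (_ : MeasurableSet B), (ν B - μ B)

/-- The `m`-tuple `(𝐱, 𝐮)`. -/
def join {d m l : ℕ} (x : Fin l → E d) (u : Fin (m - l) → E d) : Fin m → E d :=
  fun i => if h : (i : ℕ) < l then x ⟨i, h⟩ else u ⟨i - l, by omega⟩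

section Terms

variable {d m : ℕ} {Ω : Type*} [MeasurableSpace Ω]

/-- The term `C_1`: pairs of `m`-tuples that share `m - ℓ` points, `1 ≤ ℓ ≤ m - 1`. -/
def termC1 (P : Measure Ω) (η : Ω → Config d) (lam : Measure (E d)) (t : ℝ)
    (g : (Fin m → E d) → Config d → ℝ≥0) : ℝ≥0∞ :=
  ∑ l ∈ Finset.Ico 1 m,
    ((m.choose l : ℝ≥0∞) / ((m.factorial : ℝ≥0∞) * (l.factorial : ℝ≥0∞))) *
    ∫⁻ ω, ∫⁻ x : Fin l → E d, ∫⁻ u : Fin (m - l) → E d, ∫⁻ y : Fin l → E d,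
      ind (center (join x u : Fin m → E d) ∈ window d t) *
      ind (center (join y u : Fin m → E d) ∈ window d t) *
      (g (join x u) ((η ω).addPts y) : ℝ≥0∞) * (g (join y u) ((η ω).addPts x) : ℝ≥0∞)
      ∂(Measure.pi fun _ => lam) ∂(Measure.pi fun _ => lam) ∂(Measure.pi fun _ => lam) ∂P

/-- The term `C_2`: pairs of disjoint `m`-tuples with close centres. -/
def termC2 (P : Measure Ω) (η : Ω → Config d) (lam : Measure (E d)) (t : ℝ)
    (g : (Fin m → E d) → Config d → ℝ≥0) (b : E d → ℝ≥0) : ℝ≥0∞ :=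
  (1 / (m.factorial : ℝ≥0∞) ^ 2) *
    ∫⁻ ω, ∫⁻ x : Fin m → E d, ∫⁻ y : Fin m → E d,
      ind (center x ∈ window d t) * ind (center y ∈ window d t) *
      (g x ((η ω).addPts y) : ℝ≥0∞) * (g y ((η ω).addPts x) : ℝ≥0∞) *
      ind (dist (center x) (center y) ≤ b (center x) + b (center y))
      ∂(Measure.pi fun _ => lam) ∂(Measure.pi fun _ => lam) ∂P

/-- The term `C_3`: pairs of disjoint `m`-tuples, the first of which has a large stabilization
radius. -/
def termC3 (P : Measure Ω) (η : Ω → Config d) (lam : Measure (E d)) (t : ℝ)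
    (g : (Fin m → E d) → Config d → ℝ≥0) (R : E d → Config d → ℝ≥0∞) (b : E d → ℝ≥0) : ℝ≥0∞ :=
  (2 / (m.factorial : ℝ≥0∞) ^ 2) *
    ∫⁻ ω, ∫⁻ x : Fin m → E d, ∫⁻ y : Fin m → E d,
      ind (center x ∈ window d t) * ind (center y ∈ window d t) *
      (g x ((η ω).addPts y) : ℝ≥0∞) * (g y ((η ω).addPts x) : ℝ≥0∞) *
      ind ((b (center x) : ℝ≥0∞) < R (center x) (((η ω).addPts x).addPts y))
      ∂(Measure.pi fun _ => lam) ∂(Measure.pi fun _ => lam) ∂P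

/-- The remaining term
`∬ (2 ℙ(R(z, η^z) > b(z)) + 1{|w - z| ≤ b(w) + b(z)}) 𝔼ξ(dw) 𝔼ξ(dz)`. -/
def termPalm (κ : Kernel (E d) (Config d)) (Eξ : Measure (E d))
    (R : E d → Config d → ℝ≥0∞) (b : E d → ℝ≥0) : ℝ≥0∞ :=
  ∫⁻ z, ∫⁻ w, (2 * κ z {μ | (b z : ℝ≥0∞) < R z μ} + ind (dist w z ≤ b w + b z)) ∂Eξ ∂Eξ

end Terms

end

/-! The proof is Stein's method for Poisson process approximation, combined with a coupling provided
by the stopping set property.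

Stein equation. For the indicator `f` of an event one needs a function `D` with `f(μ) - 𝔼 f(ν) = ∫
D(x, μ - δ_x) μ(dx) - ∫ D(x, μ) 𝔼ν(dx)` for all finite `μ`. No semigroup is needed: for finite
multisets `s` and `u`, keep each point of `s` with probability `p` and each point of `u` with
probability `1 - p`, independently, and take the expectation of `f` (`biThin`). This is `f u` at `p
= 0` and `f s` at `p = 1`, and its derivative in `p` is a sum of differences of `f` over the points
of `s` minus such a sum over the points of `u`. Integration over `p` gives `sub_eq_steinDiff`;
averaging over `u = ν` turns the second sum into an integral with respect to `𝔼ν` by the Mecke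
equation (`IsMecke.exists_stein`). Moreover `|D| ≤ 1`, and one additional point changes `D` by at
most `∫ 2p dp = 1`. The code works with `Ψ = 1 + D`, so that all integrals are `ℝ≥0∞`-valued.

Reduction. Insert the process `ξ` and take expectations. Replacing `𝔼ν` by `𝔼ξ` costs the total
variation norm (`lintegral_add_le_tvNorm`). It remains to compare `𝔼 ∫ D(z, ξ - δ_z) ξ(dz)` with `∫
𝔼 D(z, ξ) 𝔼ξ(dz)`. By Mecke's formula this means, for fixed `𝐱` with centre `z` and on the event
`g(𝐱, η) = 1`, to compare `D(z, ξ(η_𝐱) - δ_z)` with `D(z, ξ(η'))`, where `η'` is an independent copy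
of `η`.

Coupling. Let `S` be the stabilization ball of `𝐱`. As `S` is a stopping set, `ζ = η_S + η'_{Sᶜ}`
has the law of `η` (`IsMecke.lintegral_resample`). It has the same ball and the same value of `g(𝐱,
·)` as `η`, and it agrees with `η'` outside `S`. A tuple whose own ball misses `S` therefore
contributes the same point to `ξ(ζ_𝐱)` and to `ξ(η')` (`Config.exists_common_part`). Apart from
`δ_z`, the two processes differ only through tuples mixing points of `𝐱` and `ζ`, tuples of points
of `ζ` whose balls meet `S`, and tuples of points of `η'` whose balls meet `S`. Two balls meet only
if the centres are at distance at most the sum of the thresholds or one of the radii exceeds its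
threshold. After another application of Mecke's formula the first kind gives `C_1` and the second
`C_2 + C_3`; independence and the Palm kernel turn the third into the last term. In the last two
cases the two radius events contribute equally, hence the factors `2`.

All facts about Poisson processes are drawn from the Mecke equation, which is proved for counts in
disjoint cells and extended by uniqueness of measures. Its multivariate form follows by removing the
points one at a time, and the resampling property by summing over the tuples that exhaust the
stopping set. -/

/-! ### Ordering the points of a counting measure on the line -/

/-- The `i`-th point, in increasing order, of a finite counting measure on the line. -/
noncomputable def realPoint (i : ℕ) (μ : Measure ℝ) : ℝ :=
  open Classical in
  if (i : ℝ≥0∞) < μ Set.univ ∧ μ Set.univ < ∞ then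
    sInf {a | ((i + 1 : ℕ) : ℝ≥0∞) ≤ μ (Set.Iic a)} else 0

/-- The distribution function of `μ` is right-continuous, so the infimum defining `realPoint` is
attained. The set is nonempty because the total mass exceeds `i`, and bounded below because the
distribution function of a finite measure vanishes at `-∞`. -/
theorem realPoint_le_iff {μ : Measure ℝ} (hμ : ∀ B, MeasurableSet B → ∃ n : ℕ∞, μ B = n)
    {i : ℕ} (h1 : (i : ℝ≥0∞) < μ Set.univ) (h2 : μ Set.univ < ∞) (a : ℝ) :
    realPoint i μ ≤ a ↔ ((i + 1 : ℕ) : ℝ≥0∞) ≤ μ (Set.Iic a) := by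
  have : IsFiniteMeasure μ := ⟨h2⟩
  rw [realPoint, if_pos ⟨h1, h2⟩]
  set S := {a | ((i + 1 : ℕ) : ℝ≥0∞) ≤ μ (Set.Iic a)} with hS
  have hmono : ∀ {a b}, a ≤ b → a ∈ S → b ∈ S := fun hab ha =>
    le_trans ha (measure_mono (Set.Iic_subset_Iic.2 hab))
  have hnot : ∀ a, a ∉ S → μ (Set.Iic a) ≤ i := by
    intro a ha
    obtain ⟨n, hn⟩ := hμ _ (measurableSet_Iic (a := a))
    have ha : ¬ ((i + 1 : ℕ) : ℝ≥0∞) ≤ μ (Set.Iic a) := ha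
    rw [hn, not_le] at ha
    rw [hn]
    lift n to ℕ using fun h => by simp [h] at ha
    norm_cast at ha ⊢
    omega
  have hne : S.Nonempty := by
    by_contra hemp
    rw [Set.not_nonempty_iff_eq_empty] at hemp
    have := le_of_tendsto' (tendsto_measure_Iic_atTop μ) (fun a => hnot a (by simp [hemp]))
    exact absurd h1 (not_lt.2 this)
  have hbdd : BddBelow S := by
    have h := tendsto_measure_iInter_atBot (μ := μ) (s := fun r : ℝ => Set.Iic r)
      (fun _ => measurableSet_Iic.nullMeasurableSet) (fun _ _ h => Set.Iic_subset_Iic.2 h)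
      ⟨0, measure_ne_top _ _⟩
    have h' : ⋂ r : ℝ, Set.Iic r = ∅ := by
      ext x
      simpa using ⟨x - 1, by linarith⟩
    rw [h', measure_empty] at h
    have := (h.eventually_lt_const (u := ((i + 1 : ℕ) : ℝ≥0∞)) (by exact_mod_cast i.succ_pos)).exists
    obtain ⟨c, hc⟩ := this
    refine ⟨c, fun a ha => ?_⟩
    by_contra hlt
    exact absurd (hmono (not_le.1 hlt).le ha) (not_le.2 hc)
  have hcl : sInf S ∈ S := by
    have h := tendsto_measure_biInter_gt (μ := μ) (s := fun r => Set.Iic r) (a := sInf S)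
      (fun r _ => measurableSet_Iic.nullMeasurableSet)
      (fun i j _ hij => Set.Iic_subset_Iic.2 hij) ⟨sInf S + 1, by simp, measure_ne_top _ _⟩
    have h' : ⋂ r > sInf S, Set.Iic r = Set.Iic (sInf S) := by
      ext x; simp only [Set.mem_iInter, Set.mem_Iic]
      exact ⟨fun h => le_of_forall_gt_imp_ge_of_dense h, fun h r hr => h.trans hr.le⟩
    rw [h'] at h
    refine ge_of_tendsto h (Filter.eventually_of_mem self_mem_nhdsWithin fun r hr => ?_)
    obtain ⟨s, hs, hsr⟩ := exists_lt_of_csInf_lt hne hr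
    exact hmono hsr.le hs
  exact ⟨fun h => hmono h hcl, fun h => csInf_le hbdd h⟩

/-- Both sides have the same distribution function: if `μ (Iic a) = k`, then exactly the points
number `0, …, k - 1` are at most `a`. -/
theorem eq_sum_dirac_realPoint {μ : Measure ℝ} (hμ : ∀ B, MeasurableSet B → ∃ n : ℕ∞, μ B = n)
    {n : ℕ} (hn : μ Set.univ = n) : μ = ∑ i : Fin n, Measure.dirac (realPoint i μ) := by
  have : IsFiniteMeasure μ := ⟨by simp [hn]⟩
  refine Measure.ext_of_Iic _ _ fun a => ?_
  obtain ⟨k, hk⟩ := hμ _ (measurableSet_Iic (a := a))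
  have hkn : μ (Set.Iic a) ≤ n := hn ▸ measure_mono (Set.subset_univ _)
  rw [hk] at hkn
  have hkn' : k ≤ n := by exact_mod_cast hkn
  lift k to ℕ using ne_top_of_le_ne_top (by simp) hkn'
  norm_cast at hkn'
  have : ∀ i : Fin n, (Measure.dirac (realPoint i μ)) (Set.Iic a) = if (i : ℕ) < k then 1 else 0 := by
    intro i
    rw [Measure.dirac_apply' _ measurableSet_Iic, Set.indicator_apply]
    have := realPoint_le_iff hμ (i := i) (by rw [hn]; exact_mod_cast i.2) (by simp [hn]) a
    rw [hk] at this
    simp only [Set.mem_Iic, this]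
    norm_cast
    simp
  rw [Measure.finsetSum_apply, Finset.sum_congr rfl (fun i _ => this i), hk]
  rw [Finset.sum_boole, ← Fintype.card_subtype]
  have : Fintype.card {x : Fin n // (x : ℕ) < k} = k := by
    rw [Fintype.card_subtype]
    simpa [hkn'] using (Fin.card_filter_val_lt (n := n) (m := k))
  simp [this]

theorem measurable_realPoint_comp {α : Type*} [MeasurableSpace α] {c : α → Measure ℝ}
    (hc : Measurable c) (hint : ∀ a B, MeasurableSet B → ∃ n : ℕ∞, c a B = n) (i : ℕ) :
    Measurable fun a => realPoint i (c a) := by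
  have hG : MeasurableSet {a | (i : ℝ≥0∞) < c a Set.univ ∧ c a Set.univ < ∞} := by
    have : Measurable fun a => c a Set.univ := (Measure.measurable_coe MeasurableSet.univ).comp hc
    exact (measurableSet_lt measurable_const this).inter (measurableSet_lt this measurable_const)
  refine measurable_of_Iic fun r => ?_
  have : (fun a => realPoint i (c a)) ⁻¹' Set.Iic r =
      ({a | (i : ℝ≥0∞) < c a Set.univ ∧ c a Set.univ < ∞} ∩
        {a | ((i + 1 : ℕ) : ℝ≥0∞) ≤ c a (Set.Iic r)}) ∪
      ({a | (i : ℝ≥0∞) < c a Set.univ ∧ c a Set.univ < ∞}ᶜ ∩ {_a | 0 ≤ r}) := by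
    ext a
    by_cases h : (i : ℝ≥0∞) < c a Set.univ ∧ c a Set.univ < ∞
    · simp [realPoint_le_iff (hint a) h.1 h.2, h]
    · simp [realPoint, h]
  rw [this]
  refine (hG.inter (measurableSet_le measurable_const ?_)).union (hG.compl.inter (.const _))
  exact (Measure.measurable_coe measurableSet_Iic).comp hc

/-! ### Measurable enumeration of finite configurations -/

namespace Config
variable {d : ℕ}

@[ext] theorem ext {μ ν : Config d} (h : ∀ B, MeasurableSet B → μ.1 B = ν.1 B) : μ = ν :=
  Subtype.ext (Measure.ext h)

theorem measurable_val {α : Type*} [MeasurableSpace α] {c : α → Config d} (hc : Measurable c) :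
    Measurable fun a => (c a).1 := measurable_subtype_coe.comp hc

theorem measurable_apply {α : Type*} [MeasurableSpace α] {c : α → Config d} (hc : Measurable c)
    {B : Set (E d)} (hB : MeasurableSet B) : Measurable fun a => (c a).1 B :=
  (Measure.measurable_coe hB).comp (measurable_val hc)

theorem measurable_of_apply {α : Type*} [MeasurableSpace α] {c : α → Config d}
    (hc : ∀ B, MeasurableSet B → Measurable fun a => (c a).1 B) : Measurable c :=
  (Measure.measurable_of_measurable_coe _ hc).subtype_mk

/-- Measurable enumeration of the points of finite configurations. -/
theorem exists_enumeration (d : ℕ) : ∃ e : ℕ → Config d → E d, (∀ i, Measurable (e i)) ∧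
    ∀ (μ : Config d) (n : ℕ), μ.1 Set.univ = n →
      μ.1 = ∑ i : Fin n, Measure.dirac (e i μ) := by
  -- A Borel embedding into the line with a measurable left inverse `ψ` transports the order, and
  -- hence the measurable enumeration, to `ℝ^d`.
  obtain ⟨φ, hφ⟩ := exists_measurableEmbedding_real (E d)
  obtain ⟨ψ, hψ, hψφ⟩ := hφ.exists_measurable_extend (measurable_id (α := E d)) fun _ => inferInstance
  have hint : ∀ (μ : Config d) (B : Set ℝ), MeasurableSet B → ∃ n : ℕ∞, μ.1.map φ B = n := by
    intro μ B hB
    rw [Measure.map_apply hφ.measurable hB]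
    exact μ.exists_enat _
  refine ⟨fun i μ => ψ (realPoint i (μ.1.map φ)), fun i => hψ.comp ?_, fun μ n hn => ?_⟩
  · exact measurable_realPoint_comp
      ((Measure.measurable_map φ hφ.measurable).comp measurable_subtype_coe) hint i
  · have h := eq_sum_dirac_realPoint (hint μ) (n := n)
      (by rw [Measure.map_apply hφ.measurable .univ]; simpa using hn)
    have h2 := congrArg (Measure.map ψ) h
    rw [Measure.map_map hψ hφ.measurable, hψφ, Measure.map_id] at h2
    rw [h2]
    ext B hB
    rw [Measure.map_apply hψ hB]
    simp only [Measure.finsetSum_apply]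
    exact Finset.sum_congr rfl fun i _ => by
      rw [Measure.dirac_apply' _ (hψ hB), Measure.dirac_apply' _ hB]; rfl
end Config

/-! ### Lists of points with multiplicity and sums over tuples of different points -/

namespace Config
variable {d : ℕ}

/-- `ℓ` lists the points of `μ` with multiplicity. -/
def IsEnum {ι : Type*} (μ : Config d) (ℓ : ι → E d) : Prop :=
  μ.1 = Measure.sum fun i => Measure.dirac (ℓ i)

theorem IsEnum.lintegral_eq {ι : Type*} {μ : Config d} {ℓ : ι → E d} (h : μ.IsEnum ℓ)
    (F : E d → ℝ≥0∞) : ∫⁻ y, F y ∂μ.1 = ∑' i, F (ℓ i) := by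
  rw [h, lintegral_sum_measure]
  exact tsum_congr fun i => lintegral_dirac _ _

theorem IsEnum.apply {ι : Type*} {μ : Config d} {ℓ : ι → E d} (h : μ.IsEnum ℓ)
    {B : Set (E d)} (hB : MeasurableSet B) : μ.1 B = ∑' i, B.indicator 1 (ℓ i) := by
  rw [← lintegral_indicator_one hB, h.lintegral_eq]

theorem IsEnum.encard_fiber {ι : Type*} {μ : Config d} {ℓ : ι → E d} (h : μ.IsEnum ℓ) (x : E d) :
    (((ℓ ⁻¹' {x}).encard : ℕ∞) : ℝ≥0∞) = μ.1 {x} := by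
  rw [h.apply (measurableSet_singleton x), ← ENNReal.tsum_set_one,
    tsum_subtype (ℓ ⁻¹' {x}) (fun _ => (1 : ℝ≥0∞))]
  rfl

theorem singleton_lt_top (μ : Config d) (x : E d) : μ.1 {x} < ∞ := μ.2.1 _ isCompact_singleton

/-- The fibres over a location have the same finite cardinality in both lists, so bijections of the
fibres can be glued. Hence sums over tuples of points may be computed with any list of the points
instead of `μ.Points`. -/
theorem exists_equiv_of_encard_fiber {ι ι' : Type*} {μ : Config d} {ℓ : ι → E d} {ℓ' : ι' → E d}
    (h : ∀ x, (((ℓ ⁻¹' {x}).encard : ℕ∞) : ℝ≥0∞) = μ.1 {x})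
    (h' : ∀ x, (((ℓ' ⁻¹' {x}).encard : ℕ∞) : ℝ≥0∞) = μ.1 {x}) :
    ∃ e : ι ≃ ι', ∀ i, ℓ' (e i) = ℓ i := by
  have key : ∀ x, Nonempty ({i // ℓ i = x} ≃ {i // ℓ' i = x}) := by
    intro x
    have h1 : (ℓ ⁻¹' {x}).encard = (ℓ' ⁻¹' {x}).encard := by
      have := (h x).trans (h' x).symm
      exact_mod_cast this
    have hfin : (ℓ ⁻¹' {x}).Finite := by
      rw [← Set.encard_lt_top_iff]
      have := (h x).trans_lt (μ.singleton_lt_top x)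
      exact_mod_cast this
    have hfin' : (ℓ' ⁻¹' {x}).Finite := by
      rw [← Set.encard_lt_top_iff, ← h1, Set.encard_lt_top_iff]; exact hfin
    have : Finite {i // ℓ i = x} := hfin
    have : Finite {i // ℓ' i = x} := hfin'
    refine Finite.card_eq.1 ?_
    have := congrArg ENat.toNat h1
    rwa [← Set.ncard_def, ← Set.ncard_def, ← Nat.card_coe_set_eq, ← Nat.card_coe_set_eq] at this
  let g := fun x => (key x).some
  refine ⟨(Equiv.sigmaFiberEquiv ℓ).symm.trans ((Equiv.sigmaCongrRight fun x => (g x)).trans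
    (Equiv.sigmaFiberEquiv ℓ')), fun i => ?_⟩
  exact ((g (ℓ i)) ⟨i, rfl⟩).2

/-- The shells `{y | k ≤ ‖y‖ < k + 1}`. -/
def shell (d k : ℕ) : Set (E d) := {y | (k : ℝ) ≤ ‖y‖ ∧ ‖y‖ < k + 1}

theorem measurableSet_shell (d k : ℕ) : MeasurableSet (shell d k) :=
  (measurableSet_le measurable_const measurable_norm).inter
    (measurableSet_lt measurable_norm measurable_const)

theorem iUnion_shell (d : ℕ) : ⋃ k, shell d k = Set.univ := by
  refine Set.eq_univ_of_forall fun y => Set.mem_iUnion.2 ⟨⌊‖y‖⌋₊, ?_, ?_⟩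
  · exact Nat.floor_le (norm_nonneg y)
  · exact Nat.lt_floor_add_one _

theorem pairwise_disjoint_shell (d : ℕ) : Pairwise (Function.onFun Disjoint (shell d)) := by
  intro i j hij
  refine Set.disjoint_left.2 fun y hi hj => hij ?_
  rw [← (Nat.floor_eq_iff (norm_nonneg y)).2 hi, ← (Nat.floor_eq_iff (norm_nonneg y)).2 hj]

theorem isBounded_shell (d k : ℕ) : Bornology.IsBounded (shell d k) :=
  (Metric.isBounded_closedBall (x := (0 : E d)) (r := k + 1)).subset fun y hy => by
    simpa using hy.2.le

theorem lt_top_of_isBounded (μ : Config d) {B : Set (E d)} (hB : Bornology.IsBounded B) :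
    μ.1 B < ∞ :=
  (measure_mono subset_closure).trans_lt (μ.2.1 _ hB.isCompact_closure)

/-- The `j`-th point of `μ` in the `k`-th shell. -/
noncomputable def shellPoint (p : ℕ × ℕ) (μ : Config d) : E d :=
  (exists_enumeration d).choose p.2 (μ.restr (shell d p.1))

theorem measurable_restr {α : Type*} [MeasurableSpace α] {c : α → Config d} (hc : Measurable c)
    {B : Set (E d)} (hB : MeasurableSet B) : Measurable fun a => (c a).restr B := by
  refine measurable_of_apply fun A hA => ?_
  simp only [restr, Measure.restrict_apply hA]
  exact measurable_apply hc (hA.inter hB)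

theorem measurable_shellPoint (p : ℕ × ℕ) : Measurable (shellPoint (d := d) p) :=
  ((exists_enumeration d).choose_spec.1 p.2).comp
    (measurable_restr measurable_id (measurableSet_shell d _))

theorem restr_shell_eq (μ : Config d) (k : ℕ) : μ.1.restrict (shell d k) =
    Measure.sum fun j : {j : ℕ // (j : ℝ≥0∞) < μ.1 (shell d k)} =>
      Measure.dirac (shellPoint (k, j.1) μ) := by
  obtain ⟨n, hn⟩ := μ.exists_enat (shell d k)
  lift n to ℕ using fun h => by
    have := μ.lt_top_of_isBounded (isBounded_shell d k)
    simp [hn, h] at this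
  have h := (exists_enumeration d).choose_spec.2 (μ.restr (shell d k)) n (by
    simpa [restr] using hn)
  have e : {j : ℕ // (j : ℝ≥0∞) < μ.1 (shell d k)} ≃ Fin n :=
    (Equiv.subtypeEquivRight fun j => by rw [hn]; norm_cast).trans Fin.equivSubtype.symm
  change (μ.restr (shell d k)).1 = _
  rw [h]
  let e : {j : ℕ // (j : ℝ≥0∞) < μ.1 (shell d k)} ≃ Fin n :=
    (Equiv.subtypeEquivRight fun j => by rw [hn]; norm_cast).trans Fin.equivSubtype.symm
  rw [← Measure.sum_fintype]
  ext B hB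
  rw [Measure.sum_apply _ hB, Measure.sum_apply _ hB, ← e.tsum_eq]
  rfl

theorem isEnum_shellPoint (μ : Config d) :
    μ.IsEnum fun p : Σ k : ℕ, {j : ℕ // (j : ℝ≥0∞) < μ.1 (shell d k)} =>
      shellPoint (p.1, p.2.1) μ := by
  have h : μ.1 = Measure.sum fun k => μ.1.restrict (shell d k) := by
    rw [← Measure.restrict_iUnion (pairwise_disjoint_shell d) (measurableSet_shell d),
      iUnion_shell, Measure.restrict_univ]
  rw [IsEnum]
  ext B hB
  nth_rewrite 1 [h]
  rw [Measure.sum_apply _ hB, Measure.sum_apply _ hB, ENNReal.tsum_sigma']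
  refine tsum_congr fun k => ?_
  rw [restr_shell_eq, Measure.sum_apply _ hB]

theorem encard_fiber_points (μ : Config d) (x : E d) :
    ((((fun p : μ.Points => p.1.1) ⁻¹' {x}).encard : ℕ∞) : ℝ≥0∞) = μ.1 {x} := by
  obtain ⟨n, hn⟩ := μ.exists_enat {x}
  lift n to ℕ using fun h => by
    have := μ.singleton_lt_top x
    simp [hn, h] at this
  let e : ((fun p : μ.Points => p.1.1) ⁻¹' {x}) ≃ Fin n :=
    { toFun := fun p => ⟨p.1.1.2, by
        have h := p.1.2
        have h2 : p.1.1.1 = x := p.2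
        rw [h2, hn] at h
        exact_mod_cast h⟩
      invFun := fun j => ⟨⟨(x, j), by rw [hn]; exact_mod_cast j.2⟩, rfl⟩
      left_inv := fun p => by
        have h2 : p.1.1.1 = x := p.2
        refine Subtype.ext (Subtype.ext (Prod.ext h2.symm rfl))
      right_inv := fun j => rfl }
  rw [hn, Set.encard_congr (t := (Set.univ : Set (Fin n))) (e.trans (Equiv.Set.univ _).symm)]
  simp

theorem isEnum_points (μ : Config d) : μ.IsEnum fun p : μ.Points => p.1.1 := by
  obtain ⟨e, he⟩ := exists_equiv_of_encard_fiber μ.isEnum_shellPoint.encard_fiber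
    μ.encard_fiber_points
  have h := μ.isEnum_shellPoint
  rw [IsEnum] at h ⊢
  nth_rewrite 1 [h]
  ext B hB
  rw [Measure.sum_apply _ hB, Measure.sum_apply _ hB, ← e.tsum_eq]
  exact tsum_congr fun i => by rw [he]

theorem IsEnum.exists_equiv {ι ι' : Type*} {μ : Config d} {ℓ : ι → E d} {ℓ' : ι' → E d}
    (h : μ.IsEnum ℓ) (h' : μ.IsEnum ℓ') : ∃ e : ι ≃ ι', ∀ i, ℓ' (e i) = ℓ i :=
  exists_equiv_of_encard_fiber h.encard_fiber h'.encard_fiber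

theorem lintegral_eq_tsum_shellPoint (μ : Config d) (F : E d → ℝ≥0∞) :
    ∫⁻ y, F y ∂μ.1 = ∑' (k : ℕ) (j : ℕ),
      {μ : Config d | (j : ℝ≥0∞) < μ.1 (shell d k)}.indicator
        (fun μ => F (shellPoint (k, j) μ)) μ := by
  rw [μ.isEnum_shellPoint.lintegral_eq, ENNReal.tsum_sigma']
  refine tsum_congr fun k => ?_
  exact tsum_subtype {j : ℕ | (j : ℝ≥0∞) < μ.1 (shell d k)} fun j => F (shellPoint (k, j) μ)

/-- The parameter enters through the measure and through the integrand. Expanding the integral into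
a countable sum over the points `shellPoint (k, j)`, which depend measurably on the configuration,
leaves only compositions of measurable maps. -/
theorem measurable_lintegral {α : Type*} [MeasurableSpace α] {c : α → Config d} (hc : Measurable c)
    {F : α → E d → ℝ≥0∞} (hF : Measurable (Function.uncurry F)) :
    Measurable fun a => ∫⁻ y, F a y ∂(c a).1 := by
  simp only [lintegral_eq_tsum_shellPoint]
  refine Measurable.tsum fun k => Measurable.tsum fun j => ?_
  have hs : MeasurableSet {a | (j : ℝ≥0∞) < (c a).1 (shell d k)} :=
    measurableSet_lt measurable_const (measurable_apply hc (measurableSet_shell d k))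
  have hm : Measurable fun a => F a (shellPoint (k, j) (c a)) :=
    hF.comp (measurable_id.prodMk ((measurable_shellPoint (k, j)).comp hc))
  exact (hm.indicator hs)

theorem measurable_apply_singleton {α : Type*} [MeasurableSpace α] {c : α → Config d}
    (hc : Measurable c) {x : α → E d} (hx : Measurable x) :
    Measurable fun a => (c a).1 {x a} := by
  have : ∀ a, (c a).1 {x a} = ∫⁻ y, {q : α × E d | q.2 = x q.1}.indicator 1 (a, y) ∂(c a).1 := by
    intro a
    rw [← lintegral_indicator_one (measurableSet_singleton _)]
    rfl
  simp only [this]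
  refine measurable_lintegral hc (F := fun a y => {q : α × E d | q.2 = x q.1}.indicator 1 (a, y)) ?_
  exact measurable_one.indicator
    (measurableSet_eq_fun measurable_snd (hx.comp measurable_fst))

theorem addPts_apply {k : ℕ} (μ : Config d) (x : Fin k → E d) {B : Set (E d)}
    (hB : MeasurableSet B) : (μ.addPts x).1 B = μ.1 B + ∑ i, B.indicator 1 (x i) := by
  simp only [addPts, Measure.add_apply, Measure.finsetSum_apply, Measure.dirac_apply' _ hB]

theorem measurable_addPts {α : Type*} [MeasurableSpace α] {k : ℕ} {c : α → Config d}
    (hc : Measurable c) {x : α → Fin k → E d} (hx : Measurable x) :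
    Measurable fun a => (c a).addPts (x a) := by
  refine measurable_of_apply fun B hB => ?_
  simp only [addPts_apply _ _ hB]
  refine (measurable_apply hc hB).add (Finset.measurable_fun_sum _ fun i _ => ?_)
  exact (measurable_one.indicator hB).comp ((measurable_pi_apply i).comp hx)

theorem measurable_add {α : Type*} [MeasurableSpace α] {c c' : α → Config d}
    (hc : Measurable c) (hc' : Measurable c') : Measurable fun a => (c a).add (c' a) := by
  refine measurable_of_apply fun B hB => ?_
  exact (measurable_apply hc hB).add (measurable_apply hc' hB)

theorem removePts_addPts {k : ℕ} (μ : Config d) (x : Fin k → E d) :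
    (μ.addPts x).removePts x = μ := by
  have h : ∑ i, Measure.dirac (x i) ≤ (μ.addPts x).1 := Measure.le_add_left le_rfl
  rw [removePts, dif_pos h]
  exact Subtype.ext Measure.add_sub_cancel

theorem addPts_removePts {k : ℕ} (μ : Config d) (x : Fin k → E d)
    (h : ∑ i, Measure.dirac (x i) ≤ μ.1) : (μ.removePts x).addPts x = μ := by
  rw [removePts, dif_pos h]
  exact Subtype.ext (Measure.sub_add_cancel_of_le h)

theorem IsEnum.apply_eq_add {ι : Type*} {μ : Config d} {ℓ : ι → E d} (h : μ.IsEnum ℓ) {m : ℕ}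
    (f : Fin m ↪ ι) {B : Set (E d)} (hB : MeasurableSet B) :
    μ.1 B = (∑' i : {i // i ∉ Set.range f}, B.indicator 1 (ℓ i)) +
      (∑ j, Measure.dirac (ℓ (f j))) B := by
  rw [h.apply hB, add_comm]
  have h1 := ENNReal.summable.tsum_add_tsum_compl (f := fun i => B.indicator (1 : E d → ℝ≥0∞) (ℓ i))
    (s := Set.range f) ENNReal.summable
  rw [← h1, Measure.finsetSum_apply]
  congr 1
  rw [← (Equiv.ofInjective f f.injective).tsum_eq, tsum_fintype]
  exact Finset.sum_congr rfl fun i _ => by rw [Measure.dirac_apply' _ hB]; rfl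

theorem IsEnum.sum_dirac_le {ι : Type*} {μ : Config d} {ℓ : ι → E d} (h : μ.IsEnum ℓ) {m : ℕ}
    (f : Fin m ↪ ι) : ∑ j, Measure.dirac (ℓ (f j)) ≤ μ.1 :=
  Measure.le_iff.2 fun B hB => by rw [h.apply_eq_add f hB]; exact le_add_self

theorem IsEnum.removePts {ι : Type*} {μ : Config d} {ℓ : ι → E d} (h : μ.IsEnum ℓ) {m : ℕ}
    (f : Fin m ↪ ι) :
    (μ.removePts (ℓ ∘ f)).IsEnum (fun i : {i // i ∉ Set.range f} => ℓ i) := by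
  have h1 := addPts_removePts μ (ℓ ∘ f) (h.sum_dirac_le f)
  rw [IsEnum]
  ext B hB
  have h2 := h.apply_eq_add f hB
  rw [← h1] at h2
  simp only [addPts, Measure.add_apply] at h2
  rw [Measure.sum_apply _ hB]
  simp only [Measure.dirac_apply' _ hB]
  exact (ENNReal.add_left_inj (measure_ne_top (∑ j, Measure.dirac (ℓ (f j))) B)).1 h2

theorem IsEnum.addPts_removePts {ι : Type*} {μ : Config d} {ℓ : ι → E d} (h : μ.IsEnum ℓ) {m : ℕ}
    (f : Fin m ↪ ι) : (μ.removePts (ℓ ∘ f)).addPts (ℓ ∘ f) = μ :=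
  Config.addPts_removePts μ (ℓ ∘ f) (h.sum_dirac_le f)

theorem IsEnum.addPts {ι : Type*} {k : ℕ} {μ : Config d} {ℓ : ι → E d} (h : μ.IsEnum ℓ)
    (x : Fin k → E d) : (μ.addPts x).IsEnum (Sum.elim x ℓ) := by
  rw [IsEnum] at *
  ext B hB
  rw [Config.addPts, Measure.add_apply, h, Measure.sum_apply _ hB,
    Measure.sum_apply _ hB, ENNReal.summable.tsum_sum ENNReal.summable, add_comm,
    Measure.finsetSum_apply, ← tsum_fintype (L := .unconditional _)]
  rfl

theorem IsEnum.restr {ι : Type*} {μ : Config d} {ℓ : ι → E d} (h : μ.IsEnum ℓ) {A : Set (E d)}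
    (hA : MeasurableSet A) : (μ.restr A).IsEnum (fun i : {i // ℓ i ∈ A} => ℓ i) := by
  rw [IsEnum]
  ext B hB
  rw [Config.restr, Measure.restrict_apply hB, h.apply (hB.inter hA), Measure.sum_apply _ hB]
  have := tsum_subtype {i | ℓ i ∈ A} fun i => B.indicator (1 : E d → ℝ≥0∞) (ℓ i)
  simp only [Measure.dirac_apply' _ hB]
  refine Eq.trans (tsum_congr fun i => ?_) this.symm
  by_cases h1 : ℓ i ∈ A <;> by_cases h2 : ℓ i ∈ B <;> simp [h1, h2]

/-- Sums over `m`-tuples of different points of `μ`, the summand depending on the tuple and on the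
configuration of the remaining points. -/
noncomputable def facSum (m : ℕ) (μ : Config d) (F : (Fin m → E d) → Config d → ℝ≥0∞) : ℝ≥0∞ :=
  ∑' f : Fin m ↪ μ.Points, F (tupleOf f) (μ.removePts (tupleOf f))

theorem IsEnum.tsum_embedding {ι : Type*} {μ : Config d} {ℓ : ι → E d} (h : μ.IsEnum ℓ) {m : ℕ}
    (F : (Fin m → E d) → ℝ≥0∞) :
    ∑' f : Fin m ↪ μ.Points, F (tupleOf f) = ∑' f : Fin m ↪ ι, F (ℓ ∘ f) := by
  obtain ⟨e, he⟩ := h.exists_equiv μ.isEnum_points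
  rw [← (Equiv.embeddingCongr (Equiv.refl (Fin m)) e).tsum_eq]
  refine tsum_congr fun f => ?_
  congr 1
  ext1 j
  exact he (f j)

theorem IsEnum.facSum_eq {ι : Type*} {μ : Config d} {ℓ : ι → E d} (h : μ.IsEnum ℓ) {m : ℕ}
    (F : (Fin m → E d) → Config d → ℝ≥0∞) :
    facSum m μ F = ∑' f : Fin m ↪ ι, F (ℓ ∘ f) (μ.removePts (ℓ ∘ f)) :=
  h.tsum_embedding fun y => F y (μ.removePts y)

theorem removePts_zero (μ : Config d) (x : Fin 0 → E d) : μ.removePts x = μ := by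
  have h := removePts_addPts μ x
  have : μ.addPts x = μ := Subtype.ext (by simp [Config.addPts])
  rwa [this] at h

theorem facSum_zero (μ : Config d) (F : (Fin 0 → E d) → Config d → ℝ≥0∞) :
    facSum 0 μ F = F Fin.elim0 μ := by
  rw [facSum, tsum_eq_single (default : Fin 0 ↪ μ.Points)
    (fun b hb => absurd (Subsingleton.elim _ _) hb), removePts_zero]
  congr 1
  exact Subsingleton.elim _ _

/-- An `(m + 1)`-tuple of different points is an `m`-tuple together with a point of what remains
after its removal. Measurability of `facSum` and the multivariate Mecke equation are both proved by
induction along this recursion. -/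
theorem facSum_succ (m : ℕ) (μ : Config d) (F : (Fin (m + 1) → E d) → Config d → ℝ≥0∞) :
    facSum (m + 1) μ F = facSum m μ fun y μ' =>
      ∫⁻ x, F (Fin.cons x y) (μ'.removePts (fun _ : Fin 1 => x)) ∂μ'.1 := by
  rw [facSum, ← (Equiv.embeddingFinSucc m μ.Points).symm.tsum_eq, ENNReal.tsum_sigma', facSum]
  refine tsum_congr fun f => ?_
  have hen := μ.isEnum_points.removePts f
  have hf : (fun p : μ.Points => p.1.1) ∘ f = tupleOf f := rfl
  rw [hf] at hen
  rw [hen.lintegral_eq]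
  refine tsum_congr fun p => ?_
  have h1 : tupleOf ((Equiv.embeddingFinSucc m μ.Points).symm ⟨f, p⟩) =
      Fin.cons p.1.1.1 (tupleOf f) := by
    ext1 j
    simp only [tupleOf, Equiv.coe_embeddingFinSucc_symm]
    refine Fin.cases ?_ (fun i => ?_) j
    · simp
    · simp only [Fin.cons_succ, tupleOf]
  rw [h1]
  congr 1
  have h2 : (μ.removePts (tupleOf f)) = (((μ.removePts (tupleOf f)).removePts
      (fun _ : Fin 1 => p.1.1.1)).addPts (fun _ : Fin 1 => p.1.1.1)) := by
    let q : Fin 1 ↪ {i // i ∉ Set.range f} := ⟨fun _ => p, fun _ _ _ => Subsingleton.elim _ _⟩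
    exact (hen.addPts_removePts q).symm
  have h3 : μ = (((μ.removePts (tupleOf f)).removePts
      (fun _ : Fin 1 => p.1.1.1)).addPts (Fin.cons p.1.1.1 (tupleOf f) : Fin (m + 1) → E d)) := by
    have h4 := (μ.isEnum_points.addPts_removePts f).symm
    rw [hf] at h4
    refine h4.trans ?_
    nth_rewrite 1 [h2]
    refine Subtype.ext ?_
    simp only [Config.addPts, Fin.sum_univ_succ, Fin.cons_zero, Fin.cons_succ]
    simp [add_assoc]
  nth_rewrite 1 [h3]
  exact removePts_addPts _ _

theorem sum_dirac_le_one_iff (μ : Config d) (x : Fin 1 → E d) :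
    ∑ i, Measure.dirac (x i) ≤ μ.1 ↔ 1 ≤ μ.1 {x 0} := by
  simp only [Finset.univ_unique, Finset.sum_singleton]
  constructor
  · intro h
    simpa using h {x 0}
  · intro h
    refine Measure.le_iff.2 fun B hB => ?_
    simp only [Fin.default_eq_zero]
    rw [Measure.dirac_apply' _ hB]
    by_cases hx : x 0 ∈ B
    · simpa [hx] using h.trans (measure_mono (Set.singleton_subset_iff.2 hx))
    · simp [hx]

theorem measurable_removePt {α : Type*} [MeasurableSpace α] {c : α → Config d} (hc : Measurable c)
    {x : α → E d} (hx : Measurable x) :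
    Measurable fun a => (c a).removePts fun _ : Fin 1 => x a := by
  refine measurable_of_apply fun B hB => ?_
  have : (fun a => ((c a).removePts fun _ : Fin 1 => x a).1 B) =
      {a | 1 ≤ (c a).1 {x a}}.piecewise (fun a => (c a).1 B - B.indicator 1 (x a))
        (fun a => (c a).1 B) := by
    classical
    ext a
    by_cases h : 1 ≤ (c a).1 {x a}
    · rw [Set.piecewise_eq_of_mem _ _ _ (show a ∈ {a | 1 ≤ (c a).1 {x a}} from h), removePts,
        dif_pos ((sum_dirac_le_one_iff (c a) _).2 h), Measure.sub_apply hB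
          ((sum_dirac_le_one_iff (c a) _).2 h)]
      simp [Measure.dirac_apply' _ hB]
    · rw [Set.piecewise_eq_of_notMem _ _ _ (show a ∉ {a | 1 ≤ (c a).1 {x a}} from h), removePts,
        dif_neg (mt (sum_dirac_le_one_iff (c a) _).1 h)]
  rw [this]
  refine Measurable.piecewise (measurableSet_le measurable_const (measurable_apply_singleton hc hx))
    ((measurable_apply hc hB).sub ?_) (measurable_apply hc hB)
  exact (measurable_one.indicator hB).comp hx

theorem measurable_finCons {α : Type*} [MeasurableSpace α] {m : ℕ} {x : α → E d}
    {y : α → Fin m → E d} (hx : Measurable x) (hy : Measurable y) :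
    Measurable fun a => (Fin.cons (x a) (y a) : Fin (m + 1) → E d) := by
  refine measurable_pi_iff.2 fun j => ?_
  refine Fin.cases ?_ (fun i => ?_) j
  · simpa using hx
  · simp only [Fin.cons_succ]
    exact (measurable_pi_apply i).comp hy

theorem measurable_facSum {m : ℕ} : ∀ {α : Type*} [MeasurableSpace α] {c : α → Config d}
    (_ : Measurable c) {F : α → (Fin m → E d) → Config d → ℝ≥0∞}
    (_ : Measurable fun q : α × (Fin m → E d) × Config d => F q.1 q.2.1 q.2.2),
    Measurable fun a => facSum m (c a) (F a) := by
  induction m with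
  | zero =>
    intro α _ c hc F hF
    simp only [facSum_zero]
    exact hF.comp (measurable_id.prodMk (measurable_const.prodMk hc))
  | succ m ih =>
    intro α _ c hc F hF
    simp only [facSum_succ]
    refine ih hc ?_
    refine measurable_lintegral (c := fun q : α × (Fin m → E d) × Config d => q.2.2)
      (F := fun q x => F q.1 (Fin.cons x q.2.1) (q.2.2.removePts fun _ : Fin 1 => x))
      (measurable_snd.comp measurable_snd) ?_
    exact hF.comp (Measurable.prodMk (by fun_prop) ((measurable_finCons (by fun_prop)
      (by fun_prop)).prodMk (measurable_removePt (by fun_prop) (by fun_prop))))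

end Config

/-! ### The Mecke equation for the counts of a Poisson process -/

theorem lintegral_poissonMeasure (r : ℝ≥0) (v : ℕ → ℝ≥0∞) : ∫⁻ n, v n ∂poissonMeasure r =
    ∑' n : ℕ, ENNReal.ofReal (Real.exp (-r) * r ^ n / n.factorial) * v n := by
  rw [poissonMeasure, lintegral_sum_measure]
  exact tsum_congr fun n => by rw [lintegral_smul_measure, lintegral_dirac]; rfl

/-- The index shift `n r^n / n! = r · r^(n-1) / (n-1)!`. This is the Mecke equation for the number
of points in a single set. -/
theorem lintegral_nat_mul_poissonMeasure (r : ℝ≥0) (v : ℕ → ℝ≥0∞) :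
    ∫⁻ n, n * v n ∂poissonMeasure r = r * ∫⁻ n, v (n + 1) ∂poissonMeasure r := by
  rw [lintegral_poissonMeasure, lintegral_poissonMeasure, tsum_eq_zero_add' ENNReal.summable,
    ← ENNReal.tsum_mul_left]
  simp only [Nat.cast_zero, zero_mul, mul_zero, zero_add]
  refine tsum_congr fun n => ?_
  rw [← mul_assoc, ← mul_assoc]
  congr 1
  rw [← ENNReal.ofReal_natCast, ← ENNReal.ofReal_coe_nnreal (p := r),
    ← ENNReal.ofReal_mul (by positivity), ← ENNReal.ofReal_mul (by positivity)]
  congr 1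
  rw [Nat.factorial_succ]
  push_cast
  field_simp
  ring

/-- Fubini isolates the coordinate `j₀`; the Poisson identity is applied to it with the other
coordinates held fixed. -/
theorem lintegral_pi_mul_poisson {n : ℕ} (L : Fin (n + 1) → Measure ℝ≥0∞)
    [∀ j, IsProbabilityMeasure (L j)] (j₀ : Fin (n + 1)) {r : ℝ≥0}
    (hL : L j₀ = (poissonMeasure r).map fun n : ℕ => (n : ℝ≥0∞))
    {u : (Fin (n + 1) → ℝ≥0∞) → ℝ≥0∞} (hu : Measurable u) :
    ∫⁻ x, x j₀ * u x ∂Measure.pi L = r * ∫⁻ x, u (x + Pi.single j₀ 1) ∂Measure.pi L := by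
  have hmp := (measurePreserving_piFinSuccAbove L j₀).symm
  set e := (MeasurableEquiv.piFinSuccAbove (fun _ : Fin (n + 1) => ℝ≥0∞) j₀).symm with he
  have he' : ∀ q, e q = Fin.insertNth (α := fun _ => ℝ≥0∞) j₀ q.1 q.2 := fun q => rfl
  have key : ∀ w : (Fin (n + 1) → ℝ≥0∞) → ℝ≥0∞, Measurable w → ∫⁻ x, w x ∂Measure.pi L =
      ∫⁻ y, ∫⁻ k, w (e ((k : ℝ≥0∞), y)) ∂(poissonMeasure r)
        ∂Measure.pi (fun j => L (j₀.succAbove j)) := by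
    intro w hw
    rw [← hmp.lintegral_comp hw, lintegral_prod_symm (fun q => w (e q)) (hw.comp hmp.measurable).aemeasurable]
    refine lintegral_congr fun y => ?_
    rw [hL, lintegral_map]
    · exact hw.comp (hmp.measurable.comp (measurable_id.prodMk measurable_const))
    · exact measurable_from_top
  rw [key (fun x => x j₀ * u x) ((measurable_pi_apply j₀).mul hu),
    key (fun x => u (x + Pi.single j₀ 1)) (hu.comp (measurable_id.add measurable_const)),
    ← lintegral_const_mul']
  · refine lintegral_congr fun y => ?_
    simp only [he', Fin.insertNth_apply_same]
    rw [lintegral_nat_mul_poissonMeasure]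
    congr 1
    refine lintegral_congr fun k => ?_
    congr 1
    ext j
    refine Fin.succAboveCases j₀ ?_ (fun i => ?_) j
    · simp
    · simp
  · simp

namespace IsPoissonProcess
variable {d : ℕ} {Ω : Type*} [MeasurableSpace Ω] {P : Measure Ω} [IsProbabilityMeasure P]
  {η : Ω → Config d} {lam : Measure (E d)}

theorem lintegral_mul_comp (h : IsPoissonProcess P η lam) {n : ℕ} {A : Fin (n + 1) → Set (E d)}
    (hA : ∀ i, MeasurableSet (A i)) (hdisj : Pairwise fun i j => Disjoint (A i) (A j))
    (j₀ : Fin (n + 1)) (hfin : lam (A j₀) ≠ ∞) {u : (Fin (n + 1) → ℝ≥0∞) → ℝ≥0∞}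
    (hu : Measurable u) :
    ∫⁻ ω, (η ω).1 (A j₀) * u (fun j => (η ω).1 (A j)) ∂P =
      lam (A j₀) * ∫⁻ ω, u ((fun j => (η ω).1 (A j)) + Pi.single j₀ 1) ∂P := by
  have hX : ∀ j, Measurable fun ω => (η ω).1 (A j) := fun j =>
    Config.measurable_apply h.measurable (hA j)
  have hX' : Measurable fun ω j => (η ω).1 (A j) := measurable_pi_iff.2 hX
  have hlaw := (iIndepFun_iff_map_fun_eq_pi_map fun j => (hX j).aemeasurable).1
    (h.indep (n + 1) A hA hdisj)
  have : ∀ j, IsProbabilityMeasure (P.map fun ω => (η ω).1 (A j)) := fun j =>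
    Measure.isProbabilityMeasure_map (hX j).aemeasurable
  have key := lintegral_pi_mul_poisson (fun j => P.map fun ω => (η ω).1 (A j)) j₀ (h.law_finite _ (hA j₀) hfin) hu
  rw [← hlaw, lintegral_map (f := fun x => x j₀ * u x) ((measurable_pi_apply j₀).mul hu) hX',
    lintegral_map (f := fun x => u (x + Pi.single j₀ 1)) (hu.comp (measurable_id.add measurable_const)) hX',
    ENNReal.coe_toNNReal hfin] at key
  exact key

/-- For `x` in the cell `A j`, adding the point `x` raises the `j`-th count by one and leaves the
other counts unchanged. So the identity for single cells, summed over `j ∈ I`, is an integral over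
`x`. -/
theorem lintegral_mul_comp_iUnion (h : IsPoissonProcess P η lam) {n : ℕ}
    {A : Fin (n + 1) → Set (E d)}
    (hA : ∀ i, MeasurableSet (A i)) (hdisj : Pairwise fun i j => Disjoint (A i) (A j))
    (I : Finset (Fin (n + 1))) (hfin : lam (⋃ j ∈ I, A j) ≠ ∞)
    {u : (Fin (n + 1) → ℝ≥0∞) → ℝ≥0∞} (hu : Measurable u) :
    ∫⁻ ω, (η ω).1 (⋃ j ∈ I, A j) * u (fun j => (η ω).1 (A j)) ∂P =
      ∫⁻ x in ⋃ j ∈ I, A j, ∫⁻ ω, u (fun j => ((η ω).addPts fun _ : Fin 1 => x).1 (A j)) ∂P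
        ∂lam := by
  have hX : Measurable fun ω j => (η ω).1 (A j) := measurable_pi_iff.2 fun j =>
    Config.measurable_apply h.measurable (hA j)
  have hd : Set.PairwiseDisjoint (I : Set (Fin (n + 1))) A := fun i _ j _ hij => hdisj hij
  rw [lintegral_biUnion_finset hd fun j _ => hA j]
  simp only [measure_biUnion_finset hd fun j _ => hA j, Finset.sum_mul]
  rw [lintegral_finsetSum]
  · refine Finset.sum_congr rfl fun j hj => ?_
    rw [h.lintegral_mul_comp hA hdisj j (ne_top_of_le_ne_top hfin
      (measure_mono (Set.subset_biUnion_of_mem (u := A) hj))) hu,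
      setLIntegral_congr_fun (hA j) (g := fun _ =>
        ∫⁻ ω, u ((fun j => (η ω).1 (A j)) + Pi.single j 1) ∂P), setLIntegral_const, mul_comm]
    intro x hx
    refine lintegral_congr fun ω => ?_
    congr 1
    ext i
    rw [Config.addPts_apply _ _ (hA i)]
    by_cases hij : i = j
    · subst hij; simp [hx]
    · have : x ∉ A i := fun hx' => Set.disjoint_left.1 (hdisj hij) hx' hx
      simp [this, hij]
  · intro j _
    exact ((measurable_pi_apply j).comp hX).mul (hu.comp hX)

/-- The cells generated by a finite family of sets. -/
def _root_.cell {α : Type*} {k : ℕ} (S : Fin k → Set α) (J : Fin k → Bool) : Set α :=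
  {x | ∀ i, x ∈ S i ↔ J i = true}

theorem _root_.measurableSet_cell {α : Type*} [MeasurableSpace α] {k : ℕ} {S : Fin k → Set α}
    (hS : ∀ i, MeasurableSet (S i)) (J : Fin k → Bool) : MeasurableSet (cell S J) := by
  have : cell S J = ⋂ i, {x | x ∈ S i ↔ J i = true} := by
    ext x; simp [cell]
  rw [this]
  refine MeasurableSet.iInter fun i => ?_
  cases J i
  · convert (hS i).compl using 1
    ext x; simp
  · convert hS i using 1
    ext x; simp

theorem _root_.disjoint_cell {α : Type*} {k : ℕ} (S : Fin k → Set α) {J J' : Fin k → Bool}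
    (h : J ≠ J') : Disjoint (cell S J) (cell S J') := by
  refine Set.disjoint_left.2 fun x hx hx' => h ?_
  ext i
  exact Bool.eq_iff_iff.2 ((hx i).symm.trans (hx' i))

/-- The sets `S i` may overlap each other and `B`. They are cut, together with `B`, into the
disjoint cells of the family `B, S 0, …`; all counts are sums of counts of cells. -/
theorem lintegral_mul_cylinder (h : IsPoissonProcess P η lam) {k : ℕ} {S : Fin k → Set (E d)}
    (hS : ∀ i, MeasurableSet (S i)) {B : Set (E d)} (hB : MeasurableSet B) (hfin : lam B ≠ ∞)
    {u : (Fin k → ℝ≥0∞) → ℝ≥0∞} (hu : Measurable u) :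
    ∫⁻ ω, (η ω).1 B * u (fun j => (η ω).1 (S j)) ∂P =
      ∫⁻ x in B, ∫⁻ ω, u (fun j => ((η ω).addPts fun _ : Fin 1 => x).1 (S j)) ∂P ∂lam := by
  classical
  let S' : Fin (k + 1) → Set (E d) := Fin.cons B S
  have hS' : ∀ i, MeasurableSet (S' i) := fun i => Fin.cases hB hS i
  obtain ⟨n, hn⟩ : ∃ n, Fintype.card (Fin (k + 1) → Bool) = n + 1 :=
    ⟨_, (Nat.succ_pred_eq_of_pos Fintype.card_pos).symm⟩
  let e : Fin (n + 1) ≃ (Fin (k + 1) → Bool) := (Fintype.equivFinOfCardEq hn).symm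
  let A : Fin (n + 1) → Set (E d) := fun j => cell S' (e j)
  have hA : ∀ j, MeasurableSet (A j) := fun j => measurableSet_cell hS' _
  have hdisj : Pairwise fun i j => Disjoint (A i) (A j) := fun i j hij =>
    disjoint_cell S' fun h => hij (e.injective h)
  have hU : ∀ i, S' i = ⋃ j ∈ Finset.univ.filter (fun j => e j i = true), A j := by
    intro i
    ext x
    simp only [Set.mem_iUnion, Finset.mem_filter, Finset.mem_univ, true_and, exists_prop]
    constructor
    · intro hx
      refine ⟨e.symm fun i => decide (x ∈ S' i), by simpa using hx, ?_⟩
      intro i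
      simp
    · rintro ⟨j, hj, hx⟩
      exact (hx i).2 hj
  have hsum : ∀ (μ : Config d) (i : Fin (k + 1)), μ.1 (S' i) =
      ∑ j ∈ Finset.univ.filter (fun j => e j i = true), μ.1 (A j) := by
    intro μ i
    nth_rewrite 1 [hU i]
    exact measure_biUnion_finset (fun a _ b _ hab => hdisj hab) fun j _ => hA j
  have hB' : B = ⋃ j ∈ Finset.univ.filter (fun j => e j 0 = true), A j := hU 0
  have key := h.lintegral_mul_comp_iUnion hA hdisj
    (Finset.univ.filter (fun j => e j 0 = true)) (by rwa [← hB'])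
    (u := fun x => u fun i => ∑ j ∈ Finset.univ.filter (fun j => e j i.succ = true), x j)
    (hu.comp (measurable_pi_iff.2 fun i => Finset.measurable_fun_sum _ fun j _ =>
      measurable_pi_apply j))
  simp only [← hB', ← hsum] at key
  exact key

theorem isProbabilityMeasure_map (h : IsPoissonProcess P η lam) :
    IsProbabilityMeasure (P.map η) :=
  Measure.isProbabilityMeasure_map h.measurable.aemeasurable

theorem lintegral_apply (h : IsPoissonProcess P η lam) {B : Set (E d)} (hB : MeasurableSet B)
    (hfin : lam B ≠ ∞) : ∫⁻ ω, (η ω).1 B ∂P = lam B := by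
  simpa using h.lintegral_mul_cylinder (k := 0) (S := Fin.elim0) (by simp) hB hfin
    (u := fun _ => 1) measurable_const

/-- Finite dimensional events. -/
def _root_.cylinders (d : ℕ) : Set (Set (Config d)) :=
  {C | ∃ (k : ℕ) (S : Fin k → Set (E d)) (T : Set (Fin k → ℝ≥0∞)), (∀ i, MeasurableSet (S i)) ∧
    MeasurableSet T ∧ C = {μ | (fun i => μ.1 (S i)) ∈ T}}

theorem _root_.isPiSystem_cylinders (d : ℕ) : IsPiSystem (cylinders d) := by
  rintro _ ⟨k, S, T, hS, hT, rfl⟩ _ ⟨k', S', T', hS', hT', rfl⟩ _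
  refine ⟨k + k', Fin.append S S', {x | (fun i => x (Fin.castAdd k' i)) ∈ T} ∩
    {x | (fun i => x (Fin.natAdd k i)) ∈ T'}, ?_, ?_, ?_⟩
  · exact fun i => Fin.addCases (by simpa using hS) (by simpa using hS') i
  · exact ((measurable_pi_iff.2 fun i => measurable_pi_apply _) hT).inter
      ((measurable_pi_iff.2 fun i => measurable_pi_apply _) hT')
  · ext μ
    simp

theorem _root_.generateFrom_cylinders (d : ℕ) :
    (inferInstance : MeasurableSpace (Config d)) = MeasurableSpace.generateFrom (cylinders d) := by
  refine le_antisymm ?_ (MeasurableSpace.generateFrom_le ?_)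
  · have : @Measurable _ _ (MeasurableSpace.generateFrom (cylinders d)) inferInstance
        (id : Config d → Config d) := by
      exact @Config.measurable_of_apply d (Config d) (MeasurableSpace.generateFrom (cylinders d)) id
        (fun B hB T hT => MeasurableSpace.measurableSet_generateFrom
          ⟨1, fun _ => B, {x | x 0 ∈ T}, fun _ => hB, measurable_pi_apply 0 hT, rfl⟩)
    intro s hs
    exact this hs
  · rintro _ ⟨k, S, T, hS, hT, rfl⟩
    exact (measurable_pi_iff.2 fun i => Config.measurable_apply measurable_id (hS i)) hT

/-- Both sides are finite measures in `T` of total mass `lam B`. They agree on the cylinder events,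
a generating `π`-system. -/
theorem lintegral_mul_indicator (h : IsPoissonProcess P η lam) [IsLocallyFiniteMeasure lam]
    {B : Set (E d)} (hB : MeasurableSet B)
    (hfin : lam B ≠ ∞) {T : Set (Config d)} (hT : MeasurableSet T) :
    ∫⁻ ω, (η ω).1 B * T.indicator 1 (η ω) ∂P =
      ∫⁻ x in B, ∫⁻ ω, T.indicator 1 ((η ω).addPts fun _ : Fin 1 => x) ∂P ∂lam := by
  have := h.isProbabilityMeasure_map
  let Q := P.map η
  let M1 : Measure (Config d) := Q.withDensity fun μ => μ.1 B
  have hadd : Measurable fun q : E d × Config d => q.2.addPts fun _ : Fin 1 => q.1 :=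
    Config.measurable_addPts measurable_snd (measurable_pi_iff.2 fun _ => measurable_fst)
  let M2 : Measure (Config d) := ((lam.restrict B).prod Q).map
    fun q => q.2.addPts fun _ : Fin 1 => q.1
  have h1 : ∀ T, MeasurableSet T → M1 T = ∫⁻ ω, (η ω).1 B * T.indicator 1 (η ω) ∂P := by
    intro T hT
    have hm : Measurable fun μ : Config d => μ.1 B := Config.measurable_apply measurable_id hB
    rw [← lintegral_indicator_one hT, lintegral_withDensity_eq_lintegral_mul _ hm
      (measurable_one.indicator hT), lintegral_map (hm.mul (measurable_one.indicator hT))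
        h.measurable]
    rfl
  have h2 : ∀ T, MeasurableSet T → M2 T =
      ∫⁻ x in B, ∫⁻ ω, T.indicator 1 ((η ω).addPts fun _ : Fin 1 => x) ∂P ∂lam := by
    intro T hT
    have hm : Measurable fun q : E d × Config d =>
        T.indicator (1 : Config d → ℝ≥0∞) (q.2.addPts fun _ : Fin 1 => q.1) :=
      (measurable_one.indicator hT).comp hadd
    rw [← lintegral_indicator_one hT, lintegral_map (measurable_one.indicator hT) hadd,
      lintegral_prod _ hm.aemeasurable]
    refine lintegral_congr fun x => ?_
    exact lintegral_map (hm.comp measurable_prodMk_left) h.measurable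
  have hcyl : ∀ C ∈ cylinders d, M1 C = M2 C := by
    intro C hC
    have hCm : MeasurableSet C := by
      have := MeasurableSpace.measurableSet_generateFrom hC
      rwa [← generateFrom_cylinders] at this
    obtain ⟨k, S, T, hS, hT, rfl⟩ := hC
    rw [h1 _ hCm, h2 _ hCm]
    exact h.lintegral_mul_cylinder hS hB hfin (measurable_one.indicator hT)
  have huniv : Set.univ ∈ cylinders d :=
    ⟨0, Fin.elim0, Set.univ, fun i => i.elim0, .univ, by simp⟩
  have : IsFiniteMeasure M1 := ⟨by
    rw [h1 _ .univ]
    simpa [h.lintegral_apply hB hfin] using hfin.lt_top⟩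
  rw [← h1 T hT, ← h2 T hT, ext_of_generate_finite _ (generateFrom_cylinders d)
    (isPiSystem_cylinders d) hcyl (hcyl _ huniv)]
end IsPoissonProcess

/-! ### The Mecke equation and its multivariate form -/

/-- The (univariate) Mecke equation for a law `Q` on configurations and a measure `lam`. -/
def IsMecke {d : ℕ} (Q : Measure (Config d)) (lam : Measure (E d)) : Prop :=
  ∀ F : E d → Config d → ℝ≥0∞, Measurable (Function.uncurry F) →
    ∫⁻ μ, ∫⁻ x, F x μ ∂μ.1 ∂Q = ∫⁻ x, ∫⁻ μ, F x (μ.addPts fun _ : Fin 1 => x) ∂Q ∂lam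

theorem measure_shell_ne_top {d : ℕ} (lam : Measure (E d)) [IsLocallyFiniteMeasure lam] (k : ℕ) :
    lam (Config.shell d k) ≠ ∞ :=
  ((measure_mono subset_closure).trans_lt
    (Config.isBounded_shell d k).isCompact_closure.measure_lt_top).ne

theorem lintegral_eq_tsum_shell {d : ℕ} (lam : Measure (E d)) (F : E d → ℝ≥0∞) :
    ∫⁻ x, F x ∂lam = ∑' k, ∫⁻ x in Config.shell d k, F x ∂lam := by
  rw [← lintegral_iUnion (Config.measurableSet_shell d) (Config.pairwise_disjoint_shell d),
    Config.iUnion_shell, Measure.restrict_univ]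

namespace IsPoissonProcess
variable {d : ℕ} {Ω : Type*} [MeasurableSpace Ω] {P : Measure Ω} [IsProbabilityMeasure P]
  {η : Ω → Config d} {lam : Measure (E d)}

/-- Restricted to a bounded shell, both sides are integrals of `F` with respect to measures on `E d
× Config d`, one of them visibly finite, which agree on all rectangles by `lintegral_mul_indicator`.
Summation over the shells gives the claim. -/
theorem isMecke (h : IsPoissonProcess P η lam) [IsLocallyFiniteMeasure lam] :
    IsMecke (P.map η) lam := by
  have := h.isProbabilityMeasure_map
  intro F hF
  have hadd : Measurable fun q : E d × Config d => q.2.addPts fun _ : Fin 1 => q.1 :=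
    Config.measurable_addPts measurable_snd (measurable_pi_iff.2 fun _ => measurable_fst)
  have hres : ∀ k, Measurable fun μ : Config d => μ.restr (Config.shell d k) := fun k =>
    Config.measurable_restr measurable_id (Config.measurableSet_shell d k)
  rw [lintegral_eq_tsum_shell lam,
    lintegral_congr fun μ : Config d => lintegral_eq_tsum_shell μ.1 fun x => F x μ, lintegral_tsum]
  swap
  · intro k
    exact (Config.measurable_lintegral (hres k)
      (F := fun μ x => F x μ) (hF.comp measurable_swap)).aemeasurable
  refine tsum_congr fun k => ?_
  set s := Config.shell d k with hs
  have hsm : MeasurableSet s := Config.measurableSet_shell d k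
  let c : Config d → Measure (E d × Config d) := fun μ => (μ.1.restrict s).map fun x => (x, μ)
  have hcl : ∀ G : E d × Config d → ℝ≥0∞, Measurable G → ∀ μ,
      ∫⁻ q, G q ∂(c μ) = ∫⁻ x in s, G (x, μ) ∂μ.1 := fun G hG μ =>
    lintegral_map hG measurable_prodMk_right
  have hc : Measurable c := by
    refine Measure.measurable_of_measurable_coe _ fun T hT => ?_
    simp only [← lintegral_indicator_one hT, hcl _ (measurable_one.indicator hT)]
    exact Config.measurable_lintegral (hres k) (F := fun μ x => T.indicator 1 (x, μ))
      ((measurable_one.indicator hT).comp measurable_swap)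
  let N1 := (P.map η).bind c
  let N2 := ((lam.restrict s).prod (P.map η)).map fun q => (q.1, q.2.addPts fun _ : Fin 1 => q.1)
  have hN1 : ∀ G : E d × Config d → ℝ≥0∞, Measurable G →
      ∫⁻ q, G q ∂N1 = ∫⁻ μ, ∫⁻ x in s, G (x, μ) ∂μ.1 ∂(P.map η) := by
    intro G hG
    rw [Measure.lintegral_bind hc.aemeasurable hG.aemeasurable]
    simp only [hcl G hG]
  have hN2 : ∀ G : E d × Config d → ℝ≥0∞, Measurable G → ∫⁻ q, G q ∂N2 =
      ∫⁻ x in s, ∫⁻ μ, G (x, μ.addPts fun _ : Fin 1 => x) ∂(P.map η) ∂lam := by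
    intro G hG
    rw [lintegral_map hG (measurable_fst.prodMk hadd),
      lintegral_prod (fun q : E d × Config d => G (q.1, q.2.addPts fun _ : Fin 1 => q.1))
        (hG.comp (measurable_fst.prodMk hadd)).aemeasurable]
  have hrect : ∀ {A : Set (E d)} {T : Set (Config d)}, MeasurableSet A → MeasurableSet T →
      N1 (A ×ˢ T) = N2 (A ×ˢ T) := by
    intro A T hA hT
    have hm : Measurable fun μ : Config d => μ.1 (A ∩ s) :=
      Config.measurable_apply measurable_id (hA.inter hsm)
    have hfin : lam (A ∩ s) ≠ ∞ := ne_top_of_le_ne_top (measure_shell_ne_top lam k)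
      (measure_mono Set.inter_subset_right)
    have key := h.lintegral_mul_indicator (hA.inter hsm) hfin hT
    rw [← lintegral_map (f := fun μ : Config d => μ.1 (A ∩ s) * T.indicator 1 μ)
      (hm.mul (measurable_one.indicator hT)) h.measurable] at key
    have hm2 : ∀ x, Measurable fun μ : Config d =>
        T.indicator (1 : Config d → ℝ≥0∞) (μ.addPts fun _ : Fin 1 => x) := fun x =>
      (measurable_one.indicator hT).comp
        (Config.measurable_addPts measurable_id measurable_const)
    simp only [← lintegral_map (hm2 _) h.measurable] at key
    rw [← lintegral_indicator_one (hA.prod hT), ← lintegral_indicator_one (hA.prod hT),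
      hN1 _ (measurable_one.indicator (hA.prod hT)), hN2 _ (measurable_one.indicator (hA.prod hT))]
    have e : ∀ (x : E d) (μ : Config d), (A ×ˢ T).indicator (1 : E d × Config d → ℝ≥0∞) (x, μ) =
        A.indicator 1 x * T.indicator 1 μ := fun x μ => by
      by_cases h1 : x ∈ A <;> by_cases h2 : μ ∈ T <;> simp [h1, h2]
    simp only [e]
    have e1 : ∀ μ : Config d, ∫⁻ x in s, A.indicator 1 x * T.indicator 1 μ ∂μ.1 =
        μ.1 (A ∩ s) * T.indicator 1 μ := by
      intro μ
      rw [lintegral_mul_const _ (measurable_one.indicator hA), lintegral_indicator_one hA,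
        Measure.restrict_apply hA]
    simp only [e1]
    rw [key, ← Measure.restrict_restrict hA, ← lintegral_indicator hA]
    refine lintegral_congr fun x => ?_
    by_cases hx : x ∈ A
    · simp [hx]
    · simp [hx]
  have : IsFiniteMeasure N2 := by
    have : IsFiniteMeasure (lam.restrict s) := ⟨by
      simpa using (measure_shell_ne_top lam k).lt_top⟩
    infer_instance
  have hN : N2 = N1 := Measure.ext_prod fun hA hT => (hrect hA hT).symm
  have h1 := hN1 _ hF
  rw [← hN, hN2 _ hF] at h1
  exact h1.symm
end IsPoissonProcess

namespace IsMecke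
open Config
variable {d : ℕ} {Q : Measure (Config d)} {lam : Measure (E d)}

/-- The form of the Mecke equation that can be iterated: `F` sees the configuration without the
point `x`, so no point has to be added on the right-hand side. -/
theorem lintegral_removePt (h : IsMecke Q lam) {F : E d → Config d → ℝ≥0∞}
    (hF : Measurable (Function.uncurry F)) :
    ∫⁻ μ, ∫⁻ x, F x (μ.removePts fun _ : Fin 1 => x) ∂μ.1 ∂Q = ∫⁻ x, ∫⁻ μ, F x μ ∂Q ∂lam := by
  rw [h fun x μ => F x (μ.removePts fun _ : Fin 1 => x)]
  · simp only [removePts_addPts]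
  · exact hF.comp (measurable_fst.prodMk (measurable_removePt measurable_snd measurable_fst))

/-- The multivariate Mecke equation. -/
theorem lintegral_facSum [SigmaFinite lam] [SFinite Q] (h : IsMecke Q lam) {m : ℕ}
    {F : (Fin m → E d) → Config d → ℝ≥0∞} (hF : Measurable (Function.uncurry F)) :
    ∫⁻ μ, facSum m μ F ∂Q = ∫⁻ x, ∫⁻ μ, F x μ ∂Q ∂(Measure.pi fun _ : Fin m => lam) := by
  induction m with
  | zero =>
    simp only [facSum_zero]
    rw [Measure.pi_of_empty (fun _ : Fin 0 => lam) Fin.elim0, lintegral_dirac]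
  | succ m ih =>
    simp only [facSum_succ]
    -- The induction hypothesis handles the tuple `y`, with the sum over the last chosen point `x`
    -- as integrand; the univariate equation then removes `x` for each fixed `y`.
    rw [ih]
    swap
    · refine measurable_lintegral (c := fun q : (Fin m → E d) × Config d => q.2)
        (F := fun q x => F (Fin.cons x q.1) (q.2.removePts fun _ : Fin 1 => x)) measurable_snd ?_
      exact hF.comp (Measurable.prodMk (measurable_finCons (by fun_prop) (by fun_prop))
        (measurable_removePt (by fun_prop) (by fun_prop)))
    have h1 : ∀ y : Fin m → E d, ∫⁻ μ, ∫⁻ x, F (Fin.cons x y) (μ.removePts fun _ : Fin 1 => x)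
        ∂μ.1 ∂Q = ∫⁻ x, ∫⁻ μ, F (Fin.cons x y) μ ∂Q ∂lam := fun y =>
      h.lintegral_removePt (F := fun x μ => F (Fin.cons x y) μ)
        (hF.comp (Measurable.prodMk (measurable_finCons (by fun_prop) (by fun_prop))
          measurable_snd))
    simp only [h1]
    have hG : Measurable fun x : Fin (m + 1) → E d => ∫⁻ μ, F x μ ∂Q := hF.lintegral_prod_right
    have hmp := (measurePreserving_piFinSuccAbove (fun _ : Fin (m + 1) => lam) 0).symm
    rw [← hmp.lintegral_comp hG, lintegral_prod_symm (fun q : E d × (Fin m → E d) =>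
      ∫⁻ μ, F ((MeasurableEquiv.piFinSuccAbove (fun _ => E d) 0).symm q) μ ∂Q)
      (hG.comp hmp.measurable).aemeasurable]
    have e : ∀ q : E d × (Fin m → E d), (MeasurableEquiv.piFinSuccAbove (fun _ => E d) 0).symm q =
        (Fin.cons q.1 q.2 : Fin (m + 1) → E d) := fun q => Fin.insertNth_zero' _ _
    simp only [e]
end IsMecke

/-! ### Independence outside a fixed set and resampling outside a stopping set -/

theorem ind_pos {p : Prop} (h : p) : ind p = 1 := if_pos h

theorem ind_neg {p : Prop} (h : ¬p) : ind p = 0 := if_neg h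

theorem measurableSet_and {α : Type*} [MeasurableSpace α] {p q : α → Prop}
    (hp : MeasurableSet {a | p a}) (hq : MeasurableSet {a | q a}) :
    MeasurableSet {a | p a ∧ q a} := hp.inter hq

theorem measurableSet_forall {α ι : Type*} [Countable ι] [MeasurableSpace α] {p : ι → α → Prop}
    (hp : ∀ i, MeasurableSet {a | p i a}) : MeasurableSet {a | ∀ i, p i a} := by
  have : {a | ∀ i, p i a} = ⋂ i, {a | p i a} := by ext; simp
  rw [this]
  exact MeasurableSet.iInter hp

namespace Config
variable {d : ℕ}

theorem facSum_congr {m : ℕ} {μ : Config d} {F F' : (Fin m → E d) → Config d → ℝ≥0∞}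
    (h : ∀ y μ', μ'.addPts y = μ → F y μ' = F' y μ') : facSum m μ F = facSum m μ F' :=
  tsum_congr fun f => h _ _ (μ.isEnum_points.addPts_removePts f)

theorem facSum_mono {m : ℕ} {μ : Config d} {F F' : (Fin m → E d) → Config d → ℝ≥0∞}
    (h : ∀ y μ', μ'.addPts y = μ → F y μ' ≤ F' y μ') : facSum m μ F ≤ facSum m μ F' :=
  ENNReal.tsum_le_tsum fun f => h _ _ (μ.isEnum_points.addPts_removePts f)

theorem facSum_mul_const {m : ℕ} {μ : Config d} (F : (Fin m → E d) → Config d → ℝ≥0∞)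
    (c : ℝ≥0∞) : facSum m μ (fun y μ' => F y μ' * c) = facSum m μ F * c :=
  ENNReal.tsum_mul_right

theorem facSum_add {m : ℕ} {μ : Config d} (F F' : (Fin m → E d) → Config d → ℝ≥0∞) :
    facSum m μ (fun y μ' => F y μ' + F' y μ') = facSum m μ F + facSum m μ F' :=
  ENNReal.tsum_add

theorem addPts_apply_of_forall_mem {n : ℕ} (μ : Config d) {y : Fin n → E d} {B : Set (E d)}
    (hB : MeasurableSet B) (hy : ∀ i, y i ∈ B) : (μ.addPts y).1 B = μ.1 B + n := by
  rw [addPts_apply _ _ hB]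
  simp [hy]

/-- The tuples that exhaust the points of `μ` in `B`. -/
theorem facSum_exhaust (n : ℕ) (μ : Config d) {B : Set (E d)} (hB : MeasurableSet B) :
    facSum n μ (fun y μ' => ind ((∀ i, y i ∈ B) ∧ μ'.1 B = 0)) =
      n.factorial * ind (μ.1 B = n) := by
  classical
  by_cases h : μ.1 B = n
  · rw [ind_pos h, mul_one]
    let T : Set μ.Points := {p | p.1.1 ∈ B}
    have hT : ((T.encard : ℕ∞) : ℝ≥0∞) = n := by
      rw [← h, μ.isEnum_points.apply hB, ← ENNReal.tsum_set_one,
        tsum_subtype T (fun _ => (1 : ℝ≥0∞))]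
      rfl
    have hT' : T.encard = n := by exact_mod_cast hT
    have hTf : Finite T := Set.finite_of_encard_eq_coe hT'
    have : Fintype T := Fintype.ofFinite T
    have hcard : Fintype.card T = n := by
      rw [← Set.toFinset_card, ← ENat.natCast_inj, ← hT', Set.encard_eq_coe_toFinset_card]
    -- Only tuples from the `n`-element set `T` contribute, and each of its `n!` orderings does: the
    -- tuple uses up all the mass in `B`, so nothing is left there.
    let Φ : (Fin n ↪ T) → (Fin n ↪ μ.Points) := fun f => f.trans (Function.Embedding.subtype _)
    have hΦ : Function.Injective Φ := fun f g hfg => by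
      ext i
      exact congrArg Subtype.val (Subtype.ext (DFunLike.congr_fun hfg i))
    rw [facSum, ← hΦ.tsum_eq]
    · have : ∀ f : Fin n ↪ T, ind ((∀ i, tupleOf (Φ f) i ∈ B) ∧
          (μ.removePts (tupleOf (Φ f))).1 B = 0) = 1 := by
        intro f
        have hf : ∀ i, tupleOf (Φ f) i ∈ B := fun i => (f i).2
        have h2 := addPts_apply_of_forall_mem (μ.removePts (tupleOf (Φ f))) hB hf
        have h3 : (μ.removePts (tupleOf (Φ f))).addPts (tupleOf (Φ f)) = μ :=
          μ.isEnum_points.addPts_removePts (Φ f)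
        rw [h3, h] at h2
        refine ind_pos ⟨hf, ?_⟩
        have h4 : (n : ℝ≥0∞) + 0 = n + (μ.removePts (tupleOf (Φ f))).1 B := by
          rw [add_zero, add_comm]; exact h2
        exact ((ENNReal.add_right_inj (by simp)).1 h4).symm
      rw [tsum_congr this, tsum_fintype]
      simp [Fintype.card_embedding_eq, hcard, Nat.descFactorial_self]
    · intro f hf
      have hf' : ∀ i, tupleOf f i ∈ B := by
        by_contra hcon
        exact hf (ind_neg fun h => hcon h.1)
      exact ⟨⟨fun i => ⟨f i, hf' i⟩, fun i j hij => f.injective (congrArg Subtype.val hij)⟩,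
        by ext i; rfl⟩
  · rw [ind_neg h, mul_zero]
    have : facSum n μ (fun y μ' => ind ((∀ i, y i ∈ B) ∧ μ'.1 B = 0)) =
        facSum n μ (fun _ _ => 0) := by
      refine facSum_congr fun y μ' hy => ind_neg fun hcon => h ?_
      rw [← hy, addPts_apply_of_forall_mem μ' hB hcon.1, hcon.2, zero_add]
    rw [this]
    simp [facSum]

theorem measurable_ind {α : Type*} [MeasurableSpace α] {p : α → Prop}
    (hp : MeasurableSet {a | p a}) : Measurable fun a => ind (p a) := by
  classical
  exact Measurable.ite hp measurable_const measurable_const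

instance : Zero (Config d) := ⟨⟨0, by simp, fun B _ => ⟨0, by simp⟩⟩⟩

theorem zero_val : (0 : Config d).1 = 0 := rfl

theorem restr_congr_of_subset {μ μ' : Config d} {A B : Set (E d)} (hAB : A ⊆ B)
    (h : μ.restr B = μ'.restr B) : μ.restr A = μ'.restr A := by
  have := congrArg Subtype.val h
  refine Subtype.ext ?_
  simp only [restr] at this ⊢
  rw [← Measure.restrict_restrict_of_subset hAB, this, Measure.restrict_restrict_of_subset hAB]

theorem restr_add_restr_compl (μ : Config d) {B : Set (E d)} (hB : MeasurableSet B) :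
    (μ.restr B).add (μ.restr Bᶜ) = μ :=
  Subtype.ext (Measure.restrict_add_restrict_compl hB)

theorem restr_addPts_of_forall_notMem {n : ℕ} (μ : Config d) {y : Fin n → E d} {B : Set (E d)}
    (hB : MeasurableSet B) (hy : ∀ i, y i ∉ B) : (μ.addPts y).restr B = μ.restr B := by
  ext A hA
  simp only [restr, Measure.restrict_apply hA, addPts_apply _ _ (hA.inter hB)]
  simp [hy]

theorem restr_addPts_of_void {n : ℕ} {μ : Config d} {y : Fin n → E d} {B : Set (E d)}
    (hB : MeasurableSet B) (h0 : μ.1 B = 0) :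
    (μ.addPts y).restr B = ((0 : Config d).addPts y).restr B := by
  ext A hA
  simp only [restr, Measure.restrict_apply hA, addPts_apply _ _ (hA.inter hB), zero_val]
  rw [measure_mono_null Set.inter_subset_right h0]
  simp

theorem restr_eq_self_of_compl {μ : Config d} {B : Set (E d)}
    (h0 : μ.1 Bᶜ = 0) : μ.restr B = μ :=
  Subtype.ext (by simpa [restr] using Measure.restrict_eq_self_of_ae_mem (s := B) (by
    rw [Filter.Eventually, mem_ae_iff]; exact h0))

theorem measurable_restr_of_measurableSet {α : Type*} [MeasurableSpace α] {c : α → Config d}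
    (hc : Measurable c) {S : α → Set (E d)} (hS : ∀ a, MeasurableSet (S a))
    (hS' : MeasurableSet {q : α × E d | q.2 ∈ S q.1}) :
    Measurable fun a => (c a).restr (S a) := by
  refine measurable_of_apply fun B hB => ?_
  have : ∀ a, ((c a).restr (S a)).1 B =
      ∫⁻ y, ({q : α × E d | q.2 ∈ S q.1} ∩ Prod.snd ⁻¹' B).indicator 1 (a, y) ∂(c a).1 := by
    intro a
    rw [restr, Measure.restrict_apply hB, ← lintegral_indicator_one (hB.inter (hS a))]
    refine lintegral_congr fun y => ?_
    by_cases h1 : y ∈ B <;> by_cases h2 : y ∈ S a <;> simp [h1, h2]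
  simp only [this]
  exact measurable_lintegral hc (F := fun a y =>
    ({q : α × E d | q.2 ∈ S q.1} ∩ Prod.snd ⁻¹' B).indicator 1 (a, y))
    (measurable_one.indicator (hS'.inter (measurable_snd hB)))

theorem measurable_apply_of_measurableSet {α : Type*} [MeasurableSpace α] {c : α → Config d}
    (hc : Measurable c) {S : α → Set (E d)} (hS : ∀ a, MeasurableSet (S a))
    (hS' : MeasurableSet {q : α × E d | q.2 ∈ S q.1}) :
    Measurable fun a => (c a).1 (S a) := by
  have h := measurable_apply (measurable_restr_of_measurableSet hc hS hS') .univ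
  simpa [restr] using h
end Config

namespace IsMecke
open Config
variable {d : ℕ} {Q : Measure (Config d)} {lam : Measure (E d)}

theorem lintegral_apply [IsProbabilityMeasure Q] (h : IsMecke Q lam) {B : Set (E d)}
    (hB : MeasurableSet B) : ∫⁻ μ, μ.1 B ∂Q = lam B := by
  have := h (fun x _ => B.indicator 1 x) ((measurable_one.indicator hB).comp measurable_fst)
  simpa [lintegral_indicator_one hB] using this

theorem ae_apply_lt_top [IsProbabilityMeasure Q] (h : IsMecke Q lam) {B : Set (E d)}
    (hB : MeasurableSet B) (hfin : lam B ≠ ∞) : ∀ᵐ μ ∂Q, μ.1 B < ∞ :=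
  ae_lt_top (measurable_apply measurable_id hB) (by rwa [h.lintegral_apply hB])

/-- The numbers of points in a (random) set sum up to one. -/
theorem _root_.tsum_ind_eq_nat {d : ℕ} (μ : Config d) {B : Set (E d)} (hfin : μ.1 B < ∞) :
    ∑' n : ℕ, ind (μ.1 B = n) = 1 := by
  classical
  obtain ⟨k, hk⟩ := μ.exists_enat B
  lift k to ℕ using fun h => by simp [hk, h] at hfin
  rw [tsum_eq_single k]
  · simp [ind, hk]
  · intro n hn
    simp only [ind, hk]
    rw [if_neg]
    norm_cast
    exact fun h => hn h.symm

/-- Split by the number `n` of points in `B` and write the event as a sum over the tuples exhausting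
`B`. Their removal does not affect the restriction to `Bᶜ`, so Mecke's formula gives `lam B ^ n /
n!` times an integral over the void event of `B`. It only matters that the constant does not depend
on `G`. -/
theorem lintegral_restr_compl [IsProbabilityMeasure Q] [SigmaFinite lam] (h : IsMecke Q lam)
    {B : Set (E d)} (hB : MeasurableSet B) (hfin : lam B ≠ ∞) :
    ∃ c : ℝ≥0∞, ∀ G : Config d → ℝ≥0∞, Measurable G → ∫⁻ μ, G (μ.restr Bᶜ) ∂Q =
      c * ∫⁻ μ, ind (μ.1 B = 0) * G (μ.restr Bᶜ) ∂Q := by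
  refine ⟨∑' n : ℕ, (n.factorial : ℝ≥0∞)⁻¹ * lam B ^ n, fun G hG => ?_⟩
  have hG' : Measurable fun μ : Config d => G (μ.restr Bᶜ) :=
    hG.comp (measurable_restr measurable_id hB.compl)
  have hi : ∀ r : ℝ≥0∞, Measurable fun μ : Config d => ind (μ.1 B = r) := fun r =>
    measurable_ind (measurableSet_eq_fun (measurable_apply measurable_id hB) measurable_const)
  have h1 : ∫⁻ μ, G (μ.restr Bᶜ) ∂Q = ∫⁻ μ : Config d, ∑' n : ℕ, ind (μ.1 B = n) * G (μ.restr Bᶜ) ∂Q := by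
    refine lintegral_congr_ae ?_
    filter_upwards [h.ae_apply_lt_top hB hfin] with μ hμ
    rw [ENNReal.tsum_mul_right, tsum_ind_eq_nat μ hμ, one_mul]
  rw [h1, lintegral_tsum (f := fun (n : ℕ) (μ : Config d) => ind (μ.1 B = n) * G (μ.restr Bᶜ))
    fun n => ((hi n).mul hG').aemeasurable, ← ENNReal.tsum_mul_right]
  refine tsum_congr fun n => ?_
  have hn : (n.factorial : ℝ≥0∞) ≠ 0 := by exact_mod_cast n.factorial_ne_zero
  have h2 : ∀ μ : Config d, ind (μ.1 B = n) * G (μ.restr Bᶜ) = (n.factorial : ℝ≥0∞)⁻¹ *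
      facSum n μ fun y μ' => ind ((∀ i, y i ∈ B) ∧ μ'.1 B = 0) * G (μ'.restr Bᶜ) := by
    intro μ
    have : facSum n μ (fun y μ' => ind ((∀ i, y i ∈ B) ∧ μ'.1 B = 0) * G (μ'.restr Bᶜ)) =
        facSum n μ (fun y μ' => ind ((∀ i, y i ∈ B) ∧ μ'.1 B = 0) * G (μ.restr Bᶜ)) := by
      refine facSum_congr fun y μ' hy => ?_
      by_cases hc : (∀ i, y i ∈ B) ∧ μ'.1 B = 0
      · rw [← hy, restr_addPts_of_forall_notMem μ' hB.compl fun i => by simpa using hc.1 i]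
      · simp [ind_neg hc]
    rw [this, facSum_mul_const, facSum_exhaust n μ hB, ← mul_assoc, ← mul_assoc,
      ENNReal.inv_mul_cancel hn (by simp), one_mul]
  have hm : Measurable (Function.uncurry fun (y : Fin n → E d) (μ' : Config d) =>
      ind ((∀ i, y i ∈ B) ∧ μ'.1 B = 0) * G (μ'.restr Bᶜ)) := by
    refine Measurable.mul (measurable_ind ?_) (hG'.comp measurable_snd)
    refine measurableSet_and ?_ ?_
    · exact measurableSet_forall fun i => (show Measurable fun q : (Fin n → E d) × Config d => q.1 i
        by fun_prop) hB
    · exact measurableSet_eq_fun (measurable_apply measurable_snd hB) measurable_const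
  rw [lintegral_congr h2, lintegral_const_mul', h.lintegral_facSum hm, mul_assoc]
  swap
  · exact ENNReal.inv_ne_top.2 hn
  congr 1
  have h3 : ∀ y : Fin n → E d, ∫⁻ μ, ind ((∀ i, y i ∈ B) ∧ μ.1 B = 0) * G (μ.restr Bᶜ) ∂Q =
      (Set.univ.pi fun _ => B).indicator 1 y * ∫⁻ μ, ind (μ.1 B = 0) * G (μ.restr Bᶜ) ∂Q := by
    intro y
    by_cases hy : ∀ i, y i ∈ B
    · simp [hy]
    · simp [hy, ind]
  rw [lintegral_congr h3, lintegral_mul_const _ (measurable_one.indicator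
    (MeasurableSet.univ_pi fun _ => hB)), lintegral_indicator_one
    (MeasurableSet.univ_pi fun _ => hB), Measure.pi_pi]
  simp

/-- The choice `G = 1` shows that the constant of `lintegral_restr_compl` is the reciprocal of the
void probability. So the event that `B` is empty is independent of the configuration outside `B`,
with no reference to the definition of a Poisson process. -/
theorem lintegral_void_mul [IsProbabilityMeasure Q] [SigmaFinite lam] (h : IsMecke Q lam)
    {B : Set (E d)} (hB : MeasurableSet B) (hfin : lam B ≠ ∞) {G : Config d → ℝ≥0∞}
    (hG : Measurable G) :
    ∫⁻ μ, ind (μ.1 B = 0) * G (μ.restr Bᶜ) ∂Q =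
      (∫⁻ μ, ind (μ.1 B = 0) ∂Q) * ∫⁻ μ, G (μ.restr Bᶜ) ∂Q := by
  obtain ⟨c, hc⟩ := h.lintegral_restr_compl hB hfin
  have h1 := hc (fun _ => 1) measurable_const
  simp only [mul_one, lintegral_one, measure_univ] at h1
  rw [hc G hG, ← mul_assoc, mul_comm _ c, ← h1, one_mul]

/-- Strong Markov property: resampling a Poisson process outside a stopping set does not change its
law. -/
theorem lintegral_resample [IsProbabilityMeasure Q] [SigmaFinite lam] (h : IsMecke Q lam)
    {S : Config d → Set (E d)} (hS : ∀ μ, MeasurableSet (S μ))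
    (hS' : MeasurableSet {q : Config d × E d | q.2 ∈ S q.1})
    (hS_eq : ∀ μ μ' : Config d, μ'.restr (S μ) = μ.restr (S μ) → S μ' = S μ)
    (hfin : ∀ᵐ μ ∂Q, μ.1 (S μ) < ∞) (hlam : ∀ μ, lam (S μ) ≠ ∞ ∨ S μ = Set.univ)
    {G : Config d → ℝ≥0∞} (hG : Measurable G) :
    ∫⁻ μ, ∫⁻ μ', G ((μ.restr (S μ)).add (μ'.restr (S μ)ᶜ)) ∂Q ∂Q = ∫⁻ μ, G μ ∂Q := by
  have hSc' : MeasurableSet {q : Config d × E d | q.2 ∈ (S q.1)ᶜ} := hS'.compl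
  have hi : ∀ n : ℕ, Measurable fun μ : Config d => ind (μ.1 (S μ) = n) := fun n =>
    measurable_ind (measurableSet_eq_fun
      (measurable_apply_of_measurableSet measurable_id hS hS') measurable_const)
  have hL : Measurable fun μ : Config d =>
      ∫⁻ μ', G ((μ.restr (S μ)).add (μ'.restr (S μ)ᶜ)) ∂Q := by
    refine Measurable.lintegral_prod_right'
      (f := fun q : Config d × Config d => G ((q.1.restr (S q.1)).add (q.2.restr (S q.1)ᶜ))) ?_
    refine hG.comp (measurable_add ?_ ?_)
    · exact measurable_restr_of_measurableSet measurable_fst (fun q => hS q.1)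
        (S := fun q : Config d × Config d => S q.1)
        ((show Measurable fun q : (Config d × Config d) × E d => (q.1.1, q.2) by fun_prop) hS')
    · exact measurable_restr_of_measurableSet measurable_snd (fun q => (hS q.1).compl)
        (S := fun q : Config d × Config d => (S q.1)ᶜ)
        ((show Measurable fun q : (Config d × Config d) × E d => (q.1.1, q.2) by fun_prop) hSc')
  have hsplit : ∀ H : Config d → ℝ≥0∞, Measurable H →
      ∫⁻ μ, H μ ∂Q = ∑' n : ℕ, ∫⁻ μ, ind (μ.1 (S μ) = n) * H μ ∂Q := by
    intro H hH
    rw [← lintegral_tsum (f := fun (n : ℕ) (μ : Config d) => ind (μ.1 (S μ) = n) * H μ)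
      fun n => ((hi n).mul hH).aemeasurable]
    refine lintegral_congr_ae ?_
    filter_upwards [hfin] with μ hμ
    rw [ENNReal.tsum_mul_right, tsum_ind_eq_nat μ hμ, one_mul]
  rw [hsplit _ hL, hsplit _ hG]
  refine tsum_congr fun n => ?_
  have hn : (n.factorial : ℝ≥0∞) ≠ 0 := by exact_mod_cast n.factorial_ne_zero
  -- On the event that `S μ` contains exactly the points `y`, the stopping set is `S (δ y)`. After
  -- Mecke's formula it is therefore a deterministic set, for each fixed `y`.
  let δ : (Fin n → E d) → Config d := fun y => (0 : Config d).addPts y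
  have hδ : Measurable δ := measurable_addPts measurable_const measurable_id
  let I : (Fin n → E d) → Config d → ℝ≥0∞ := fun y μ' =>
    ind ((∀ i, y i ∈ S (δ y)) ∧ μ'.1 (S (δ y)) = 0)
  have hIm : Measurable (Function.uncurry I) := by
    refine measurable_ind (measurableSet_and ?_ ?_)
    · exact measurableSet_forall fun i => (show Measurable fun q : (Fin n → E d) × Config d =>
        (δ q.1, q.1 i) by fun_prop) hS'
    · refine measurableSet_eq_fun ?_ measurable_const
      exact measurable_apply_of_measurableSet measurable_snd
        (S := fun q : (Fin n → E d) × Config d => S (δ q.1)) (fun q => hS _)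
        ((show Measurable fun q : ((Fin n → E d) × Config d) × E d => (δ q.1.1, q.2)
          by fun_prop) hS')
  -- If `μ'` has no points in `S (δ y)`, then `μ' + δ_y` and `δ y` agree there, and a stopping set
  -- is determined by the configuration inside it. The second version starts from the stopping set
  -- of the full configuration.
  have hSδ1 : ∀ (y : Fin n → E d) (μ' : Config d), μ'.1 (S (δ y)) = 0 →
      S (μ'.addPts y) = S (δ y) := fun y μ' h0 =>
    hS_eq _ _ (restr_addPts_of_void (hS _) h0)
  have hSδ2 : ∀ (y : Fin n → E d) (μ' : Config d), μ'.1 (S (μ'.addPts y)) = 0 →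
      S (δ y) = S (μ'.addPts y) := fun y μ' h0 =>
    hS_eq _ _ (restr_addPts_of_void (hS _) h0).symm
  have hI : ∀ μ : Config d, facSum n μ I = n.factorial * ind (μ.1 (S μ) = n) := by
    intro μ
    rw [← facSum_exhaust n μ (hS μ)]
    refine facSum_congr fun y μ' hy => ?_
    simp only [I]
    congr 1
    refine propext ⟨fun hc => ?_, fun hc => ?_⟩
    · rw [← hy, hSδ1 y μ' hc.2]; exact hc
    · rw [← hy] at hc
      rw [hSδ2 y μ' hc.2]; exact hc
  let T : (Fin n → E d) → Config d → Config d := fun y μ' =>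
    (δ y).add (μ'.restr (S (δ y))ᶜ)
  have hT : Measurable (Function.uncurry T) := by
    refine measurable_add (by fun_prop) (measurable_restr_of_measurableSet measurable_snd
        (S := fun q : (Fin n → E d) × Config d => (S (δ q.1))ᶜ) (fun q => (hS _).compl) ?_)
    exact (show Measurable fun q : ((Fin n → E d) × Config d) × E d => (δ q.1.1, q.2)
          by fun_prop) hSc'
  have hδS : ∀ y : Fin n → E d, (∀ i, y i ∈ S (δ y)) → (δ y).restr (S (δ y)) = δ y := by
    intro y hy
    refine restr_eq_self_of_compl ?_
    rw [addPts_apply _ _ (hS _).compl]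
    simp [zero_val, hy]
  have hA : ∀ μ : Config d, ind (μ.1 (S μ) = n) * ∫⁻ μ', G ((μ.restr (S μ)).add (μ'.restr (S μ)ᶜ)) ∂Q =
      (n.factorial : ℝ≥0∞)⁻¹ * facSum n μ fun y μ' => I y μ' * ∫⁻ χ, G (T y χ) ∂Q := by
    intro μ
    have : facSum n μ (fun y μ' => I y μ' * ∫⁻ χ, G (T y χ) ∂Q) = facSum n μ (fun y μ' =>
        I y μ' * ∫⁻ μ', G ((μ.restr (S μ)).add (μ'.restr (S μ)ᶜ)) ∂Q) := by
      refine facSum_congr fun y μ' hy => ?_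
      by_cases hc : (∀ i, y i ∈ S (δ y)) ∧ μ'.1 (S (δ y)) = 0
      · rw [← hy, hSδ1 y μ' hc.2, restr_addPts_of_void (hS _) hc.2]
        change _ = _ * ∫⁻ χ, G (((δ y).restr (S (δ y))).add (χ.restr (S (δ y))ᶜ)) ∂Q
        rw [hδS y hc.1]
      · simp [I, ind_neg hc]
    rw [this, facSum_mul_const, hI, ← mul_assoc, ← mul_assoc,
      ENNReal.inv_mul_cancel hn (by simp), one_mul]
  have hB : ∀ μ : Config d, ind (μ.1 (S μ) = n) * G μ =
      (n.factorial : ℝ≥0∞)⁻¹ * facSum n μ fun y μ' => I y μ' * G (T y μ') := by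
    intro μ
    have : facSum n μ (fun y μ' => I y μ' * G (T y μ')) = facSum n μ (fun y μ' =>
        I y μ' * G μ) := by
      refine facSum_congr fun y μ' hy => ?_
      by_cases hc : (∀ i, y i ∈ S (δ y)) ∧ μ'.1 (S (δ y)) = 0
      · congr 2
        rw [← hy, ← restr_add_restr_compl (μ'.addPts y) (hS (δ y)),
          restr_addPts_of_void (hS _) hc.2, restr_addPts_of_forall_notMem μ' (hS _).compl
            fun i => by simpa using hc.1 i]
        change _ = ((δ y).restr (S (δ y))).add _
        rw [hδS y hc.1]
      · simp [I, ind_neg hc]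
    rw [this, facSum_mul_const, hI, ← mul_assoc, ← mul_assoc,
      ENNReal.inv_mul_cancel hn (by simp), one_mul]
  have hGT : Measurable (Function.uncurry fun y μ' => G (T y μ')) := hG.comp hT
  have hKA : Measurable fun y : Fin n → E d => ∫⁻ χ, G (T y χ) ∂Q := hGT.lintegral_prod_right
  have e1 := h.lintegral_facSum (F := fun y μ' => I y μ' * ∫⁻ χ, G (T y χ) ∂Q)
    (Measurable.mul (f := fun q : (Fin n → E d) × Config d => I q.1 q.2) hIm
      (hKA.comp measurable_fst))
  have e2 := h.lintegral_facSum (F := fun y μ' => I y μ' * G (T y μ'))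
    (Measurable.mul (f := fun q : (Fin n → E d) × Config d => I q.1 q.2) hIm hGT)
  rw [lintegral_congr hA, lintegral_congr hB, lintegral_const_mul' _ _ (ENNReal.inv_ne_top.2 hn),
    lintegral_const_mul' _ _ (ENNReal.inv_ne_top.2 hn), e1, e2]
  congr 1
  refine lintegral_congr fun y => ?_
  have hIy : Measurable (I y) := Measurable.of_uncurry_left hIm
  rw [lintegral_mul_const _ hIy]
  by_cases hy : ∀ i, y i ∈ S (δ y)
  · simp only [I, hy, implies_true, true_and]
    -- For fixed `y` the claim is the independence of the void event of `S (δ y)` and the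
    -- configuration outside. If `S (δ y)` is the whole space, there is nothing outside to resample.
    rcases hlam (δ y) with hl | hl
    · exact (h.lintegral_void_mul (hS (δ y)) hl (G := fun χ => G ((δ y).add χ))
        (hG.comp (measurable_add measurable_const measurable_id))).symm
    · have : ∀ χ, T y χ = δ y := by
        intro χ
        refine Subtype.ext ?_
        simp [T, Config.add, restr, hl]
      simp only [this]
      rw [lintegral_const, measure_univ, mul_one, lintegral_mul_const]
      exact measurable_ind (measurableSet_eq_fun (measurable_apply measurable_id (hS _))
        measurable_const)
  · simp [I, hy, ind]
end IsMecke

/-! ### Interpolation by thinning and the solution of the Stein equation -/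

section Thinning
variable {α : Type*}

/-- The expectation of `f` at the `p`-thinning of the finite configuration `s`. -/
noncomputable def thin (p : ℝ) (f : Multiset α → ℝ) (s : Multiset α) : ℝ :=
  (s.powerset.map fun t => p ^ t.card * (1 - p) ^ (s.card - t.card) * f t).sum

/-- The difference operator. -/
def addDiff (a : α) (f : Multiset α → ℝ) (s : Multiset α) : ℝ := f (a ::ₘ s) - f s

@[simp] theorem thin_zero (p : ℝ) (f : Multiset α → ℝ) : thin p f 0 = f 0 := by
  simp [thin]

/-- Conditioning on whether the point `a` is kept. The properties of `thin` below are obtained by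
induction from this recursion. -/
theorem thin_cons (p : ℝ) (f : Multiset α → ℝ) (a : α) (s : Multiset α) :
    thin p f (a ::ₘ s) = p * thin p (fun t => f (a ::ₘ t)) s + (1 - p) * thin p f s := by
  simp only [thin, Multiset.powerset_cons, Multiset.map_add, Multiset.sum_add, Multiset.map_map,
    ← Multiset.sum_map_mul_left]
  rw [add_comm]
  congr 2
  · refine Multiset.map_congr rfl fun t _ => ?_
    simp only [Function.comp, Multiset.card_cons, Nat.add_sub_add_right]
    ring
  · refine Multiset.map_congr rfl fun t ht => ?_
    have : t.card ≤ s.card := Multiset.card_le_card (Multiset.mem_powerset.1 ht)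
    rw [Multiset.card_cons, Nat.sub_add_comm this]
    ring

theorem thin_sub (p : ℝ) (f g : Multiset α → ℝ) (s : Multiset α) :
    thin p (fun t => f t - g t) s = thin p f s - thin p g s := by
  induction s using Multiset.induction generalizing f g with
  | empty => simp
  | cons a s ih => rw [thin_cons, thin_cons, thin_cons, ih, ih]; ring

theorem thin_sum_map {β : Type*} (p : ℝ) (F : β → Multiset α → ℝ) (u : Multiset β)
    (s : Multiset α) : thin p (fun t => (u.map fun b => F b t).sum) s =
      (u.map fun b => thin p (F b) s).sum := by
  induction s using Multiset.induction generalizing F with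
  | empty => simp
  | cons a s ih =>
    simp only [thin_cons, Multiset.sum_map_add, Multiset.sum_map_mul_left]
    rw [ih fun b t => F b (a ::ₘ t), ih F]

theorem thin_neg (p : ℝ) (f : Multiset α → ℝ) (s : Multiset α) :
    thin p (fun t => - f t) s = - thin p f s := by
  induction s using Multiset.induction generalizing f with
  | empty => simp
  | cons a s ih => rw [thin_cons, thin_cons, ih, ih]; ring

theorem thin_addDiff (p : ℝ) (f : Multiset α → ℝ) (a : α) (s : Multiset α) :
    thin p (addDiff a f) s = thin p (fun t => f (a ::ₘ t)) s - thin p f s :=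
  thin_sub p (fun t => f (a ::ₘ t)) f s

theorem thin_cons_sub (p : ℝ) (f : Multiset α → ℝ) (a : α) (s : Multiset α) :
    thin p f (a ::ₘ s) - thin p f s = p * thin p (addDiff a f) s := by
  rw [thin_cons, thin_addDiff]
  ring

theorem abs_thin_le {p : ℝ} (h0 : 0 ≤ p) (h1 : p ≤ 1) {f : Multiset α → ℝ} {C : ℝ}
    (hf : ∀ t, |f t| ≤ C) (s : Multiset α) : |thin p f s| ≤ C := by
  induction s using Multiset.induction generalizing f with
  | empty => simpa using hf 0
  | cons a s ih =>
    rw [thin_cons]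
    have h2 := ih fun t => hf (a ::ₘ t)
    have h3 := ih hf
    calc _ ≤ |p * thin p (fun t => f (a ::ₘ t)) s| + |(1 - p) * thin p f s| := abs_add_le _ _
      _ = p * |thin p (fun t => f (a ::ₘ t)) s| + (1 - p) * |thin p f s| := by
        rw [abs_mul, abs_mul, abs_of_nonneg h0, abs_of_nonneg (sub_nonneg.2 h1)]
      _ ≤ p * C + (1 - p) * C := by
        gcongr
      _ = C := by ring

theorem thin_at_zero (f : Multiset α → ℝ) (s : Multiset α) : thin 0 f s = f 0 := by
  induction s using Multiset.induction generalizing f with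
  | empty => simp
  | cons a s ih => rw [thin_cons, ih, ih]; ring

theorem thin_at_one (f : Multiset α → ℝ) (s : Multiset α) : thin 1 f s = f s := by
  induction s using Multiset.induction generalizing f with
  | empty => simp
  | cons a s ih => rw [thin_cons, ih]; ring

/-- A Russo formula: raising the retention probability of one point `a` changes the expectation at
the rate of the thinned difference `addDiff a`, and the chain rule adds over all points. The
function may itself depend on `p`, since it will be an expectation over a second thinning. -/
theorem hasDerivAt_thin [DecidableEq α] {H : ℝ → Multiset α → ℝ} {H' : Multiset α → ℝ} {p : ℝ}
    (hH : ∀ t, HasDerivAt (fun p => H p t) (H' t) p) (s : Multiset α) :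
    HasDerivAt (fun p => thin p (H p) s)
      ((s.map fun a => thin p (addDiff a (H p)) (s.erase a)).sum + thin p H' s) p := by
  induction s using Multiset.induction generalizing H H' with
  | empty => simpa using hH 0
  | cons b s ih =>
    simp only [thin_cons p]
    have h1 := ih (H := fun p t => H p (b ::ₘ t)) (H' := fun t => H' (b ::ₘ t)) fun t => hH _
    have h2 := ih hH
    have h3 := ((hasDerivAt_id p).mul h1).add (((hasDerivAt_id p).const_sub 1).mul h2)
    have h4 : (fun p => thin p (H p) (b ::ₘ s)) =
        (id * fun p => thin p (fun t => H p (b ::ₘ t)) s) + (fun x => 1 - id x) *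
          fun p => thin p (H p) s := by
      ext q; simp [thin_cons]
    rw [h4]
    refine h3.congr_deriv ?_
    rw [Multiset.map_cons, Multiset.sum_cons, Multiset.erase_cons_head]
    have h5 : s.map (fun a => thin p (addDiff a (H p)) ((b ::ₘ s).erase a)) =
        s.map fun a => p * thin p (addDiff a fun t => H p (b ::ₘ t)) (s.erase a) +
          (1 - p) * thin p (addDiff a (H p)) (s.erase a) := by
      refine Multiset.map_congr rfl fun a ha => ?_
      have : (b ::ₘ s).erase a = b ::ₘ s.erase a := by
        by_cases hab : b = a
        · subst hab; rw [Multiset.erase_cons_head, Multiset.cons_erase ha]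
        · rw [Multiset.erase_cons_tail _ hab]
      rw [this, thin_cons]
      congr 3
      ext t
      simp only [addDiff]
      rw [Multiset.cons_swap]
    rw [h5]
    simp only [Multiset.sum_map_add, Multiset.sum_map_mul_left, thin_addDiff p (H p) b, id]
    ring

/-- Interpolation between `f s` (at `p = 1`) and `f u` (at `p = 0`). -/
noncomputable def biThin (p : ℝ) (f : Multiset α → ℝ) (s u : Multiset α) : ℝ :=
  thin p (fun t => thin (1 - p) (fun r => f (t + r)) u) s

/-- The additional point survives with probability `p`. This factor is what makes the Lipschitz
constant of `steinDiff` equal to `1` and not `2`. -/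
theorem biThin_cons_sub (p : ℝ) (f : Multiset α → ℝ) (a : α) (s u : Multiset α) :
    biThin p f (a ::ₘ s) u - biThin p f s u = p * biThin p (addDiff a f) s u := by
  rw [biThin, biThin, thin_cons_sub, biThin]
  congr 2
  ext t
  simp only [addDiff, Multiset.cons_add]
  rw [← thin_sub]

theorem abs_biThin_le {p : ℝ} (h0 : 0 ≤ p) (h1 : p ≤ 1) {f : Multiset α → ℝ} {C : ℝ}
    (hf : ∀ t, |f t| ≤ C) (s u : Multiset α) : |biThin p f s u| ≤ C :=
  abs_thin_le h0 h1 (fun t => abs_thin_le (by linarith) (by linarith) (fun r => hf (t + r)) u) s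

/-- The Russo formula for both thinnings; the retention probability `1 - p` of the points of `u`
decreases, hence the minus sign. -/
theorem hasDerivAt_biThin [DecidableEq α] (f : Multiset α → ℝ) (s u : Multiset α) (p : ℝ) :
    HasDerivAt (fun p => biThin p f s u)
      ((s.map fun a => biThin p (addDiff a f) (s.erase a) u).sum -
        (u.map fun b => biThin p (addDiff b f) s (u.erase b)).sum) p := by
  have h1 : ∀ t, HasDerivAt (fun p => thin (1 - p) (fun r => f (t + r)) u)
      (-(u.map fun b => thin (1 - p) (addDiff b fun r => f (t + r)) (u.erase b)).sum) p := by
    intro t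
    have h := hasDerivAt_thin (H := fun _ r => f (t + r)) (H' := fun _ => 0) (p := 1 - p)
      (fun r => hasDerivAt_const _ _) u
    have h0 : thin (1 - p) (fun _ : Multiset α => (0 : ℝ)) u = 0 := by simp [thin]
    rw [h0, add_zero] at h
    have := h.comp_const_sub 1 p
    exact this
  have h2 := hasDerivAt_thin h1 s
  refine h2.congr_deriv ?_
  rw [thin_neg, thin_sum_map, ← sub_eq_add_neg]
  congr 1
  · refine congrArg (Multiset.sum (M := ℝ)) (Multiset.map_congr rfl fun a _ => ?_)
    rw [biThin]
    congr 1
    ext t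
    simp only [addDiff, Multiset.cons_add]
    rw [← thin_sub]
  · refine congrArg (Multiset.sum (M := ℝ)) (Multiset.map_congr rfl fun b _ => ?_)
    rw [biThin]
    congr 1
    ext t
    congr 1
    ext r
    simp [addDiff]

theorem continuous_biThin [DecidableEq α] (f : Multiset α → ℝ) (s u : Multiset α) :
    Continuous fun p => biThin p f s u :=
  continuous_iff_continuousAt.2 fun p => (hasDerivAt_biThin f s u p).continuousAt

theorem continuous_sum_map {β : Type*} {m : Multiset β} {G : β → ℝ → ℝ}
    (hG : ∀ b, Continuous (G b)) : Continuous fun p => (m.map fun b => G b p).sum := by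
  induction m using Multiset.induction with
  | empty => simpa using continuous_const
  | cons a m ih =>
    simp only [Multiset.map_cons, Multiset.sum_cons]
    exact (hG a).add ih

theorem intervalIntegral_sum_map {β : Type*} {m : Multiset β} {G : β → ℝ → ℝ}
    (hG : ∀ b, Continuous (G b)) :
    ∫ p in (0 : ℝ)..1, (m.map fun b => G b p).sum = (m.map fun b => ∫ p in (0 : ℝ)..1, G b p).sum := by
  induction m using Multiset.induction with
  | empty => simp
  | cons a m ih =>
    simp only [Multiset.map_cons, Multiset.sum_cons]
    rw [intervalIntegral.integral_add ((hG a).intervalIntegrable _ _)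
      ((continuous_sum_map hG).intervalIntegrable _ _), ih]

/-- The first difference of the solution of Stein's equation for `f`, with the Poisson process
replaced by a fixed configuration `u`. -/
noncomputable def steinDiff (f : Multiset α → ℝ) (x : α) (s u : Multiset α) : ℝ :=
  ∫ p in (0 : ℝ)..1, biThin p (addDiff x f) s u

/-- The fundamental theorem of calculus for `biThin` on `[0, 1]`. This is the Stein equation before
averaging over `u`. -/
theorem sub_eq_steinDiff [DecidableEq α] (f : Multiset α → ℝ) (s u : Multiset α) :
    f s - f u = (s.map fun a => steinDiff f a (s.erase a) u).sum -
      (u.map fun b => steinDiff f b s (u.erase b)).sum := by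
  have h1 : Continuous fun p => (s.map fun a => biThin p (addDiff a f) (s.erase a) u).sum :=
    continuous_sum_map fun a => continuous_biThin _ _ _
  have h2 : Continuous fun p => (u.map fun b => biThin p (addDiff b f) s (u.erase b)).sum :=
    continuous_sum_map fun a => continuous_biThin _ _ _
  have h := intervalIntegral.integral_eq_sub_of_hasDerivAt (a := 0) (b := 1)
    (fun p _ => hasDerivAt_biThin f s u p) ((h1.sub h2).intervalIntegrable _ _)
  rw [intervalIntegral.integral_sub (h1.intervalIntegrable _ _) (h2.intervalIntegrable _ _),
    intervalIntegral_sum_map fun a => continuous_biThin _ _ _,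
    intervalIntegral_sum_map fun a => continuous_biThin _ _ _] at h
  simp only [steinDiff]
  rw [h]
  simp [biThin, thin_at_one, thin_at_zero]

theorem abs_addDiff_le {f : Multiset α → ℝ} (h0 : ∀ s, 0 ≤ f s) (h1 : ∀ s, f s ≤ 1) (x : α)
    (s : Multiset α) : |addDiff x f s| ≤ 1 := by
  rw [addDiff, abs_le]
  constructor <;> linarith [h0 s, h1 s, h0 (x ::ₘ s), h1 (x ::ₘ s)]

theorem abs_steinDiff_le {f : Multiset α → ℝ} (h0 : ∀ s, 0 ≤ f s) (h1 : ∀ s, f s ≤ 1) (x : α)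
    (s u : Multiset α) : |steinDiff f x s u| ≤ 1 := by
  have h := intervalIntegral.norm_integral_le_of_norm_le_const (a := 0) (b := 1) (C := 1)
    (f := fun p => biThin p (addDiff x f) s u) fun p hp => by
      rw [Set.uIoc_of_le zero_le_one] at hp
      exact abs_biThin_le hp.1.le hp.2 (abs_addDiff_le h0 h1 x) s u
  simpa [steinDiff] using h

/-- Second differences of a `[0, 1]`-valued function are at most `2` in absolute value, the
additional point survives with probability `p`, and `∫ 2p dp = 1` over `[0, 1]`. -/
theorem abs_steinDiff_cons_sub_le [DecidableEq α] {f : Multiset α → ℝ} (h0 : ∀ s, 0 ≤ f s) (h1 : ∀ s, f s ≤ 1)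
    (x a : α) (s u : Multiset α) : |steinDiff f x (a ::ₘ s) u - steinDiff f x s u| ≤ 1 := by
  rw [steinDiff, steinDiff, ← intervalIntegral.integral_sub
    ((continuous_biThin _ _ _).intervalIntegrable _ _)
    ((continuous_biThin _ _ _).intervalIntegrable _ _)]
  simp only [biThin_cons_sub]
  have h := intervalIntegral.norm_integral_le_of_norm_le (a := 0) (b := 1) (μ := volume)
    (f := fun p => p * biThin p (addDiff a (addDiff x f)) s u) (g := fun p => p * 2) zero_le_one
    (Filter.Eventually.of_forall fun p hp => by
      rw [Real.norm_eq_abs, abs_mul, abs_of_pos hp.1]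
      refine mul_le_mul_of_nonneg_left (abs_biThin_le hp.1.le hp.2 (fun t => ?_) s u) hp.1.le
      have e1 := abs_le.1 (abs_addDiff_le h0 h1 x t)
      have e2 := abs_le.1 (abs_addDiff_le h0 h1 x (a ::ₘ t))
      rw [addDiff, abs_le]
      constructor <;> linarith [e1.1, e1.2, e2.1, e2.2])
    ((continuous_id.mul continuous_const).intervalIntegrable _ _)
  refine h.trans ?_
  rw [intervalIntegral.integral_mul_const, integral_id]
  norm_num

theorem abs_steinDiff_add_sub_le [DecidableEq α] {f : Multiset α → ℝ} (h0 : ∀ s, 0 ≤ f s) (h1 : ∀ s, f s ≤ 1)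
    (x : α) (s r u : Multiset α) : |steinDiff f x (r + s) u - steinDiff f x s u| ≤ r.card := by
  induction r using Multiset.induction with
  | empty => simp
  | cons a r ih =>
    have := abs_steinDiff_cons_sub_le h0 h1 x a (r + s) u
    rw [Multiset.cons_add, Multiset.card_cons]
    push_cast
    have h2 := abs_sub_le (steinDiff f x (a ::ₘ (r + s)) u) (steinDiff f x (r + s) u)
      (steinDiff f x s u)
    linarith

/-- Pass from `s` to `t` through their common part `s ∩ t`, one point at a time. -/
theorem steinDiff_le_add [DecidableEq α] {f : Multiset α → ℝ} (h0 : ∀ s, 0 ≤ f s) (h1 : ∀ s, f s ≤ 1)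
    (x : α) (s t u : Multiset α) :
    steinDiff f x s u ≤ steinDiff f x t u + (s - t).card + (t - s).card := by
  have e1 := abs_le.1 (abs_steinDiff_add_sub_le h0 h1 x (s ∩ t) (s - t) u)
  have e2 := abs_le.1 (abs_steinDiff_add_sub_le h0 h1 x (t ∩ s) (t - s) u)
  rw [Multiset.sub_add_inter] at e1 e2
  rw [Multiset.inter_comm t s] at e2
  linarith [e1.2, e2.1]
end Thinning

/-! ### Measurability of the thinned expectations -/

section ThinningMeasurable
variable {α : Type}

/-- The multiset of the entries of a tuple. -/
def tupleMultiset {n : ℕ} (x : Fin n → α) : Multiset α := (List.ofFn x : List α)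

theorem tupleMultiset_cons {n : ℕ} (a : α) (x : Fin n → α) :
    tupleMultiset (Fin.cons a x : Fin (n + 1) → α) = a ::ₘ tupleMultiset x := by
  simp [tupleMultiset, List.ofFn_succ]

theorem tupleMultiset_append {n k : ℕ} (x : Fin n → α) (y : Fin k → α) :
    tupleMultiset (Fin.append x y) = tupleMultiset x + tupleMultiset y := by
  simp [tupleMultiset, List.ofFn_fin_append]

variable [MeasurableSpace α]

/-- Measurability of a function of a parameter and a finite configuration. -/
def MeasurableOnMultisets {β : Type*} [MeasurableSpace β] (H : β → Multiset α → ℝ) : Prop :=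
  ∀ n, Measurable fun q : β × (Fin n → α) => H q.1 (tupleMultiset q.2)

theorem measurable_cons' {β : Type*} [MeasurableSpace β] {n : ℕ} {x : β → α} {y : β → Fin n → α}
    (hx : Measurable x) (hy : Measurable y) :
    Measurable fun a => (Fin.cons (x a) (y a) : Fin (n + 1) → α) := by
  refine measurable_pi_iff.2 fun j => ?_
  refine Fin.cases ?_ (fun i => ?_) j
  · simpa using hx
  · simp only [Fin.cons_succ]
    exact (measurable_pi_apply i).comp hy

theorem measurable_append {β : Type*} [MeasurableSpace β] {n k : ℕ} {x : β → Fin n → α}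
    {y : β → Fin k → α} (hx : Measurable x) (hy : Measurable y) :
    Measurable fun a => (Fin.append (x a) (y a) : Fin (n + k) → α) := by
  refine measurable_pi_iff.2 fun j => ?_
  refine Fin.addCases (fun i => ?_) (fun i => ?_) j
  · simp only [Fin.append_left]
    exact (measurable_pi_apply i).comp hx
  · simp only [Fin.append_right]
    exact (measurable_pi_apply i).comp hy

theorem MeasurableOnMultisets.cons {β : Type*} [MeasurableSpace β] {H : β → Multiset α → ℝ}
    (hH : MeasurableOnMultisets H) :
    MeasurableOnMultisets fun (q : β × α) s => H q.1 (q.2 ::ₘ s) := by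
  intro n
  simp only [← tupleMultiset_cons]
  exact (hH (n + 1)).comp (Measurable.prodMk (by fun_prop)
    (measurable_cons' (by fun_prop) (by fun_prop)))

theorem MeasurableOnMultisets.comp {β γ : Type*} [MeasurableSpace β] [MeasurableSpace γ]
    {H : β → Multiset α → ℝ} (hH : MeasurableOnMultisets H) {g : γ → β} (hg : Measurable g) :
    MeasurableOnMultisets fun c s => H (g c) s :=
  fun n => (hH n).comp (Measurable.prodMk (by fun_prop) (by fun_prop))

/-- Induction on the number of points by `thin_cons`: the first point becomes part of the parameter,
which is why the parameter space varies in the induction. -/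
theorem MeasurableOnMultisets.thin {β : Type*} [MeasurableSpace β] {H : β → Multiset α → ℝ}
    (hH : MeasurableOnMultisets H) {p : β → ℝ} (hp : Measurable p) :
    MeasurableOnMultisets fun b s => thin (p b) (H b) s := by
  intro n
  induction n generalizing β with
  | zero => simpa [tupleMultiset] using hH 0
  | succ n ih =>
    have h1 : Measurable fun q : (β × α) × (Fin n → α) =>
        _root_.thin (p q.1.1) (fun t => H q.1.1 (q.1.2 ::ₘ t)) (tupleMultiset q.2) :=
      ih (β := β × α) hH.cons (hp.comp measurable_fst)
    have h2 := ih hH hp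
    have e : ∀ x : Fin (n + 1) → α, tupleMultiset x = x 0 ::ₘ tupleMultiset (Fin.tail x) := by
      intro x
      rw [← tupleMultiset_cons, Fin.cons_self_tail]
    simp only [e, thin_cons]
    have ht : Measurable fun q : β × (Fin (n + 1) → α) => Fin.tail q.2 :=
      measurable_pi_iff.2 fun i => (measurable_pi_apply _).comp measurable_snd
    have hp' : Measurable fun q : β × (Fin (n + 1) → α) => p q.1 := hp.comp measurable_fst
    have h1' : Measurable fun q : β × (Fin (n + 1) → α) =>
        _root_.thin (p q.1) (fun t => H q.1 (q.2 0 ::ₘ t)) (tupleMultiset (Fin.tail q.2)) :=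
      h1.comp (g := fun q : (β × α) × (Fin n → α) =>
        _root_.thin (p q.1.1) (fun t => H q.1.1 (q.1.2 ::ₘ t)) (tupleMultiset q.2))
        (f := fun q : β × (Fin (n + 1) → α) => ((q.1, q.2 0), Fin.tail q.2))
        (Measurable.prodMk (by fun_prop) ht)
    have h2' : Measurable fun q : β × (Fin (n + 1) → α) =>
        _root_.thin (p q.1) (H q.1) (tupleMultiset (Fin.tail q.2)) :=
      h2.comp (g := fun q : β × (Fin n → α) => _root_.thin (p q.1) (H q.1) (tupleMultiset q.2))
        (Measurable.prodMk measurable_fst ht)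
    exact (hp'.mul h1').add ((measurable_const.sub hp').mul h2')

theorem MeasurableOnMultisets.biThin [DecidableEq α] {β : Type*} [MeasurableSpace β]
    {H : β → Multiset α → ℝ}
    (hH : MeasurableOnMultisets H) {p : β → ℝ} (hp : Measurable p) (l : ℕ) :
    MeasurableOnMultisets fun (q : β × (Fin l → α)) s =>
      biThin (p q.1) (H q.1) s (tupleMultiset q.2) := by
  refine MeasurableOnMultisets.thin (H := fun (q : β × (Fin l → α)) t =>
    _root_.thin (1 - p q.1) (fun r => H q.1 (t + r)) (tupleMultiset q.2)) ?_
    (hp.comp measurable_fst)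
  intro k
  have h1 : MeasurableOnMultisets fun (q : β × (Fin k → α)) r => H q.1 (tupleMultiset q.2 + r) := by
    intro j
    simp only [← tupleMultiset_append]
    exact (hH (k + j)).comp (Measurable.prodMk (by fun_prop)
      (measurable_append (by fun_prop) (by fun_prop)))
  have h2 := h1.thin (p := fun q => 1 - p q.1) (measurable_const.sub (hp.comp measurable_fst)) l
  exact h2.comp (f := fun q : (β × (Fin l → α)) × (Fin k → α) => ((q.1.1, q.2), q.1.2))
    (by fun_prop)

theorem measurable_steinDiff [DecidableEq α] {f : Multiset α → ℝ}
    (hf : ∀ n, Measurable fun x : Fin n → α => f (tupleMultiset x)) (k l : ℕ) :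
    Measurable fun q : α × (Fin k → α) × (Fin l → α) =>
      steinDiff f q.1 (tupleMultiset q.2.1) (tupleMultiset q.2.2) := by
  have h1 : MeasurableOnMultisets fun (_ : Unit) s => f s := fun n => (hf n).comp measurable_snd
  have h2 : MeasurableOnMultisets fun (x : α) s => addDiff x f s := by
    intro n
    exact ((h1.cons.comp (g := fun x : α => ((), x)) (by fun_prop)) n).sub
      ((h1.comp (g := fun _ : α => ()) (by fun_prop)) n)
  have h3 := ((h2.comp (g := fun q : ℝ × α => q.2) measurable_snd).biThin
    (p := fun q => q.1) measurable_fst l) k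
  have h4 : Measurable fun w : (α × (Fin k → α) × (Fin l → α)) × ℝ =>
      biThin w.2 (addDiff w.1.1 f) (tupleMultiset w.1.2.1) (tupleMultiset w.1.2.2) :=
    h3.comp (f := fun w : (α × (Fin k → α) × (Fin l → α)) × ℝ =>
      (((w.2, w.1.1), w.1.2.2), w.1.2.1)) (by fun_prop)
  simp only [steinDiff, intervalIntegral.integral_of_le zero_le_one]
  exact (h4.stronglyMeasurable.integral_prod_right (ν := volume.restrict (Set.Ioc 0 1))).measurable
end ThinningMeasurable

/-! ### Finite configurations as multisets -/

namespace Config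
variable {d : ℕ}

/-- The configuration with the points of a finite multiset. -/
noncomputable def ofMultiset (s : Multiset (E d)) : Config d :=
  ⟨(s.map Measure.dirac).sum, by
    induction s using Multiset.induction with
    | empty => exact (0 : Config d).2
    | cons a s ih =>
      have := (Config.addPts (d := d) ⟨_, ih⟩ fun _ : Fin 1 => a).2
      simpa [Config.addPts, add_comm] using this⟩

theorem ofMultiset_cons (a : E d) (s : Multiset (E d)) :
    ofMultiset (a ::ₘ s) = (ofMultiset s).addPts fun _ : Fin 1 => a :=
  Subtype.ext (by simp [ofMultiset, Config.addPts, add_comm])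

theorem ofMultiset_singleton [DecidableEq (E d)] (s : Multiset (E d)) (a : E d) :
    (ofMultiset s).1 {a} = s.count a := by
  induction s using Multiset.induction with
  | empty => simp [ofMultiset]
  | cons b s ih =>
    rw [ofMultiset_cons, addPts_apply _ _ (measurableSet_singleton a), ih, Multiset.count_cons]
    by_cases h : a = b
    · simp [h]
    · simp [h, Ne.symm h]

theorem ofMultiset_injective : Function.Injective (ofMultiset (d := d)) := by
  classical
  intro s t h
  ext a
  have h1 := ofMultiset_singleton s a
  rw [h, ofMultiset_singleton] at h1
  exact_mod_cast h1.symm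

theorem ofMultiset_univ (s : Multiset (E d)) : (ofMultiset s).1 Set.univ = s.card := by
  induction s using Multiset.induction with
  | empty => simp [ofMultiset]
  | cons b s ih => rw [ofMultiset_cons, addPts_apply _ _ .univ, ih]; simp

theorem lintegral_ofMultiset (s : Multiset (E d)) (F : E d → ℝ≥0∞) :
    ∫⁻ x, F x ∂(ofMultiset s).1 = (s.map F).sum := by
  induction s using Multiset.induction with
  | empty => simp [ofMultiset]
  | cons b s ih =>
    rw [ofMultiset_cons, addPts, lintegral_add_measure, ih, Multiset.map_cons, Multiset.sum_cons,
      add_comm]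
    simp

theorem ofMultiset_tupleMultiset {n : ℕ} (x : Fin n → E d) :
    (ofMultiset (tupleMultiset x)).1 = ∑ i, Measure.dirac (x i) := by
  change ((tupleMultiset x).map Measure.dirac).sum = _
  rw [tupleMultiset, Multiset.map_coe, Multiset.sum_coe, List.map_ofFn, List.sum_ofFn]
  rfl

theorem measurable_ofMultiset_tupleMultiset (n : ℕ) :
    Measurable fun x : Fin n → E d => ofMultiset (tupleMultiset x) := by
  have : ∀ x : Fin n → E d, ofMultiset (tupleMultiset x) = (0 : Config d).addPts x := fun x =>
    Subtype.ext (by rw [ofMultiset_tupleMultiset]; exact (zero_add _).symm)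
  simp only [this]
  exact measurable_addPts measurable_const measurable_id

/-- The points of a finite configuration as a tuple. -/
noncomputable def points (n : ℕ) (μ : Config d) : Fin n → E d :=
  fun i => (exists_enumeration d).choose i μ

theorem measurable_points (n : ℕ) : Measurable (points (d := d) n) :=
  measurable_pi_iff.2 fun i => (exists_enumeration d).choose_spec.1 i

/-- The number of points of a finite configuration. -/
noncomputable def numPoints (μ : Config d) : ℕ := ⌊(μ.1 Set.univ).toReal⌋₊

theorem measurable_numPoints : Measurable (numPoints (d := d)) :=
  Nat.measurable_floor.comp (measurable_apply measurable_id .univ).ennreal_toReal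

theorem univ_eq_numPoints {μ : Config d} (h : μ.1 Set.univ < ∞) : μ.1 Set.univ = μ.numPoints := by
  obtain ⟨n, hn⟩ := μ.exists_enat Set.univ
  lift n to ℕ using fun h' => by simp [hn, h'] at h
  simp [numPoints, hn]

/-- The points of a finite configuration as a multiset. -/
noncomputable def toMultiset (μ : Config d) : Multiset (E d) :=
  tupleMultiset (points μ.numPoints μ)

theorem ofMultiset_toMultiset {μ : Config d} (h : μ.1 Set.univ < ∞) :
    ofMultiset μ.toMultiset = μ := by
  refine Subtype.ext ?_
  rw [toMultiset, ofMultiset_tupleMultiset]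
  exact ((exists_enumeration d).choose_spec.2 μ _ (univ_eq_numPoints h)).symm

theorem toMultiset_ofMultiset (s : Multiset (E d)) : (ofMultiset s).toMultiset = s :=
  ofMultiset_injective (ofMultiset_toMultiset (by simp [ofMultiset_univ]))

theorem exists_eq_ofMultiset {μ : Config d} (h : μ.1 Set.univ < ∞) : ∃ s, μ = ofMultiset s :=
  ⟨_, (ofMultiset_toMultiset h).symm⟩

theorem toMultiset_removePt [DecidableEq (E d)] {s : Multiset (E d)} {x : E d} (hx : x ∈ s) :
    ((ofMultiset s).removePts fun _ : Fin 1 => x).toMultiset = s.erase x := by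
  nth_rewrite 1 [← Multiset.cons_erase hx]
  rw [ofMultiset_cons, removePts_addPts, toMultiset_ofMultiset]

/-- At each location the excess of `s` over `t` is at most the mass of `β` there. The common part
`α` need not be a counting measure, so a common part can be cut off without checking integrality. -/
theorem card_sub_le [DecidableEq (E d)] {s t : Multiset (E d)} {α β γ : Measure (E d)}
    (hs : (ofMultiset s).1 = α + β) (ht : (ofMultiset t).1 = α + γ) :
    ((s - t).card : ℝ≥0∞) ≤ β Set.univ := by
  rw [← Multiset.toFinset_sum_count_eq, Nat.cast_sum]
  have h1 : ∀ a, (((s - t).count a : ℕ) : ℝ≥0∞) ≤ β {a} := by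
    intro a
    rw [Multiset.count_sub, ENNReal.natCast_sub, ← ofMultiset_singleton, ← ofMultiset_singleton,
      hs, ht, Measure.add_apply, Measure.add_apply, tsub_le_iff_right]
    calc α {a} + β {a} ≤ β {a} + α {a} + γ {a} := by rw [add_comm (α {a})]; exact le_self_add
      _ = _ := by rw [add_assoc]
  calc _ ≤ ∑ a ∈ (s - t).toFinset, β {a} := Finset.sum_le_sum fun a _ => h1 a
    _ = β ((s - t).toFinset : Set (E d)) := by rw [sum_measure_singleton]
    _ ≤ _ := measure_mono (Set.subset_univ _)

theorem measurable_steinDiff_toMultiset [DecidableEq (E d)] {f : Multiset (E d) → ℝ}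
    (hf : ∀ n, Measurable fun x : Fin n → E d => f (tupleMultiset x)) :
    Measurable fun q : E d × Config d × Config d =>
      steinDiff f q.1 q.2.1.toMultiset q.2.2.toMultiset := by
  let G : (ℕ × ℕ) × (E d × Config d × Config d) → ℝ := fun w =>
    steinDiff f w.2.1 (tupleMultiset (points w.1.1 w.2.2.1)) (tupleMultiset (points w.1.2 w.2.2.2))
  have hG : Measurable G := by
    refine measurable_from_prod_countable_right fun n => ?_
    refine (measurable_steinDiff hf n.1 n.2).comp (f := fun w : E d × Config d × Config d =>
      (w.1, points n.1 w.2.1, points n.2 w.2.2)) ?_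
    exact measurable_fst.prodMk (((measurable_points _).comp (by fun_prop)).prodMk
      ((measurable_points _).comp (by fun_prop)))
  exact hG.comp (f := fun q : E d × Config d × Config d =>
    ((q.2.1.numPoints, q.2.2.numPoints), q)) (((measurable_numPoints.comp (by fun_prop)).prodMk
      (measurable_numPoints.comp (by fun_prop))).prodMk measurable_id)
end Config

/-! ### The Stein equation for a Poisson process -/

theorem multiset_sum_ofReal {β : Type*} (s : Multiset β) {G : β → ℝ} (hG : ∀ b, 0 ≤ G b) :
    (s.map fun b => ENNReal.ofReal (G b)).sum = ENNReal.ofReal (s.map G).sum := by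
  induction s using Multiset.induction with
  | empty => simp
  | cons a s ih =>
    rw [Multiset.map_cons, Multiset.sum_cons, Multiset.map_cons, Multiset.sum_cons, ih,
      ENNReal.ofReal_add (hG a) (Multiset.sum_nonneg (by simpa using fun b _ => hG b))]

namespace IsMecke
open Config
variable {d : ℕ}

/-- Stein's method for Poisson process approximation: the function `Ψ - 1` is the first difference
of a solution of the Stein equation for `f`. -/
theorem exists_stein {Q : Measure (Config d)} [IsProbabilityMeasure Q] {Λ : Measure (E d)}
    [IsFiniteMeasure Λ] (h : IsMecke Q Λ) {f : Config d → ℝ≥0∞} (hf : Measurable f)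
    (hf1 : ∀ μ, f μ ≤ 1) :
    ∃ Ψ : E d → Config d → ℝ≥0∞, Measurable (Function.uncurry Ψ) ∧ (∀ x μ, Ψ x μ ≤ 2) ∧
      (∀ (x : E d) (μ₁ μ₂ : Config d) (α β γ : Measure (E d)), μ₁.1 Set.univ < ∞ →
        μ₂.1 Set.univ < ∞ → μ₁.1 = α + β → μ₂.1 = α + γ →
        Ψ x μ₁ ≤ Ψ x μ₂ + β Set.univ + γ Set.univ) ∧
      ∀ μ : Config d, μ.1 Set.univ < ∞ → f μ + ∫⁻ y, Ψ y μ ∂Λ + μ.1 Set.univ =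
        ∫⁻ ν, f ν ∂Q + ∫⁻ x, Ψ x (μ.removePts fun _ : Fin 1 => x) ∂μ.1 + Λ Set.univ := by
  classical
  let F : Multiset (E d) → ℝ := fun s => (f (ofMultiset s)).toReal
  have hF0 : ∀ s, 0 ≤ F s := fun s => ENNReal.toReal_nonneg
  have hF1 : ∀ s, F s ≤ 1 := fun s => ENNReal.toReal_le_of_le_ofReal zero_le_one
    (by simpa using hf1 _)
  have hFf : ∀ s, ENNReal.ofReal (F s) = f (ofMultiset s) := fun s =>
    ENNReal.ofReal_toReal (ne_top_of_le_ne_top ENNReal.one_ne_top (hf1 _))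
  have hFm : ∀ n, Measurable fun x : Fin n → E d => F (tupleMultiset x) := fun n =>
    (hf.comp (measurable_ofMultiset_tupleMultiset n)).ennreal_toReal
  -- The shift by `1` makes the difference nonnegative. Summed over the points and integrated over
  -- `Λ`, it produces the terms `μ.1 Set.univ` and `Λ Set.univ` of the claim.
  let K : E d → Multiset (E d) → Multiset (E d) → ℝ := fun x s u => 1 + steinDiff F x s u
  have hK0 : ∀ x s u, 0 ≤ K x s u := fun x s u => by
    have := (abs_le.1 (abs_steinDiff_le hF0 hF1 x s u)).1
    simp only [K]; linarith
  have hK2 : ∀ x s u, K x s u ≤ 2 := fun x s u => by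
    have := (abs_le.1 (abs_steinDiff_le hF0 hF1 x s u)).2
    simp only [K]; linarith
  have hKm : Measurable fun q : E d × Config d × Config d =>
      ENNReal.ofReal (K q.1 q.2.1.toMultiset q.2.2.toMultiset) :=
    (measurable_const.add (measurable_steinDiff_toMultiset hFm)).ennreal_ofReal
  refine ⟨fun x μ => ∫⁻ ν, ENNReal.ofReal (K x μ.toMultiset ν.toMultiset) ∂Q, ?_, ?_, ?_, ?_⟩
  · exact Measurable.lintegral_prod_right' (f := fun q : (E d × Config d) × Config d =>
      ENNReal.ofReal (K q.1.1 q.1.2.toMultiset q.2.toMultiset))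
      (hKm.comp (f := fun q : (E d × Config d) × Config d => (q.1.1, q.1.2, q.2)) (by fun_prop))
  · intro x μ
    calc _ ≤ ∫⁻ _, 2 ∂Q := lintegral_mono fun ν => by
          simpa using ENNReal.ofReal_le_ofReal (hK2 x μ.toMultiset ν.toMultiset)
      _ = 2 := by simp
  · intro x μ₁ μ₂ α β γ h1 h2 e1 e2
    obtain ⟨s, rfl⟩ := exists_eq_ofMultiset h1
    obtain ⟨t, rfl⟩ := exists_eq_ofMultiset h2
    simp only [toMultiset_ofMultiset]
    have b1 := card_sub_le e1 e2
    have b2 := card_sub_le e2 e1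
    calc _ ≤ ∫⁻ ν, (ENNReal.ofReal (K x t ν.toMultiset) + ((s - t).card + (t - s).card)) ∂Q := by
          refine lintegral_mono fun ν => ?_
          have := steinDiff_le_add hF0 hF1 x s t ν.toMultiset
          have h3 : K x s ν.toMultiset ≤ K x t ν.toMultiset + (((s - t).card : ℝ) +
            ((t - s).card : ℝ)) := by simp only [K]; linarith
          refine (ENNReal.ofReal_le_ofReal h3).trans ?_
          rw [ENNReal.ofReal_add (hK0 _ _ _) (by positivity),
            ENNReal.ofReal_add (Nat.cast_nonneg _) (Nat.cast_nonneg _)]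
          simp
      _ = ∫⁻ ν, ENNReal.ofReal (K x t ν.toMultiset) ∂Q + ((s - t).card + (t - s).card) := by
          rw [lintegral_add_right _ measurable_const]; simp
      _ ≤ _ := by rw [add_assoc]; gcongr
  · intro μ hμ
    obtain ⟨s, rfl⟩ := exists_eq_ofMultiset hμ
    rw [lintegral_ofMultiset, ofMultiset_univ]
    simp only [toMultiset_ofMultiset]
    have hm1 : ∀ (x : E d) (t : Multiset (E d)),
        Measurable fun ν : Config d => ENNReal.ofReal (K x t ν.toMultiset) := by
      intro x t
      have := hKm.comp (f := fun ν : Config d => (x, ofMultiset t, ν)) (by fun_prop)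
      simpa only [toMultiset_ofMultiset, Function.comp_def] using this
    have e1 : (s.map fun x => ∫⁻ ν, ENNReal.ofReal (K x
        ((ofMultiset s).removePts fun _ : Fin 1 => x).toMultiset ν.toMultiset) ∂Q).sum =
        ∫⁻ ν, (s.map fun x => ENNReal.ofReal (K x (s.erase x) ν.toMultiset)).sum ∂Q := by
      rw [Multiset.map_congr rfl fun x hx => by rw [toMultiset_removePt hx]]
      have : ∀ (r : Multiset (E d)),
          Measurable (fun ν : Config d =>
            (r.map fun x => ENNReal.ofReal (K x (s.erase x) ν.toMultiset)).sum) ∧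
          (r.map fun x => ∫⁻ ν, ENNReal.ofReal (K x (s.erase x) ν.toMultiset) ∂Q).sum =
          ∫⁻ ν, (r.map fun x => ENNReal.ofReal (K x (s.erase x) ν.toMultiset)).sum ∂Q := by
        intro r
        induction r using Multiset.induction with
        | empty => simp
        | cons a r ih =>
          simp only [Multiset.map_cons, Multiset.sum_cons]
          exact ⟨(hm1 _ _).add ih.1, by rw [ih.2, lintegral_add_left (hm1 _ _)]⟩
      exact (this s).2
    -- The Mecke equation read from right to left: the integral over `Λ` becomes a sum over the
    -- points `y` of `ν` at `ν - δ_y`, which matches `u.erase b` in `sub_eq_steinDiff`.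
    have e2 : ∫⁻ y, ∫⁻ ν, ENNReal.ofReal (K y s ν.toMultiset) ∂Q ∂Λ =
        ∫⁻ ν, ∫⁻ y, ENNReal.ofReal (K y s (ν.removePts fun _ : Fin 1 => y).toMultiset) ∂ν.1 ∂Q := by
      refine (h.lintegral_removePt (F := fun y ν => ENNReal.ofReal (K y s ν.toMultiset)) ?_).symm
      have := hKm.comp (f := fun q : E d × Config d => (q.1, ofMultiset s, q.2)) (by fun_prop)
      have hm : Measurable fun q : E d × Config d =>
          ENNReal.ofReal (K q.1 s q.2.toMultiset) := by
        simpa only [toMultiset_ofMultiset, Function.comp_def] using this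
      exact hm
    have hfin : ∀ᵐ ν ∂Q, ν.1 Set.univ < ∞ := h.ae_apply_lt_top .univ (measure_ne_top _ _)
    -- The identity `sub_eq_steinDiff` for a fixed realization of `ν`, arranged without subtraction;
    -- it is then integrated over `ν`.
    have key : ∀ᵐ ν ∂Q, f (ofMultiset s) +
        ∫⁻ y, ENNReal.ofReal (K y s (ν.removePts fun _ : Fin 1 => y).toMultiset) ∂ν.1 + s.card =
        f ν + (s.map fun x => ENNReal.ofReal (K x (s.erase x) ν.toMultiset)).sum +
          ν.1 Set.univ := by
      filter_upwards [hfin] with ν hν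
      obtain ⟨u, rfl⟩ := exists_eq_ofMultiset hν
      rw [lintegral_ofMultiset, ofMultiset_univ, toMultiset_ofMultiset,
        Multiset.map_congr rfl fun x hx => by rw [toMultiset_removePt hx],
        multiset_sum_ofReal _ fun b => hK0 _ _ _, multiset_sum_ofReal _ fun b => hK0 _ _ _,
        ← hFf, ← hFf, ← ENNReal.ofReal_natCast, ← ENNReal.ofReal_natCast]
      have p1 : ∀ (r : Multiset (E d)) (G : E d → ℝ), (∀ b, 0 ≤ G b) → 0 ≤ (r.map G).sum :=
        fun r G hG => Multiset.sum_nonneg (by simpa using fun b _ => hG b)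
      rw [← ENNReal.ofReal_add (hF0 _) (p1 _ _ fun b => hK0 _ _ _),
        ← ENNReal.ofReal_add (hF0 _) (p1 _ _ fun b => hK0 _ _ _),
        ← ENNReal.ofReal_add (add_nonneg (hF0 _) (p1 _ _ fun b => hK0 _ _ _)) (by positivity),
        ← ENNReal.ofReal_add (add_nonneg (hF0 _) (p1 _ _ fun b => hK0 _ _ _)) (by positivity)]
      congr 1
      have := sub_eq_steinDiff F s u
      simp only [K, Multiset.sum_map_add, Multiset.map_const', Multiset.sum_replicate,
        nsmul_eq_mul, mul_one]
      linarith
    have key2 := lintegral_congr_ae key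
    have hmS : Measurable fun ν : Config d => ν.1 Set.univ := measurable_apply measurable_id .univ
    rw [lintegral_add_right _ measurable_const, lintegral_add_left measurable_const,
      lintegral_add_right _ hmS, lintegral_add_left hf, h.lintegral_apply .univ, ← e1, ← e2] at key2
    simpa using key2
end IsMecke

/-! ### Change of the intensity measure -/

/-- The difference of the integrals of `ψ - 1`, `0 ≤ ψ ≤ 2`, is at most the total variation norm. -/
theorem lintegral_add_le_tvNorm {d : ℕ} (M Λ : Measure (E d)) [IsFiniteMeasure M]
    [IsFiniteMeasure Λ] {ψ : E d → ℝ≥0∞} (h2 : ∀ x, ψ x ≤ 2) :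
    ∫⁻ x, ψ x ∂M + Λ Set.univ ≤ ∫⁻ x, ψ x ∂Λ + M Set.univ + tvNorm M Λ := by
  -- On `D`, where `Λ ≤ M`, the excess mass is integrated using `ψ ≤ 2`; on the complement `M ≤ Λ`,
  -- and `ψ ≥ 0` suffices. The two excess masses are bounded by the two suprema in `tvNorm`.
  obtain ⟨D, hD, h1, h1'⟩ := hahn_decomposition M Λ
  have hle : Λ.restrict D ≤ M.restrict D := Measure.le_iff.2 fun s hs => by
    rw [Measure.restrict_apply hs, Measure.restrict_apply hs]
    exact h1 _ (hs.inter hD) Set.inter_subset_right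
  have hle' : M.restrict Dᶜ ≤ Λ.restrict Dᶜ := Measure.le_iff.2 fun s hs => by
    rw [Measure.restrict_apply hs, Measure.restrict_apply hs]
    exact h1' _ (hs.inter hD.compl) Set.inter_subset_right
  have hp : M D - Λ D ≤ ⨆ (B : Set (E d)) (_ : MeasurableSet B), (M B - Λ B) :=
    le_iSup₂_of_le D hD le_rfl
  have hn : Λ Dᶜ - M Dᶜ ≤ ⨆ (B : Set (E d)) (_ : MeasurableSet B), (Λ B - M B) :=
    le_iSup₂_of_le Dᶜ hD.compl le_rfl
  have a1 : ∫⁻ x in D, ψ x ∂M + Λ D ≤ ∫⁻ x in D, ψ x ∂Λ + M D + (M D - Λ D) := by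
    set ρ := M.restrict D - Λ.restrict D with hρ
    have e : ρ + Λ.restrict D = M.restrict D := Measure.sub_add_cancel_of_le hle
    have eD : M D = ρ Set.univ + Λ D := by
      have := congrArg (fun m : Measure (E d) => m Set.univ) e
      simpa using this.symm
    have : ∫⁻ x, ψ x ∂ρ ≤ 2 * ρ Set.univ := by
      calc _ ≤ ∫⁻ _, 2 ∂ρ := lintegral_mono h2
        _ = _ := by simp
    rw [← e, lintegral_add_measure, eD, ENNReal.add_sub_cancel_right (measure_ne_top _ _)]
    calc _ ≤ 2 * ρ Set.univ + ∫⁻ x in D, ψ x ∂Λ + Λ D := by gcongr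
      _ = _ := by ring
  have a2 : ∫⁻ x in Dᶜ, ψ x ∂M + Λ Dᶜ ≤ ∫⁻ x in Dᶜ, ψ x ∂Λ + M Dᶜ + (Λ Dᶜ - M Dᶜ) := by
    have e : M Dᶜ + (Λ Dᶜ - M Dᶜ) = Λ Dᶜ := add_tsub_cancel_of_le (h1' _ hD.compl subset_rfl)
    rw [add_assoc, e]
    gcongr
  rw [← lintegral_add_compl ψ hD, ← lintegral_add_compl (μ := Λ) ψ hD, ← measure_add_measure_compl hD,
    ← measure_add_measure_compl (μ := M) hD, tvNorm]
  calc _ = (∫⁻ x in D, ψ x ∂M + Λ D) + (∫⁻ x in Dᶜ, ψ x ∂M + Λ Dᶜ) := by ring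
    _ ≤ (∫⁻ x in D, ψ x ∂Λ + M D + (M D - Λ D)) +
        (∫⁻ x in Dᶜ, ψ x ∂Λ + M Dᶜ + (Λ Dᶜ - M Dᶜ)) := add_le_add a1 a2
    _ ≤ (∫⁻ x in D, ψ x ∂Λ + M D + ⨆ (B : Set (E d)) (_ : MeasurableSet B), (M B - Λ B)) +
        (∫⁻ x in Dᶜ, ψ x ∂Λ + M Dᶜ + ⨆ (B : Set (E d)) (_ : MeasurableSet B), (Λ B - M B)) := by
        gcongr
    _ = _ := by ring

/-! ### Measurability and symmetry of the circumcentre -/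

section Center
variable {d k : ℕ}

/-- The edges of the simplex `x` at the vertex `x 0`. -/
def edges (x : Fin (k + 1) → E d) (j : {j : Fin (k + 1) // j ≠ 0}) : E d := x j - x 0

theorem continuous_gram_edges :
    Continuous fun x : Fin (k + 1) → E d => Matrix.gram ℝ (edges x) := by
  refine continuous_matrix fun i j => ?_
  simp only [Matrix.gram_apply, edges]
  fun_prop

theorem affineIndependent_iff_det_gram_edges (x : Fin (k + 1) → E d) :
    AffineIndependent ℝ x ↔ (Matrix.gram ℝ (edges x)).det ≠ 0 := by
  rw [affineIndependent_iff_linearIndependent_vsub ℝ x 0,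
    Matrix.det_gram_ne_zero_iff_linearIndependent]
  rfl

/-- The circumcentre of an affinely independent family in terms of its Gram matrix. -/
theorem center_eq_gram {x : Fin (k + 1) → E d} (h : AffineIndependent ℝ x) :
    center x = x 0 + ∑ j, ((Matrix.gram ℝ (edges x))⁻¹.mulVec
      fun i => (inner ℝ (edges x i) (edges x i)) / 2) j • edges x j := by
  have hdet := (affineIndependent_iff_det_gram_edges x).1 h
  let s : Affine.Simplex ℝ (E d) k := ⟨x, h⟩
  have hs : center x = s.circumcenter := dif_pos h
  have h0 : s.circumcenter -ᵥ x 0 ∈ Submodule.span ℝ (Set.range (edges x)) := by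
    have h1 : s.circumcenter -ᵥ x 0 ∈ vectorSpan ℝ (Set.range x) := by
      rw [← direction_affineSpan]
      exact AffineSubspace.vsub_mem_direction s.circumcenter_mem_affineSpan
        (mem_affineSpan ℝ (Set.mem_range_self 0))
    rwa [vectorSpan_range_eq_span_range_vsub_right_ne ℝ x 0] at h1
  obtain ⟨c, hc⟩ := (Submodule.mem_span_range_iff_exists_fun ℝ).1 h0
  have hc' : s.circumcenter = x 0 + ∑ j, c j • edges x j := by
    rw [hc, vsub_eq_sub, add_sub_cancel]
  -- With the vertex `x 0` as origin and `v` the circumcentre, `‖e_i - v‖ = ‖v‖` is equivalent to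
  -- `⟨e_i, v⟩ = ‖e_i‖² / 2`. This is a linear system for the coordinates of `v` with the Gram
  -- matrix of the edges.
  have heq : (Matrix.gram ℝ (edges x)).mulVec c =
      fun i => (inner ℝ (edges x i) (edges x i)) / 2 := by
    funext i
    have e1 : (Matrix.gram ℝ (edges x)).mulVec c i = inner ℝ (edges x i) (∑ j, c j • edges x j) := by
      simp [Matrix.mulVec, dotProduct, Matrix.gram_apply, inner_sum, inner_smul_right, mul_comm]
    rw [e1]
    have d1 := s.dist_circumcenter_eq_circumradius i.1
    have d0 := s.dist_circumcenter_eq_circumradius 0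
    rw [← d0, hc', dist_eq_norm, dist_eq_norm] at d1
    have p0 : s.points 0 - (x 0 + ∑ j, c j • edges x j) = -∑ j, c j • edges x j := by
      change x 0 - _ = _; abel
    have p1 : s.points i.1 - (x 0 + ∑ j, c j • edges x j) =
        edges x i - ∑ j, c j • edges x j := by
      change x i.1 - _ = x i.1 - x 0 - _; abel
    rw [p0, p1, norm_neg] at d1
    have d2 := norm_sub_sq_real (edges x i) (∑ j, c j • edges x j)
    rw [d1, ← real_inner_self_eq_norm_sq (edges x i)] at d2
    linarith
  rw [hs, hc', ← heq, Matrix.mulVec_mulVec, Matrix.nonsing_inv_mul _ (isUnit_iff_ne_zero.2 hdet),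
    Matrix.one_mulVec]

/-- Affinely independent tuples form an open set. There the circumcentre is given by
`center_eq_gram`, and the inverse Gram matrix is the adjugate divided by the determinant. -/
theorem measurable_center : ∀ {m : ℕ}, Measurable (center (d := d) (m := m))
  | 0 => measurable_const
  | k + 1 => by
    classical
    have hset : MeasurableSet {x : Fin (k + 1) → E d | AffineIndependent ℝ x} :=
      isOpen_setOfPred_affineIndependent.measurableSet
    have hG := continuous_gram_edges (d := d) (k := k)
    have : (center (d := d) (m := k + 1)) = fun x => if AffineIndependent ℝ x then
        x 0 + ∑ j, ((Matrix.gram ℝ (edges x))⁻¹.mulVec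
          fun i => (inner ℝ (edges x i) (edges x i)) / 2) j • edges x j else 0 := by
      funext x
      by_cases h : AffineIndependent ℝ x
      · rw [if_pos h, center_eq_gram h]
      · rw [if_neg h]
        exact dif_neg h
    rw [this]
    refine Measurable.ite hset ?_ measurable_const
    have he : ∀ j, Measurable fun x : Fin (k + 1) → E d => edges x j := fun j =>
      Continuous.measurable (by unfold edges; fun_prop)
    have hs : ∀ j, Measurable fun x : Fin (k + 1) → E d => ((Matrix.gram ℝ (edges x))⁻¹.mulVec
        fun i => (inner ℝ (edges x i) (edges x i)) / 2) j := by
      intro j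
      simp only [Matrix.mulVec, dotProduct]
      refine Finset.measurable_fun_sum _ fun i _ => Measurable.mul ?_ ?_
      · simp only [Matrix.inv_def, Matrix.smul_apply, smul_eq_mul, Ring.inverse_eq_inv']
        exact hG.matrix_det.measurable.inv.mul
          ((continuous_apply_apply j i).comp hG.matrix_adjugate).measurable
      · exact ((he i).inner (he i)).div_const 2
    exact (measurable_pi_apply 0).add (Finset.measurable_fun_sum _ fun j _ => (hs j).smul (he j))

theorem center_comp_perm : ∀ {m : ℕ} (x : Fin m → E d) (σ : Equiv.Perm (Fin m)),
    center (x ∘ σ) = center x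
  | 0, _, _ => rfl
  | k + 1, x, σ => by
    have hi : AffineIndependent ℝ (x ∘ σ) ↔ AffineIndependent ℝ x := affineIndependent_equiv σ
    by_cases h : AffineIndependent ℝ x
    · refine (dif_pos (hi.2 h)).trans (Eq.trans ?_ (dif_pos h).symm)
      exact (⟨x, h⟩ : Affine.Simplex ℝ (E d) k).circumcenter_reindex σ.symm
    · exact (dif_neg (mt hi.1 h) : center (x ∘ σ) = 0).trans (dif_neg h : center x = 0).symm

end Center

/-! ### The process `ξ_t` as a finite counting measure -/

theorem measurableSet_window (d : ℕ) (t : ℝ) : MeasurableSet (window d t) := by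
  have : window d t = ⋂ i, ({z : E d | 0 ≤ z i} ∩ {z : E d | z i ≤ t ^ (1 / (d : ℝ))}) := by
    ext z
    simp only [Set.mem_iInter]
    rfl
  rw [this]
  exact MeasurableSet.iInter fun i =>
    (measurableSet_le measurable_const (by fun_prop)).inter
      (measurableSet_le (by fun_prop) measurable_const)

theorem isBounded_window (d : ℕ) (t : ℝ) : Bornology.IsBounded (window d t) := by
  rw [isBounded_iff_forall_norm_le]
  refine ⟨√(∑ _i : Fin d, (t ^ (1 / (d : ℝ))) ^ 2), fun z hz => ?_⟩
  rw [EuclideanSpace.norm_eq]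
  refine Real.sqrt_le_sqrt (Finset.sum_le_sum fun i _ => ?_)
  rw [Real.norm_eq_abs, abs_of_nonneg (hz i).1]
  exact pow_le_pow_left₀ (hz i).1 (hz i).2 2

/-- Embeddings with the same image form an orbit of the symmetric group with `m!` elements, so the
sum is `m!` times the number of images on which `H` is `1`. This is why the normalization by `1 /
m!` makes `ξ_t` integer-valued. -/
theorem tsum_embedding_symm {m : ℕ} {α : Type*} {H : (Fin m ↪ α) → ℝ≥0∞}
    (h01 : ∀ f, H f = 0 ∨ H f = 1)
    (hsymm : ∀ (f : Fin m ↪ α) (σ : Equiv.Perm (Fin m)), H (σ.toEmbedding.trans f) = H f) :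
    ∃ n : ℕ∞, ∑' f, H f = m.factorial * (n : ℝ≥0∞) := by
  classical
  let toS : (Fin m ↪ α) → Finset α := fun f => Finset.univ.map f
  have hcard : ∀ f, (toS f).card = m := fun f => by simp [toS]
  have hσ : ∀ f f' : Fin m ↪ α, toS f = toS f' → ∃ σ : Equiv.Perm (Fin m),
      σ.toEmbedding.trans f = f' := by
    intro f f' h
    have h1 : ∀ i, ∃ j, f j = f' i := fun i => by
      have : f' i ∈ toS f := by rw [h]; simp [toS]
      simpa [toS] using this
    choose σ hσ using h1
    have hinj : Function.Injective σ := fun i j hij => f'.injective (by rw [← hσ, ← hσ, hij])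
    refine ⟨Equiv.ofBijective σ (Finite.injective_iff_bijective.1 hinj), ?_⟩
    ext i
    exact hσ i
  let rep : Set.range toS → (Fin m ↪ α) := fun s => s.2.choose
  have hrep : ∀ s, toS (rep s) = s.1 := fun s => s.2.choose_spec
  let Φ : Set.range toS × Equiv.Perm (Fin m) ≃ (Fin m ↪ α) := by
    refine Equiv.ofBijective (fun q => q.2.toEmbedding.trans (rep q.1)) ⟨?_, ?_⟩
    · rintro ⟨s, σ⟩ ⟨s', σ'⟩ h
      have hs : ∀ (s : Set.range toS) (σ : Equiv.Perm (Fin m)),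
          toS (σ.toEmbedding.trans (rep s)) = s.1 := by
        intro s σ
        rw [← hrep s]
        simp only [toS]
        rw [← Finset.map_map]
        simp
      have e : s = s' := Subtype.ext (by rw [← hs s σ, ← hs s' σ']; exact congrArg toS h)
      subst e
      refine Prod.ext rfl (Equiv.ext fun i => (rep s).injective ?_)
      exact DFunLike.congr_fun h i
    · intro f
      obtain ⟨σ, h⟩ := hσ (rep ⟨toS f, f, rfl⟩) f (hrep _)
      exact ⟨(⟨toS f, f, rfl⟩, σ), h⟩
  have h1 : ∀ s : Set.range toS, H (rep s) = ({s | H (rep s) = 1} : Set _).indicator 1 s := by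
    intro s
    by_cases h : H (rep s) = 1
    · rw [Set.indicator_of_mem (show s ∈ {s | H (rep s) = 1} from h), h]; rfl
    · rw [Set.indicator_of_notMem (show s ∉ {s | H (rep s) = 1} from h)]
      exact (h01 _).resolve_right h
  refine ⟨({s | H (rep s) = 1} : Set _).encard, ?_⟩
  rw [← Φ.tsum_eq, ENNReal.tsum_prod (f := fun s σ => H (Φ (s, σ)))]
  have h2 : ∀ s : Set.range toS, ∑' σ : Equiv.Perm (Fin m), H (Φ (s, σ)) =
      m.factorial * ({s | H (rep s) = 1} : Set _).indicator 1 s := by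
    intro s
    rw [← h1, tsum_fintype]
    calc _ = ∑ _σ : Equiv.Perm (Fin m), H (rep s) := Finset.sum_congr rfl fun σ _ => hsymm _ σ
      _ = _ := by simp [Fintype.card_perm]
  simp only [h2]
  rw [ENNReal.tsum_mul_left, ← tsum_subtype]
  congr 1
  exact ENNReal.tsum_set_one _

namespace Config
variable {d m : ℕ}

/-- The measure `∑ F(𝐱, μ - δ_𝐱) δ_{z(𝐱)}` over all `m`-tuples `𝐱` of points of `μ`. -/
noncomputable def facMeas (m : ℕ) (μ : Config d) (F : (Fin m → E d) → Config d → ℝ≥0∞) :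
    Measure (E d) :=
  Measure.sum fun f : Fin m ↪ μ.Points =>
    F (tupleOf f) (μ.removePts (tupleOf f)) • Measure.dirac (center (tupleOf f))

theorem facMeas_apply (μ : Config d) (F : (Fin m → E d) → Config d → ℝ≥0∞) {B : Set (E d)}
    (hB : MeasurableSet B) :
    facMeas m μ F B = facSum m μ fun y μ' => F y μ' * B.indicator 1 (center y) := by
  rw [facMeas, Measure.sum_apply _ hB]
  simp only [Measure.smul_apply, smul_eq_mul, Measure.dirac_apply' _ hB]
  rfl

theorem facMeas_univ (μ : Config d) (F : (Fin m → E d) → Config d → ℝ≥0∞) :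
    facMeas m μ F Set.univ = facSum m μ F := by
  rw [facMeas_apply _ _ .univ]
  simp

theorem lintegral_facMeas (μ : Config d) (F : (Fin m → E d) → Config d → ℝ≥0∞)
    (G : E d → ℝ≥0∞) :
    ∫⁻ z, G z ∂(facMeas m μ F) = facSum m μ fun y μ' => F y μ' * G (center y) := by
  rw [facMeas, lintegral_sum_measure]
  simp only [lintegral_smul_measure, lintegral_dirac, smul_eq_mul]
  rfl

end Config

/-- `1{z(𝐱) ∈ W_t} g(𝐱, μ)`. -/
noncomputable def selection {d m : ℕ} (t : ℝ) (g : (Fin m → E d) → Config d → ℝ≥0)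
    (x : Fin m → E d) (μ : Config d) : ℝ≥0∞ :=
  ind (center x ∈ window d t) * (g x μ : ℝ≥0∞)

section Selection
open Config
variable {d m : ℕ} {t : ℝ} {g : (Fin m → E d) → Config d → ℝ≥0}

theorem xiProc_eq (t : ℝ) (g : (Fin m → E d) → Config d → ℝ≥0) (μ : Config d) :
    xiProc t g μ = (m.factorial : ℝ≥0∞)⁻¹ • facMeas m μ (selection t g) := rfl

theorem measurable_selection (hg : Measurable (Function.uncurry g)) :
    Measurable (Function.uncurry (selection t g)) := by
  have h1 : Measurable fun q : (Fin m → E d) × Config d => ind (center q.1 ∈ window d t) :=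
    measurable_ind ((measurable_center.comp measurable_fst) (measurableSet_window d t))
  exact h1.mul (measurable_coe_nnreal_ennreal.comp hg)

theorem selection_eq (hg : ∀ x μ, g x μ = 0 ∨ g x μ = 1) (x : Fin m → E d) (μ : Config d) :
    selection t g x μ = 0 ∨ selection t g x μ = 1 := by
  by_cases h : center x ∈ window d t
  · rcases hg x μ with h' | h' <;> simp [selection, ind_pos h, h']
  · simp [selection, ind_neg h]

theorem selection_comp_perm
    (hg : ∀ (x : Fin m → E d) (μ : Config d) (σ : Equiv.Perm (Fin m)), g (x ∘ σ) μ = g x μ)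
    (x : Fin m → E d) (μ : Config d) (σ : Equiv.Perm (Fin m)) :
    selection t g (x ∘ σ) μ = selection t g x μ := by
  rw [selection, selection, center_comp_perm, hg]

theorem lintegral_xiProc (μ : Config d) (G : E d → ℝ≥0∞) :
    ∫⁻ z, G z ∂(xiProc t g μ) = (m.factorial : ℝ≥0∞)⁻¹ *
      facSum m μ fun y μ' => selection t g y μ' * G (center y) := by
  rw [xiProc_eq, lintegral_smul_measure, lintegral_facMeas, smul_eq_mul]

theorem xiProc_apply (μ : Config d) {B : Set (E d)} (hB : MeasurableSet B) :
    xiProc t g μ B = (m.factorial : ℝ≥0∞)⁻¹ *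
      facSum m μ fun y μ' => selection t g y μ' * B.indicator 1 (center y) := by
  rw [xiProc_eq, Measure.smul_apply, facMeas_apply _ _ hB, smul_eq_mul]

theorem removePts_comp_perm (μ : Config d) (x : Fin m → E d) (σ : Equiv.Perm (Fin m)) :
    μ.removePts (x ∘ σ) = μ.removePts x := by
  have : ∑ i, Measure.dirac ((x ∘ σ) i) = ∑ i, Measure.dirac (x i) :=
    Equiv.sum_comp σ fun i => Measure.dirac (x i)
  unfold Config.removePts
  split_ifs with h1 h2 h2
  · exact Subtype.ext (congrArg (μ.1 - ·) this)
  · exact absurd (this ▸ h1) h2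
  · exact absurd (this ▸ h2) h1
  · rfl

theorem addPts_comp_perm (μ : Config d) (x : Fin m → E d) (σ : Equiv.Perm (Fin m)) :
    μ.addPts (x ∘ σ) = μ.addPts x :=
  Subtype.ext (congrArg (μ.1 + ·) (Equiv.sum_comp σ fun i => Measure.dirac (x i)))

theorem exists_xiProc_eq_enat (hg : ∀ x μ, g x μ = 0 ∨ g x μ = 1)
    (hg' : ∀ (x : Fin m → E d) (μ : Config d) (σ : Equiv.Perm (Fin m)), g (x ∘ σ) μ = g x μ)
    (μ : Config d) {B : Set (E d)} (hB : MeasurableSet B) :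
    ∃ n : ℕ∞, xiProc t g μ B = n := by
  classical
  obtain ⟨n, hn⟩ := tsum_embedding_symm (m := m) (α := μ.Points)
    (H := fun f => selection t g (tupleOf f) (μ.removePts (tupleOf f)) *
      B.indicator 1 (center (tupleOf f))) (fun f => by
        rcases selection_eq (t := t) hg (tupleOf f) (μ.removePts (tupleOf f)) with h | h
        · simp [h]
        · by_cases h' : center (tupleOf f) ∈ B <;> simp [h, h']) (fun f σ => by
        have : tupleOf (σ.toEmbedding.trans f) = tupleOf f ∘ σ := rfl
        rw [this, removePts_comp_perm, selection_comp_perm hg', center_comp_perm])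
  refine ⟨n, ?_⟩
  rw [xiProc_apply _ hB, facSum, hn, ← mul_assoc, ENNReal.inv_mul_cancel (by positivity) (by simp),
    one_mul]

theorem measurable_xiProc_apply (hg : Measurable (Function.uncurry g)) {B : Set (E d)}
    (hB : MeasurableSet B) : Measurable fun μ : Config d => xiProc t g μ B := by
  simp only [xiProc_apply _ hB]
  refine Measurable.const_mul (measurable_facSum (F := fun (_ : Config d) y μ' =>
    selection t g y μ' * B.indicator 1 (center y)) measurable_id ?_) _
  refine ((measurable_selection hg).comp (f := fun q : Config d × (Fin m → E d) × Config d => q.2)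
    measurable_snd).mul ?_
  exact (measurable_one.indicator hB).comp (measurable_center.comp (by fun_prop))

theorem measurable_xiProc (hg : Measurable (Function.uncurry g)) :
    Measurable fun μ : Config d => xiProc t g μ :=
  Measure.measurable_of_measurable_coe _ fun _ hB => measurable_xiProc_apply hg hB

theorem xiProc_compl_window (μ : Config d) : xiProc t g μ (window d t)ᶜ = 0 := by
  rw [xiProc_apply _ (measurableSet_window d t).compl, facSum]
  simp only [mul_eq_zero, ENNReal.tsum_eq_zero]
  right
  intro f
  by_cases h : center (tupleOf f) ∈ window d t
  · right; simp [h]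
  · left; simp [selection, ind_neg h]

open Classical in
/-- The configuration `ξ_t(μ)` if it is finite, and `0` otherwise. -/
noncomputable def xiConfig (t : ℝ) (g : (Fin m → E d) → Config d → ℝ≥0)
    (hg : ∀ x μ, g x μ = 0 ∨ g x μ = 1)
    (hg' : ∀ (x : Fin m → E d) (μ : Config d) (σ : Equiv.Perm (Fin m)), g (x ∘ σ) μ = g x μ)
    (μ : Config d) : Config d :=
  if h : xiProc t g μ Set.univ < ∞ then
    ⟨xiProc t g μ, fun _ _ => (measure_mono (Set.subset_univ _)).trans_lt h,
      fun _ hB => exists_xiProc_eq_enat hg hg' μ hB⟩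
  else 0

theorem xiConfig_val {hg : ∀ x μ, g x μ = 0 ∨ g x μ = 1}
    {hg' : ∀ (x : Fin m → E d) (μ : Config d) (σ : Equiv.Perm (Fin m)), g (x ∘ σ) μ = g x μ}
    {μ : Config d} (h : xiProc t g μ Set.univ < ∞) :
    (xiConfig t g hg hg' μ).1 = xiProc t g μ := by
  rw [xiConfig, dif_pos h]

theorem xiConfig_univ_lt_top {hg : ∀ x μ, g x μ = 0 ∨ g x μ = 1}
    {hg' : ∀ (x : Fin m → E d) (μ : Config d) (σ : Equiv.Perm (Fin m)), g (x ∘ σ) μ = g x μ}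
    (μ : Config d) : (xiConfig t g hg hg' μ).1 Set.univ < ∞ := by
  by_cases h : xiProc t g μ Set.univ < ∞
  · rwa [xiConfig_val h]
  · rw [xiConfig, dif_neg h]
    simp [zero_val]

theorem measurable_xiConfig {hg : ∀ x μ, g x μ = 0 ∨ g x μ = 1}
    {hg' : ∀ (x : Fin m → E d) (μ : Config d) (σ : Equiv.Perm (Fin m)), g (x ∘ σ) μ = g x μ}
    (hgm : Measurable (Function.uncurry g)) : Measurable (xiConfig t g hg hg') := by
  classical
  refine measurable_of_apply fun B hB => ?_
  have : (fun μ => (xiConfig t g hg hg' μ).1 B) = fun μ =>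
      if xiProc t g μ Set.univ < ∞ then xiProc t g μ B else 0 := by
    funext μ
    by_cases h : xiProc t g μ Set.univ < ∞
    · rw [if_pos h, xiConfig_val h]
    · rw [if_neg h, xiConfig, dif_neg h]
      rfl
  rw [this]
  exact Measurable.ite (measurableSet_lt (measurable_xiProc_apply hgm .univ) measurable_const)
    (measurable_xiProc_apply hgm hB) measurable_const

end Selection

/-! ### Decomposition of tuples by their origin in `𝐱` or in `ζ` -/

section Split
variable {m : ℕ}

/-- The indices that are mapped to the right summand. -/
def rightSet {α β : Type*} (f : Fin m ↪ α ⊕ β) : Finset (Fin m) :=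
  Finset.univ.filter fun j => (f j).isRight

/-- The indices smaller than `l`. -/
def lowSet (m l : ℕ) : Finset (Fin m) := Finset.univ.filter fun j => (j : ℕ) < l

theorem card_lowSet {l : ℕ} (hl : l ≤ m) : (lowSet m l).card = l := by
  rw [lowSet, Fin.card_filter_val_lt, min_eq_right hl]

theorem exists_perm_of_card (A B : Finset (Fin m)) (h : A.card = B.card) :
    ∃ σ : Equiv.Perm (Fin m), ∀ j, σ j ∈ A ↔ j ∈ B := by
  classical
  let e : {j // j ∈ B} ≃ {j // j ∈ A} := Finset.equivOfCardEq h.symm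
  refine ⟨e.extendSubtype, fun j => ?_⟩
  by_cases hj : j ∈ B
  · simp only [hj, iff_true]
    exact e.extendSubtype_mem j hj
  · simp only [hj, iff_false]
    exact e.extendSubtype_not_mem j hj

/-- The embedding that is `f` on the first `l` indices and `i` on the other ones. -/
def joinEmb {α β : Type*} {l : ℕ} (i : Fin (m - l) ↪ α) (f : Fin l ↪ β) : Fin m ↪ α ⊕ β where
  toFun j := if h : (j : ℕ) < l then Sum.inr (f ⟨j, h⟩) else Sum.inl (i ⟨j - l, by omega⟩)
  inj' j k hjk := by
    by_cases hj : (j : ℕ) < l <;> by_cases hk : (k : ℕ) < l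
    · simp only [hj, hk, dif_pos, Sum.inr.injEq, EmbeddingLike.apply_eq_iff_eq, Fin.mk.injEq] at hjk
      exact Fin.ext hjk
    · simp [hj, hk] at hjk
    · simp [hj, hk] at hjk
    · simp only [hj, hk, dif_neg, not_false_iff, Sum.inl.injEq, EmbeddingLike.apply_eq_iff_eq,
        Fin.mk.injEq] at hjk
      exact Fin.ext (by omega)

theorem joinEmb_apply {α β : Type*} {l : ℕ} (i : Fin (m - l) ↪ α) (f : Fin l ↪ β) (j : Fin m) :
    joinEmb i f j =
      if h : (j : ℕ) < l then Sum.inr (f ⟨j, h⟩) else Sum.inl (i ⟨j - l, by omega⟩) := rfl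

theorem joinEmb_injective {α β : Type*} {l : ℕ} (hl : l ≤ m) : Function.Injective
    fun q : (Fin (m - l) ↪ α) × (Fin l ↪ β) => joinEmb (m := m) q.1 q.2 := by
  rintro ⟨i, f⟩ ⟨i', f'⟩ h
  refine Prod.ext ?_ ?_
  · ext k
    have := DFunLike.congr_fun h ⟨l + k, by omega⟩
    simpa [joinEmb] using this
  · ext k
    have := DFunLike.congr_fun h ⟨k, by omega⟩
    simpa [joinEmb] using this

theorem exists_joinEmb {α β : Type*} {l : ℕ} (hl : l ≤ m) {f : Fin m ↪ α ⊕ β}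
    (hf : rightSet f = lowSet m l) : ∃ q : (Fin (m - l) ↪ α) × (Fin l ↪ β),
      joinEmb (m := m) q.1 q.2 = f := by
  have h1 : ∀ j : Fin m, (f j).isRight ↔ (j : ℕ) < l := fun j => by
    have := Finset.ext_iff.1 hf j
    simpa [rightSet, lowSet] using this
  have h2 : ∀ k : Fin l, ∃ q, f ⟨k, by omega⟩ = Sum.inr q := fun k =>
    Sum.isRight_iff.1 ((h1 _).2 k.2)
  have h3 : ∀ k : Fin (m - l), ∃ q, f ⟨l + k, by omega⟩ = Sum.inl q := fun k => by
    rw [← Sum.isLeft_iff, ← Sum.not_isRight, Bool.not_eq_true, ← Bool.not_eq_true, h1]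
    simp
  choose F hF using h2
  choose I hI using h3
  refine ⟨(⟨I, fun j k h => ?_⟩, ⟨F, fun j k h => ?_⟩), ?_⟩
  · have := f.injective ((hI j).trans ((congrArg _ h).trans (hI k).symm))
    simp only [Fin.mk.injEq] at this
    exact Fin.ext (by omega)
  · have := f.injective ((hF j).trans ((congrArg _ h).trans (hF k).symm))
    simp only [Fin.mk.injEq] at this
    exact Fin.ext this
  · ext j : 1
    by_cases hj : (j : ℕ) < l
    · have := hF ⟨j, hj⟩
      rw [joinEmb_apply, dif_pos hj]
      exact this.symm
    · have := hI ⟨j - l, by omega⟩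
      have e : (⟨l + (⟨j - l, by omega⟩ : Fin (m - l)), by simp; omega⟩ : Fin m) = j :=
        Fin.ext (by simp; omega)
      rw [e] at this
      rw [joinEmb_apply, dif_neg hj]
      exact this.symm

theorem rightSet_joinEmb {α β : Type*} {l : ℕ} (i : Fin (m - l) ↪ α) (f : Fin l ↪ β) :
    rightSet (joinEmb (m := m) i f) = lowSet m l := by
  ext j
  rw [rightSet, lowSet, Finset.mem_filter, Finset.mem_filter, joinEmb_apply]
  by_cases hj : (j : ℕ) < l <;> simp [hj]

/-- Decomposition of a symmetric sum over embeddings into a disjoint union, by the number of indices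
that are mapped to the second part. -/
theorem tsum_embedding_sum {α β : Type*} {H : (Fin m ↪ α ⊕ β) → ℝ≥0∞}
    (hsymm : ∀ (f : Fin m ↪ α ⊕ β) (σ : Equiv.Perm (Fin m)), H (σ.toEmbedding.trans f) = H f) :
    ∑' f, H f = ∑ l ∈ Finset.range (m + 1), (m.choose l : ℝ≥0∞) *
      ∑' (i : Fin (m - l) ↪ α) (f : Fin l ↪ β), H (joinEmb i f) := by
  classical
  have h1 : ∀ f, H f = ∑ A ∈ (Finset.univ : Finset (Fin m)).powerset,
      if rightSet f = A then H f else 0 := fun f => by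
    rw [Finset.sum_ite_eq, if_pos (Finset.mem_powerset.2 (Finset.subset_univ _))]
  -- A permutation moves the set `A` of indices mapped to the right summand to the first `A.card`
  -- indices. By symmetry only the cardinality of `A` matters, which produces the binomial
  -- coefficients.
  have h2 : ∀ A : Finset (Fin m), ∑' f, (if rightSet f = A then H f else 0) =
      ∑' (i : Fin (m - A.card) ↪ α) (f : Fin A.card ↪ β), H (joinEmb i f) := by
    intro A
    have hA : A.card ≤ m := by simpa using Finset.card_le_univ A
    obtain ⟨σ, hσ⟩ := exists_perm_of_card A (lowSet m A.card) (card_lowSet hA).symm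
    have e1 : ∀ f : Fin m ↪ α ⊕ β, (if rightSet f = A then H f else 0) =
        if rightSet (σ.toEmbedding.trans f) = lowSet m A.card then H (σ.toEmbedding.trans f)
          else 0 := by
      intro f
      rw [hsymm]
      have : rightSet f = A ↔ rightSet (σ.toEmbedding.trans f) = lowSet m A.card := by
        simp only [Finset.ext_iff, ← hσ]
        simp only [rightSet, Finset.mem_filter, Finset.mem_univ, true_and]
        exact ⟨fun h j => h (σ j), fun h j => by simpa using h (σ.symm j)⟩
      simp only [this]
    simp only [e1]
    have e2 := (Equiv.embeddingCongr σ.symm (Equiv.refl (α ⊕ β))).tsum_eq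
      (fun f : Fin m ↪ α ⊕ β => if rightSet f = lowSet m A.card then H f else 0)
    have e3 : ∀ f : Fin m ↪ α ⊕ β, Equiv.embeddingCongr σ.symm (Equiv.refl (α ⊕ β)) f =
        σ.toEmbedding.trans f := fun f => by ext; simp
    simp only [e3] at e2
    rw [e2]
    rw [← ENNReal.tsum_prod (f := fun (i : Fin (m - A.card) ↪ α) (f : Fin A.card ↪ β) =>
      H (joinEmb i f))]
    rw [← (joinEmb_injective (α := α) (β := β) hA).tsum_eq
      (f := fun f : Fin m ↪ α ⊕ β => if rightSet f = lowSet m A.card then H f else 0)]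
    · simp only [rightSet_joinEmb, if_true]
    · intro f hf
      have : rightSet f = lowSet m A.card := by
        by_contra h
        simp [h] at hf
      exact exists_joinEmb hA this
  rw [tsum_congr h1, Summable.tsum_finsetSum fun _ _ => ENNReal.summable, Finset.sum_congr rfl
    fun A _ => h2 A, Finset.sum_powerset_apply_card
      (fun l => ∑' (i : Fin (m - l) ↪ α) (f : Fin l ↪ β), H (joinEmb i f))]
  simp

end Split

namespace Config
variable {d m : ℕ}

theorem _root_.join_self {d m : ℕ} (y : Fin m → E d) (u : Fin (m - m) → E d) :
    (join y u : Fin m → E d) = y := by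
  funext j
  simp [join]

/-- Decomposition of a symmetric sum over the `m`-tuples of points of `ζ + δ_𝐱`, by the number of
points from `ζ`. -/
theorem facSum_addPts (hm : 1 ≤ m) (ζ : Config d) (x : Fin m → E d) {H : (Fin m → E d) → ℝ≥0∞}
    (hH : ∀ (y : Fin m → E d) (σ : Equiv.Perm (Fin m)), H (y ∘ σ) = H y) :
    facSum m (ζ.addPts x) (fun y _ => H y) = m.factorial * H x +
      ∑ l ∈ Finset.Ico 1 m, (m.choose l : ℝ≥0∞) * ∑ i : Fin (m - l) ↪ Fin m,
        facSum l ζ (fun y _ => H (join y (x ∘ i))) + facSum m ζ (fun y _ => H y) := by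
  classical
  have hj : ∀ (l : ℕ) (i : Fin (m - l) ↪ Fin m) (f : Fin l ↪ ζ.Points),
      (Sum.elim x fun p : ζ.Points => p.1.1) ∘ joinEmb i f = join (tupleOf f) (x ∘ i) := by
    intro l i f
    funext j
    rw [Function.comp_apply, joinEmb_apply, join]
    by_cases h : (j : ℕ) < l <;> simp [h, tupleOf]
  have h1 : ∀ l, ∑' (i : Fin (m - l) ↪ Fin m) (f : Fin l ↪ ζ.Points),
      H ((Sum.elim x fun p : ζ.Points => p.1.1) ∘ joinEmb i f) =
      ∑ i : Fin (m - l) ↪ Fin m, facSum l ζ (fun y _ => H (join y (x ∘ i))) := by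
    intro l
    rw [tsum_fintype]
    refine Finset.sum_congr rfl fun i _ => tsum_congr fun f => ?_
    rw [hj]
  have h0 : ∑ i : Fin (m - 0) ↪ Fin m, facSum 0 ζ (fun y _ => H (join y (x ∘ i))) =
      m.factorial * H x := by
    have : ∀ i : Fin (m - 0) ↪ Fin m, facSum 0 ζ (fun y _ => H (join y (x ∘ i))) = H x := by
      intro i
      rw [facSum_zero]
      let σ : Equiv.Perm (Fin m) := Equiv.ofBijective (i : Fin m → Fin m)
        (Finite.injective_iff_bijective.1 i.injective)
      rw [← hH x σ]
      congr 1
    simp only [this]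
    rw [Finset.sum_const, Finset.card_univ, Fintype.card_embedding_eq]
    simp [Nat.descFactorial_self]
  have hmm : ∑ i : Fin (m - m) ↪ Fin m, facSum m ζ (fun y _ => H (join y (x ∘ i))) =
      facSum m ζ (fun y _ => H y) := by
    simp only [join_self]
    rw [Finset.sum_const, Finset.card_univ, Fintype.card_embedding_eq]
    simp
  rw [(ζ.isEnum_points.addPts x).facSum_eq,
    tsum_embedding_sum (H := fun f => H ((Sum.elim x fun p : ζ.Points => p.1.1) ∘ f))
      (fun f σ => hH ((Sum.elim x fun p : ζ.Points => p.1.1) ∘ f) σ), Finset.sum_range_succ, Finset.range_eq_Ico,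
    Finset.sum_eq_sum_Ico_succ_bot (by omega)]
  simp only [h1, h0, hmm]
  simp

end Config

section Integration
variable {d m : ℕ}

/-- Integration over an `m`-tuple whose indices are split into two groups. -/
theorem lintegral_pi_split (lam : Measure (E d)) [SigmaFinite lam] {α β : Type*} [Fintype α]
    [Fintype β] (e : α ⊕ β ≃ Fin m) {F : (Fin m → E d) → ℝ≥0∞} (hF : Measurable F) :
    ∫⁻ x, F x ∂(Measure.pi fun _ : Fin m => lam) =
      ∫⁻ x : α → E d, ∫⁻ u : β → E d, F (Sum.elim x u ∘ e.symm) ∂(Measure.pi fun _ => lam)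
        ∂(Measure.pi fun _ => lam) := by
  let T : (α → E d) × (β → E d) → (Fin m → E d) := fun q => Sum.elim q.1 q.2 ∘ e.symm
  have hT : Measurable T := by
    refine measurable_pi_iff.2 fun j => ?_
    rcases h : e.symm j with a | b
    · simp only [T, Function.comp_apply, h, Sum.elim_inl]
      fun_prop
    · simp only [T, Function.comp_apply, h, Sum.elim_inr]
      fun_prop
  have hmap : ((Measure.pi fun _ : α => lam).prod (Measure.pi fun _ : β => lam)).map T =
      Measure.pi fun _ : Fin m => lam := by
    refine (Measure.pi_eq fun s hs => ?_).symm
    rw [Measure.map_apply hT (MeasurableSet.univ_pi hs)]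
    have : T ⁻¹' Set.univ.pi s = (Set.univ.pi fun a => s (e (Sum.inl a))) ×ˢ
        (Set.univ.pi fun b => s (e (Sum.inr b))) := by
      ext q
      simp only [Set.mem_preimage, Set.mem_pi, Set.mem_univ, true_imp_iff, Set.mem_prod, T,
        Function.comp_apply]
      constructor
      · intro h
        exact ⟨fun a => by simpa using h (e (Sum.inl a)), fun b => by simpa using h (e (Sum.inr b))⟩
      · rintro ⟨ha, hb⟩ j
        obtain ⟨c, rfl⟩ := e.surjective j
        rcases c with a | b
        · simpa using ha a
        · simpa using hb b
    rw [this, Measure.prod_prod, Measure.pi_pi, Measure.pi_pi, ← e.prod_comp, Fintype.prod_sum_type]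
  rw [← hmap, lintegral_map hF hT, lintegral_prod (f := fun q : (α → E d) × (β → E d) => F (T q))
    (hF.comp hT).aemeasurable]

/-- The indices of the two parts of a joint tuple. -/
def joinEquiv {l : ℕ} (hl : l ≤ m) : Fin l ⊕ Fin (m - l) ≃ Fin m :=
  finSumFinEquiv.trans (finCongr (by omega))

theorem join_comp_joinEquiv {l : ℕ} (hl : l ≤ m) (x : Fin l → E d) (u : Fin (m - l) → E d) :
    (join x u : Fin m → E d) ∘ joinEquiv hl = Sum.elim x u := by
  funext c
  rcases c with a | b
  · simp [joinEquiv, join]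
  · simp [joinEquiv, join]

/-- A mixed tuple uses the points of `𝐱` at the positions `i`. The family `j l i` lists the other
positions, whose points stay in the remaining configuration when the mixed tuple is removed. -/
theorem exists_complementary (hm : 1 ≤ m) :
    ∃ j : ∀ l, (Fin (m - l) ↪ Fin m) → Fin l → Fin m, ∀ l ≤ m, ∀ i : Fin (m - l) ↪ Fin m,
      Function.Bijective (Sum.elim (j l i) i) := by
  classical
  have h : ∀ (l : ℕ) (i : Fin (m - l) ↪ Fin m), ∃ j : Fin l → Fin m,
      l ≤ m → Function.Bijective (Sum.elim j i) := by
    intro l i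
    by_cases hl : l ≤ m
    · let j₀ : Fin (m - l) ↪ Fin m :=
        ⟨fun b => joinEquiv hl (Sum.inr b), (joinEquiv hl).injective.comp Sum.inr_injective⟩
      let q : {a // a ∈ Set.range j₀} ≃ {a // a ∈ Set.range i} :=
        (Equiv.ofInjective j₀ j₀.injective).symm.trans (Equiv.ofInjective i i.injective)
      have hq : ∀ b, q.extendSubtype (j₀ b) = i b := by
        intro b
        rw [q.extendSubtype_apply_of_mem _ (Set.mem_range_self b)]
        have : (⟨j₀ b, Set.mem_range_self b⟩ : {a // a ∈ Set.range j₀}) =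
          Equiv.ofInjective j₀ j₀.injective b := rfl
        simp only [q, Equiv.trans_apply, this, Equiv.symm_apply_apply]
        rfl
      refine ⟨fun a => q.extendSubtype (joinEquiv hl (Sum.inl a)), fun _ => ?_⟩
      have : Sum.elim (fun a => q.extendSubtype (joinEquiv hl (Sum.inl a))) i =
          (joinEquiv hl).trans q.extendSubtype := by
        funext c
        rcases c with a | b
        · rfl
        · exact (hq b).symm
      rw [this]
      exact Equiv.bijective _
    · exact ⟨fun _ => ⟨0, hm⟩, fun h => absurd h hl⟩
  choose j hj using h
  exact ⟨j, fun l hl i => hj l i hl⟩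

end Integration

/-! ### Stopping sets and local dependence -/

section Stopping
open Config
variable {d m : ℕ}

/-- Events in `𝒩_F` only depend on the restriction of the configuration to `F`. -/
theorem mem_iff_of_restr_eq {F : Set (E d)} {A : Set (Config d)} (hA : MeasurableSet[sigmaOn F] A)
    {μ μ' : Config d} (h : μ'.restr F = μ.restr F) : μ' ∈ A ↔ μ ∈ A := by
  have hle : sigmaOn F ≤ MeasurableSpace.comap (fun μ : Config d => μ.restr F) ⊤ := by
    refine iSup₂_le fun B hB => ?_
    have : (fun μ : Config d => μ.1 (B ∩ F)) = (fun ν : Config d => ν.1 B) ∘ fun μ => μ.restr F := by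
      funext μ
      exact (Measure.restrict_apply hB).symm
    rw [this, ← MeasurableSpace.comap_comp]
    exact MeasurableSpace.comap_mono le_top
  obtain ⟨A', -, rfl⟩ := hle _ hA
  rw [Set.mem_preimage, Set.mem_preimage, h]

/-- The event `S ≤ F` depends only on the restriction to `F`. With `F = S μ` this gives `S μ' ≤ S
μ`; then the configurations also agree on the smaller set `S μ'`, and the roles can be exchanged. -/
theorem IsStoppingSet.eq_of_restr_eq {S : Config d → Closeds (E d)} (hS : IsStoppingSet S)
    {μ μ' : Config d} (h : μ'.restr (S μ) = μ.restr (S μ)) : S μ' = S μ := by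
  have h1 : S μ' ≤ S μ := (mem_iff_of_restr_eq (hS.2 (S μ)) h).2 (le_refl (S μ))
  exact le_antisymm h1 ((mem_iff_of_restr_eq (hS.2 (S μ'))
    (restr_congr_of_subset h1 h).symm).2 (le_refl (S μ')))

theorem mem_cball {z y : E d} {r : ℝ≥0∞} : y ∈ (cball z r : Set (E d)) ↔ edist y z ≤ r := Iff.rfl

/-- If the balls meet and neither radius exceeds its threshold, the triangle inequality through a
common point bounds the distance of the centres. The three indicators are the source of all error
terms except `C_1`. -/
theorem ind_not_disjoint_cball_le (w z : E d) (r s : ℝ≥0∞) (p q : ℝ≥0) :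
    ind (¬Disjoint (cball w r : Set (E d)) (cball z s)) ≤
      ind (dist z w ≤ q + p) + ind ((q : ℝ≥0∞) < s) + ind ((p : ℝ≥0∞) < r) := by
  by_cases h1 : (q : ℝ≥0∞) < s
  · rw [ind_pos h1]
    refine le_trans ?_ (le_self_add.trans' le_add_self)
    unfold ind; split_ifs <;> simp
  by_cases h2 : (p : ℝ≥0∞) < r
  · rw [ind_pos h2]
    refine le_trans ?_ le_add_self
    unfold ind; split_ifs <;> simp
  by_cases h3 : Disjoint (cball w r : Set (E d)) (cball z s)
  · rw [ind_neg (not_not.2 h3)]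
    exact zero_le
  obtain ⟨y, hy1, hy2⟩ := Set.not_disjoint_iff.1 h3
  rw [mem_cball] at hy1 hy2
  have h4 : dist z w ≤ q + p := by
    have : edist z w ≤ ((q + p : ℝ≥0) : ℝ≥0∞) := by
      calc edist z w ≤ edist z y + edist y w := edist_triangle _ _ _
        _ ≤ q + p := add_le_add ((edist_comm z y).le.trans (hy2.trans (not_lt.1 h1)))
            (hy1.trans (not_lt.1 h2))
        _ = _ := (ENNReal.coe_add q p).symm
    rw [edist_nndist, ENNReal.coe_le_coe] at this
    exact_mod_cast this
  rw [ind_pos h4]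
  refine le_trans ?_ (le_self_add.trans' le_self_add)
  unfold ind
  split_ifs <;> simp

namespace IsStabilizing
variable {Ω : Type*} [MeasurableSpace Ω] {P : Measure Ω} {η : Ω → Config d} {lam : Measure (E d)}
  {g : (Fin m → E d) → Config d → ℝ≥0} {R : E d → Config d → ℝ≥0∞}

theorem stabBall_eq (h : IsStabilizing P η lam g R) (x : Fin m → E d) {μ μ' : Config d}
    (hμ : μ'.restr (stabBall R x μ) = μ.restr (stabBall R x μ)) :
    stabBall R x μ' = stabBall R x μ :=
  (h.stopping x).eq_of_restr_eq hμ

/-- Local dependence with `χ = μ'`: filling up `μ` restricted to the ball by `μ'` outside gives `μ'`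
itself. -/
theorem eq_of_restr_eq (h : IsStabilizing P η lam g R) (x : Fin m → E d) {μ μ' : Config d}
    (hμ : μ'.restr (stabBall R x μ) = μ.restr (stabBall R x μ)) : g x μ' = g x μ := by
  rw [h.local_dependence x μ μ', ← hμ,
    restr_add_restr_compl _ (stabBall R x μ).isClosed.measurableSet]

theorem measurableSet_stabBall (hR : Measurable (Function.uncurry R)) {α : Type*}
    [MeasurableSpace α] {x : α → Fin m → E d} (hx : Measurable x) {c : α → Config d}
    (hc : Measurable c) {y : α → E d} (hy : Measurable y) :
    MeasurableSet {a | y a ∈ (stabBall R (x a) (c a) : Set (E d))} :=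
  measurableSet_le (hy.edist (measurable_center.comp hx)) (hR.comp
    ((measurable_center.comp hx).prodMk (measurable_addPts hc hx)))

end IsStabilizing
end Stopping

/-! ### The common part of two processes built from configurations that agree outside `D` -/

namespace Config
variable {d m : ℕ}

theorem facMeas_mono {μ : Config d} {F F' : (Fin m → E d) → Config d → ℝ≥0∞}
    (h : ∀ y μ', F y μ' ≤ F' y μ') : facMeas m μ F ≤ facMeas m μ F' :=
  Measure.le_iff.2 fun B hB => by
    rw [facMeas_apply _ _ hB, facMeas_apply _ _ hB]
    exact facSum_mono fun y μ' _ => mul_le_mul_left (h y μ') _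

theorem facSum_restr (μ : Config d) {A : Set (E d)} (hA : MeasurableSet A)
    (F : (Fin m → E d) → Config d → ℝ≥0∞) :
    facSum m (μ.restr A) (fun y _ => F y (μ.removePts y)) =
      facSum m μ fun y μ' => ind (∀ i, y i ∈ A) * F y μ' := by
  rw [(μ.isEnum_points.restr hA).facSum_eq]
  let J : (Fin m ↪ {p : μ.Points // p.1.1 ∈ A}) → (Fin m ↪ μ.Points) :=
    fun f => f.trans (Function.Embedding.subtype _)
  have hJ : Function.Injective J := fun f f' h => by
    ext i : 2
    exact DFunLike.congr_fun h i
  rw [facSum, ← hJ.tsum_eq]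
  · refine tsum_congr fun f => ?_
    have : ∀ i, tupleOf (J f) i ∈ A := fun i => (f i).2
    rw [ind_pos this, one_mul]
    rfl
  · intro f hf
    have h : ∀ i, tupleOf f i ∈ A := by
      by_contra h
      simp [ind_neg h] at hf
    exact ⟨⟨fun i => ⟨f i, h i⟩, fun i j hij => f.injective (congrArg Subtype.val hij)⟩, rfl⟩

theorem forall_mem_of_addPts_eq_restr {μ κ : Config d} {y : Fin m → E d} {A : Set (E d)}
    (hA : MeasurableSet A) (h : κ.addPts y = μ.restr A) (i : Fin m) : y i ∈ A := by
  by_contra hi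
  have h1 : (μ.restr A).1 Aᶜ = 0 := by
    rw [restr, Measure.restrict_apply hA.compl]
    simp
  rw [← h, addPts_apply _ _ hA.compl, add_eq_zero, Finset.sum_eq_zero_iff] at h1
  have := h1.2 i (Finset.mem_univ i)
  simp [Set.indicator, hi] at this

theorem restr_addPts_of_forall_mem (μ : Config d) {y : Fin m → E d} {A : Set (E d)}
    (hA : MeasurableSet A) (hy : ∀ i, y i ∈ A) : (μ.addPts y).restr A = (μ.restr A).addPts y := by
  ext B hB
  simp only [restr, Measure.restrict_apply hB, addPts_apply _ _ (hB.inter hA), addPts_apply _ _ hB]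
  congr 1
  refine Finset.sum_congr rfl fun i _ => ?_
  by_cases hi : y i ∈ B <;> simp [hi, hy i]

/-- The restriction of `μ - δ_𝐲` to `A` if `𝐲` is a tuple of points of `μ_A`. -/
theorem restr_removePts {μ κ : Config d} {y : Fin m → E d} {A : Set (E d)}
    (hA : MeasurableSet A) (h : κ.addPts y = μ.restr A) : (μ.removePts y).restr A = κ := by
  have hy := forall_mem_of_addPts_eq_restr hA h
  have hle : ∑ i, Measure.dirac (y i) ≤ μ.1 := by
    have h1 : (κ.addPts y).1 ≤ μ.1 := by rw [h]; exact Measure.restrict_le_self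
    refine le_trans ?_ h1
    exact Measure.le_add_left le_rfl
  have h2 := restr_addPts_of_forall_mem (μ.removePts y) hA hy
  rw [addPts_removePts μ y hle, ← h] at h2
  rw [← removePts_addPts ((μ.removePts y).restr A) y, ← h2, removePts_addPts]

section Coupling
variable {S : (Fin m → E d) → Config d → Set (E d)} {h : (Fin m → E d) → Config d → ℝ≥0∞}

/-- Each tuple lies in its own set `T`. If this set misses `D`, so do the points of the tuple; hence
one of the two indicators is always `1`. -/
theorem facSum_le_add_ind {D : Set (E d)} {μ : Config d}
    {F : (Fin m → E d) → Config d → ℝ≥0∞} {T : (Fin m → E d) → Config d → Set (E d)}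
    (hD : facSum m μ (fun y μ' => ind (¬∀ i, y i ∈ T y μ')) = 0) :
    facSum m μ F ≤ facSum m μ (fun y μ' => F y μ' * ind ((∀ i, y i ∈ Dᶜ) ∧ Disjoint (T y μ') D)) +
      facSum m μ (fun y μ' => F y μ' * ind (¬Disjoint (T y μ') D)) := by
  rw [← facSum_add]
  rw [facSum, ENNReal.tsum_eq_zero] at hD
  refine ENNReal.tsum_le_tsum fun f => ?_
  have h1 : ∀ i, tupleOf f i ∈ T (tupleOf f) (μ.removePts (tupleOf f)) := by
    by_contra hne
    exact one_ne_zero ((ind_pos hne).symm.trans (hD f))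
  dsimp only
  rw [← mul_add]
  by_cases h2 : Disjoint (T (tupleOf f) (μ.removePts (tupleOf f))) D
  · rw [ind_pos ⟨fun i hi => Set.disjoint_left.1 h2 (h1 i) hi, h2⟩]
    exact le_mul_of_one_le_right' le_self_add
  · rw [ind_pos h2]
    exact le_mul_of_one_le_right' le_add_self

/-- The common part of the point processes that are constructed from two configurations that agree
outside of a set `D`. -/
theorem exists_common_part (hS : ∀ y μ μ', μ'.restr (S y μ) = μ.restr (S y μ) → S y μ' = S y μ)
    (hh : ∀ y μ μ', μ'.restr (S y μ) = μ.restr (S y μ) → h y μ' = h y μ)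
    {x : Fin m → E d} {ζ μ : Config d} {D : Set (E d)} (hD : MeasurableSet D)
    (hζ : ζ.restr Dᶜ = μ.restr Dᶜ) (hx : ∀ i, x i ∈ D)
    (hζS : facSum m ζ (fun y μ' => ind (¬∀ i, y i ∈ S y (μ'.addPts x))) = 0)
    (hμS : facSum m μ (fun y μ' => ind (¬∀ i, y i ∈ S y μ')) = 0) :
    ∃ α : Measure (E d), α ≤ facMeas m ζ (fun y μ' => h y (μ'.addPts x)) ∧ α ≤ facMeas m μ h ∧
      facSum m ζ (fun y μ' => h y (μ'.addPts x)) ≤ α Set.univ +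
        facSum m ζ (fun y μ' => h y (μ'.addPts x) * ind (¬Disjoint (S y (μ'.addPts x)) D)) ∧
      facSum m μ h ≤ α Set.univ + facSum m μ (fun y μ' => h y μ' * ind (¬Disjoint (S y μ') D)) := by
  have hle : ∀ (a : ℝ≥0∞) (p : Prop), a * ind p ≤ a := fun a p => by
    by_cases hp : p <;> simp [ind_pos, ind_neg, hp]
  -- Tuples outside `D` are the same for `ζ` and `μ`. If the set `S` of such a tuple misses `D`,
  -- then neither the points `𝐱` nor any change inside `D` affects `h`, so both configurations give
  -- the same measure.
  have heq : facMeas m ζ (fun y μ' => h y (μ'.addPts x) *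
        ind ((∀ i, y i ∈ Dᶜ) ∧ Disjoint (S y (μ'.addPts x)) D)) =
      facMeas m μ (fun y μ' => h y μ' * ind ((∀ i, y i ∈ Dᶜ) ∧ Disjoint (S y μ') D)) := by
    ext B hB
    rw [facMeas_apply _ _ hB, facMeas_apply _ _ hB]
    have e : ∀ (a : ℝ≥0∞) (p q : Prop) (c : ℝ≥0∞), a * ind (p ∧ q) * c = ind p * (a * ind q * c) := by
      intro a p q c
      by_cases hp : p <;> by_cases hq : q <;> simp [ind_pos, ind_neg, hp, hq]
    simp only [e]
    rw [← facSum_restr ζ hD.compl fun y μ' => h y (μ'.addPts x) *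
        ind (Disjoint (S y (μ'.addPts x)) D) * B.indicator 1 (center y),
      ← facSum_restr μ hD.compl fun y μ' => h y μ' * ind (Disjoint (S y μ') D) *
        B.indicator 1 (center y), hζ]
    refine facSum_congr fun y κ hκ => ?_
    congr 1
    have h1 : ((ζ.removePts y).addPts x).restr Dᶜ = κ := by
      rw [restr_addPts_of_forall_notMem _ hD.compl fun i hi => hi (hx i)]
      exact restr_removePts hD.compl (hκ.trans hζ.symm)
    have h2 : (μ.removePts y).restr Dᶜ = κ := restr_removePts hD.compl hκ
    -- It suffices that the set `S` is disjoint from `D` for one of the two configurations; it is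
    -- then the same set for the other one.
    have key : ∀ μ₁ μ₂ : Config d, μ₁.restr Dᶜ = μ₂.restr Dᶜ → Disjoint (S y μ₁) D →
        h y μ₁ * ind (Disjoint (S y μ₁) D) = h y μ₂ * ind (Disjoint (S y μ₂) D) := by
      intro μ₁ μ₂ h12 hdis
      have h3 : μ₂.restr (S y μ₁) = μ₁.restr (S y μ₁) :=
        restr_congr_of_subset (Set.subset_compl_iff_disjoint_right.2 hdis) h12.symm
      rw [hS y μ₁ μ₂ h3, hh y μ₁ μ₂ h3]
    by_cases d1 : Disjoint (S y ((ζ.removePts y).addPts x)) D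
    · exact key _ _ (h1.trans h2.symm) d1
    · by_cases d2 : Disjoint (S y (μ.removePts y)) D
      · exact (key _ _ (h2.trans h1.symm) d2).symm
      · rw [ind_neg d1, ind_neg d2, mul_zero, mul_zero]
  refine ⟨facMeas m μ (fun y μ' => h y μ' * ind ((∀ i, y i ∈ Dᶜ) ∧ Disjoint (S y μ') D)),
    ?_, facMeas_mono fun y μ' => hle _ _, ?_, ?_⟩
  · rw [← heq]
    exact facMeas_mono fun y μ' => hle _ _
  · rw [← heq, facMeas_univ]
    exact facSum_le_add_ind (F := fun y μ' => h y (μ'.addPts x))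
      (T := fun y μ' => S y (μ'.addPts x)) hζS
  · rw [facMeas_univ]
    exact facSum_le_add_ind hμS

end Coupling
end Config

/-! ### Effect of the coupling on the Stein solution, for fixed configurations -/

section Pointwise
open Config
variable {d m : ℕ}

theorem Config.addPts_comm {k l : ℕ} (μ : Config d) (x : Fin k → E d) (y : Fin l → E d) :
    (μ.addPts x).addPts y = (μ.addPts y).addPts x :=
  Subtype.ext (add_right_comm _ _ _)

/-- The contribution of the `m`-tuples that consist of points of `𝐱` and of points of `ζ`. -/
noncomputable def mixedSum (h : (Fin m → E d) → Config d → ℝ≥0∞) (x : Fin m → E d)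
    (ζ : Config d) : ℝ≥0∞ :=
  ∑ l ∈ Finset.Ico 1 m, (m.choose l : ℝ≥0∞) * ∑ i : Fin (m - l) ↪ Fin m,
    facSum l ζ fun y _ => h (join y (x ∘ i)) ((ζ.addPts x).removePts (join y (x ∘ i)))

theorem facSum_addPts_eq (hm : 1 ≤ m) {h : (Fin m → E d) → Config d → ℝ≥0∞}
    (hh : ∀ (x : Fin m → E d) (μ : Config d) (σ : Equiv.Perm (Fin m)), h (x ∘ σ) μ = h x μ)
    (x : Fin m → E d) (ζ : Config d) :
    facSum m (ζ.addPts x) h = m.factorial * h x ζ + mixedSum h x ζ +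
      facSum m ζ (fun y μ' => h y (μ'.addPts x)) := by
  have e1 := facSum_addPts hm ζ x (H := fun y => h y ((ζ.addPts x).removePts y)) fun y σ => by
    rw [removePts_comp_perm, hh]
  rw [removePts_addPts] at e1
  refine e1.trans ?_
  congr 1
  refine facSum_congr fun y μ' hy => ?_
  rw [← hy, addPts_comm, removePts_addPts]

variable {t : ℝ} {g : (Fin m → E d) → Config d → ℝ≥0} {hg : ∀ x μ, g x μ = 0 ∨ g x μ = 1}
  {hg' : ∀ (x : Fin m → E d) (μ : Config d) (σ : Equiv.Perm (Fin m)), g (x ∘ σ) μ = g x μ}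
  {S : (Fin m → E d) → Config d → Set (E d)}

/-- The effect of adding the points `𝐱` and changing the configuration outside of `D` on a function
of `ξ_t` with bounded differences. -/
theorem stein_le (hm : 1 ≤ m)
    (hS : ∀ y μ μ', μ'.restr (S y μ) = μ.restr (S y μ) → S y μ' = S y μ)
    (hgS : ∀ y μ μ', μ'.restr (S y μ) = μ.restr (S y μ) → g y μ' = g y μ)
    {ψ : Config d → ℝ≥0∞}
    (hψ : ∀ (μ₁ μ₂ : Config d) (α β γ : Measure (E d)), μ₁.1 Set.univ < ∞ → μ₂.1 Set.univ < ∞ →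
      μ₁.1 = α + β → μ₂.1 = α + γ → ψ μ₁ ≤ ψ μ₂ + β Set.univ + γ Set.univ)
    {x : Fin m → E d} {ζ μ : Config d} {D : Set (E d)} (hD : MeasurableSet D)
    (hζ : ζ.restr Dᶜ = μ.restr Dᶜ) (hx : ∀ i, x i ∈ D)
    (hζS : facSum m ζ (fun y μ' => ind (¬∀ i, y i ∈ S y (μ'.addPts x))) = 0)
    (hμS : facSum m μ (fun y μ' => ind (¬∀ i, y i ∈ S y μ')) = 0)
    (hζf : xiProc t g (ζ.addPts x) Set.univ < ∞) (hμf : xiProc t g μ Set.univ < ∞)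
    (hsel : selection t g x ζ = 1) :
    ψ ((xiConfig t g hg hg' (ζ.addPts x)).removePts fun _ : Fin 1 => center x) ≤
      ψ (xiConfig t g hg hg' μ) + (m.factorial : ℝ≥0∞)⁻¹ * (mixedSum (selection t g) x ζ +
        facSum m ζ (fun y μ' => selection t g y (μ'.addPts x) *
          ind (¬Disjoint (S y (μ'.addPts x)) D))) +
      (m.factorial : ℝ≥0∞)⁻¹ *
        facSum m μ (fun y μ' => selection t g y μ' * ind (¬Disjoint (S y μ') D)) := by
  set c : ℝ≥0∞ := (m.factorial : ℝ≥0∞)⁻¹ with hc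
  have hcm : c * m.factorial = 1 := ENNReal.inv_mul_cancel (by positivity) (by simp)
  obtain ⟨α, h1, h2, h3, h4⟩ := exists_common_part (h := selection t g) hS
    (fun y μ₁ μ₂ h => by rw [selection, selection, hgS y μ₁ μ₂ h]) hD hζ hx hζS hμS
  set F := facMeas m ζ fun y μ' => selection t g y (μ'.addPts x) with hF
  -- The `m!` orderings of `𝐱` give a unit mass at its centre because `𝐱` is selected, `r` collects
  -- the mixed tuples, and the rest comes from tuples of `ζ`. Only the total mass of the mixed part
  -- is needed.
  have hdec : ∀ B, MeasurableSet B → ∃ r, xiProc t g (ζ.addPts x) B =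
      B.indicator 1 (center x) + r + c * F B ∧
      (B = Set.univ → r = c * mixedSum (selection t g) x ζ) := by
    intro B hB
    refine ⟨c * mixedSum (fun y μ' => selection t g y μ' * B.indicator 1 (center y)) x ζ, ?_, ?_⟩
    · rw [xiProc_apply _ hB, facSum_addPts_eq hm (h := fun y μ' => selection t g y μ' *
        B.indicator 1 (center y)) (fun y μ' σ => by
          rw [selection_comp_perm hg', center_comp_perm]), hsel, one_mul, hF,
        facMeas_apply _ _ hB, mul_add, mul_add, ← mul_assoc, ← hc, hcm, one_mul]
    · rintro rfl
      simp
  set ν := (xiConfig t g hg hg' (ζ.addPts x)).removePts fun _ : Fin 1 => center x with hν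
  have hle : ∑ _i : Fin 1, Measure.dirac (center x) ≤ (xiConfig t g hg hg' (ζ.addPts x)).1 := by
    rw [xiConfig_val hζf]
    refine Measure.le_iff.2 fun B hB => ?_
    obtain ⟨r, hr, -⟩ := hdec B hB
    rw [hr, add_assoc, Finset.sum_const, Finset.card_univ, Fintype.card_fin, one_smul,
      Measure.dirac_apply' _ hB]
    exact le_self_add
  have hνB : ∀ B, MeasurableSet B → ∃ r, ν.1 B = r + c * F B ∧
      (B = Set.univ → r = c * mixedSum (selection t g) x ζ) := by
    intro B hB
    obtain ⟨r, hr, hr'⟩ := hdec B hB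
    refine ⟨r, ?_, hr'⟩
    have e := addPts_removePts _ _ hle
    rw [← hν] at e
    have e1 := addPts_apply ν (fun _ : Fin 1 => center x) hB
    rw [e, xiConfig_val hζf, hr] at e1
    simp only [Finset.univ_unique, Finset.sum_singleton] at e1
    rw [add_assoc, add_comm (ν.1 B)] at e1
    refine ((ENNReal.add_right_inj ?_).1 e1).symm
    by_cases h : center x ∈ B <;> simp [h]
  have hαν : c • α ≤ ν.1 := Measure.le_iff.2 fun B hB => by
    obtain ⟨r, hr, -⟩ := hνB B hB
    rw [hr, Measure.smul_apply, smul_eq_mul]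
    exact (mul_le_mul_right (h1 B) c).trans le_add_self
  have hαμ : c • α ≤ (xiConfig t g hg hg' μ).1 := by
    rw [xiConfig_val hμf, xiProc_eq]
    exact Measure.le_iff.2 fun B _ => by
      rw [Measure.smul_apply, Measure.smul_apply, smul_eq_mul, smul_eq_mul]
      exact mul_le_mul_right (h2 B) c
  have hμu : (xiConfig t g hg hg' μ).1 Set.univ < ∞ := xiConfig_univ_lt_top μ
  have hνu : ν.1 Set.univ < ∞ := by
    have e := addPts_removePts _ _ hle
    refine lt_of_le_of_lt ?_ (xiConfig_univ_lt_top (t := t) (hg := hg) (hg' := hg') (ζ.addPts x))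
    rw [← hν] at e
    rw [← e, addPts_apply _ _ .univ]
    exact le_self_add
  have : IsFiniteMeasure (c • α) := ⟨(hαμ Set.univ).trans_lt hμu⟩
  -- The common part is `c • α`. The masses of the two remainders are the mixed tuples and the
  -- tuples whose sets `S` meet `D`.
  have key := hψ ν (xiConfig t g hg hg' μ) (c • α) (ν.1 - c • α)
    ((xiConfig t g hg hg' μ).1 - c • α) hνu hμu
    (by rw [add_comm]; exact (Measure.sub_add_cancel_of_le hαν).symm)
    (by rw [add_comm]; exact (Measure.sub_add_cancel_of_le hαμ).symm)
  rw [Measure.sub_apply .univ hαν, Measure.sub_apply .univ hαμ, Measure.smul_apply,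
    smul_eq_mul] at key
  refine key.trans (add_le_add (add_le_add_right ?_ _) ?_)
  · obtain ⟨r, hr, hr'⟩ := hνB _ .univ
    rw [hr, hr' rfl, hF, facMeas_univ, tsub_le_iff_left, ← mul_add, ← mul_add]
    refine mul_le_mul_right ?_ c
    calc _ ≤ mixedSum (selection t g) x ζ + _ := add_le_add_right h3 _
      _ = _ := by ring
  · rw [xiConfig_val hμf, xiProc_eq, Measure.smul_apply, smul_eq_mul, facMeas_univ,
      tsub_le_iff_left, ← mul_add]
    exact mul_le_mul_right h4 c

end Pointwise

/-! ### Almost sure properties, resampling as a measure preserving map, and Mecke's formula for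
`ξ_t` -/

theorem measurable_uncurry_comp {α β γ : Type*} [MeasurableSpace α] [MeasurableSpace β]
    [MeasurableSpace γ] {h : α → β → ℝ≥0∞} (hh : Measurable (Function.uncurry h)) {x : γ → α}
    {y : γ → β} (hx : Measurable x) (hy : Measurable y) : Measurable fun c => h (x c) (y c) :=
  hh.comp (hx.prodMk hy)

theorem lintegral_rotate {α β γ : Type*} [MeasurableSpace α] [MeasurableSpace β]
    [MeasurableSpace γ] (A : Measure α) (B : Measure β) (C : Measure γ) [SFinite A] [SFinite B]
    [SFinite C] {F : α → β → γ → ℝ≥0∞} (hF : Measurable fun q : α × β × γ => F q.1 q.2.1 q.2.2) :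
    ∫⁻ c, ∫⁻ a, ∫⁻ b, F a b c ∂B ∂A ∂C = ∫⁻ a, ∫⁻ b, ∫⁻ c, F a b c ∂C ∂B ∂A := by
  rw [lintegral_lintegral_swap (f := fun c a => ∫⁻ b, F a b c ∂B)]
  · refine lintegral_congr fun a => ?_
    rw [lintegral_lintegral_swap (f := fun c b => F a b c)]
    exact (hF.comp (f := fun q : γ × β => (a, q.2, q.1)) (by fun_prop)).aemeasurable
  · refine (Measurable.lintegral_prod_right' (f := fun q : (γ × α) × β => F q.1.2 q.2 q.1.1)
      ?_).aemeasurable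
    exact hF.comp (f := fun q : (γ × α) × β => (q.1.2, q.2, q.1.1)) (by fun_prop)

theorem ae_of_lintegral_ind_eq_zero {α : Type*} [MeasurableSpace α] {μ : Measure α} {p : α → Prop}
    (hp : MeasurableSet {a | p a}) (h : ∫⁻ a, ind (¬p a) ∂μ = 0) : ∀ᵐ a ∂μ, p a := by
  have hm : Measurable fun a => ind (¬p a) := Config.measurable_ind hp.compl
  rw [lintegral_eq_zero_iff hm] at h
  filter_upwards [h] with a ha
  by_contra hne
  exact one_ne_zero ((ind_pos hne).symm.trans ha)

namespace IsMecke
open Config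
variable {d m : ℕ} {Q : Measure (Config d)} [IsProbabilityMeasure Q] {lam : Measure (E d)}
  [SigmaFinite lam]

/-- Almost sure properties are preserved if fixed points are added. -/
theorem ae_addPts (hM : IsMecke Q lam) {p : Config d → Prop} (hp : MeasurableSet {μ | p μ})
    (h : ∀ᵐ μ ∂Q, p μ) (m : ℕ) :
    ∀ᵐ x ∂(Measure.pi fun _ : Fin m => lam), ∀ᵐ μ ∂Q, p (μ.addPts x) := by
  have hm : Measurable (Function.uncurry fun (x : Fin m → E d) (μ : Config d) =>
      ind (¬p (μ.addPts x))) :=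
    (measurable_ind hp.compl).comp (measurable_addPts measurable_snd measurable_fst)
  have h1 := hM.lintegral_facSum (F := fun (x : Fin m → E d) μ => ind (¬p (μ.addPts x))) hm
  have h0 : ∫⁻ μ, facSum m μ (fun x μ' => ind (¬p (μ'.addPts x))) ∂Q = 0 := by
    have hf : Measurable fun μ : Config d => facSum m μ fun x μ' => ind (¬p (μ'.addPts x)) :=
      measurable_facSum (F := fun (_ : Config d) x μ' => ind (¬p (μ'.addPts x))) measurable_id
        (hm.comp measurable_snd)
    rw [lintegral_eq_zero_iff hf]
    filter_upwards [h] with μ hμ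
    have : facSum m μ (fun x μ' => ind (¬p (μ'.addPts x))) = facSum m μ fun _ _ => 0 :=
      facSum_congr fun y μ' hy => by rw [hy, ind_neg (not_not.2 hμ)]
    rw [this]
    simp [facSum]
  rw [h0, eq_comm, lintegral_eq_zero_iff hm.lintegral_prod_right] at h1
  filter_upwards [h1] with x hx
  exact ae_of_lintegral_ind_eq_zero ((measurable_addPts measurable_id measurable_const) hp) hx

/-- If almost every tuple has a property relative to the process, then all tuples of points have. -/
theorem ae_facSum_eq_zero (hM : IsMecke Q lam) {F : (Fin m → E d) → Config d → ℝ≥0∞}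
    (hF : Measurable (Function.uncurry F))
    (h : ∀ᵐ x ∂(Measure.pi fun _ : Fin m => lam), ∀ᵐ μ ∂Q, F x μ = 0) :
    ∀ᵐ μ ∂Q, facSum m μ F = 0 := by
  have h1 := hM.lintegral_facSum hF
  have h2 : ∫⁻ x, ∫⁻ μ, F x μ ∂Q ∂(Measure.pi fun _ : Fin m => lam) = 0 := by
    rw [lintegral_eq_zero_iff hF.lintegral_prod_right]
    filter_upwards [h] with x hx
    exact (lintegral_eq_zero_iff hF.of_uncurry_left).2 hx
  have hf : Measurable fun μ : Config d => facSum m μ F :=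
    measurable_facSum (F := fun (_ : Config d) x μ' => F x μ') measurable_id
      (hF.comp measurable_snd)
  rw [h2, lintegral_eq_zero_iff hf] at h1
  exact h1

/-- The map form of `lintegral_resample`. It also transfers almost sure properties from `Q` to the
resampled configuration. -/
theorem measurePreserving_resample (hM : IsMecke Q lam) {S : Config d → Set (E d)}
    (hS : ∀ μ, MeasurableSet (S μ)) (hS' : MeasurableSet {q : Config d × E d | q.2 ∈ S q.1})
    (hS_eq : ∀ μ μ' : Config d, μ'.restr (S μ) = μ.restr (S μ) → S μ' = S μ)
    (hfin : ∀ᵐ μ ∂Q, μ.1 (S μ) < ∞) (hlam : ∀ μ, lam (S μ) ≠ ∞ ∨ S μ = Set.univ) :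
    MeasurePreserving (fun q : Config d × Config d =>
      (q.1.restr (S q.1)).add (q.2.restr (S q.1)ᶜ)) (Q.prod Q) Q := by
  have hSc' : MeasurableSet {q : Config d × E d | q.2 ∈ (S q.1)ᶜ} := hS'.compl
  have hm : Measurable fun q : Config d × Config d =>
      (q.1.restr (S q.1)).add (q.2.restr (S q.1)ᶜ) := by
    refine measurable_add ?_ ?_
    · exact measurable_restr_of_measurableSet measurable_fst (fun q => hS q.1)
        (S := fun q : Config d × Config d => S q.1)
        ((show Measurable fun q : (Config d × Config d) × E d => (q.1.1, q.2) by fun_prop) hS')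
    · exact measurable_restr_of_measurableSet measurable_snd (fun q => (hS q.1).compl)
        (S := fun q : Config d × Config d => (S q.1)ᶜ)
        ((show Measurable fun q : (Config d × Config d) × E d => (q.1.1, q.2) by fun_prop) hSc')
  refine ⟨hm, Measure.ext fun A hA => ?_⟩
  have h1 : Measurable (A.indicator (1 : Config d → ℝ≥0∞)) := measurable_one.indicator hA
  rw [← lintegral_indicator_one hA, lintegral_map h1 hm, lintegral_prod (f := fun q : Config d ×
      Config d => A.indicator (1 : Config d → ℝ≥0∞)
        ((q.1.restr (S q.1)).add (q.2.restr (S q.1)ᶜ))) (h1.comp hm).aemeasurable,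
    hM.lintegral_resample hS hS' hS_eq hfin hlam h1, lintegral_indicator_one hA]

end IsMecke

section Campbell
open Config
variable {d m : ℕ} {Q : Measure (Config d)} {lam : Measure (E d)} {t : ℝ} {g : (Fin m → E d) → Config d → ℝ≥0}

theorem measurable_lintegral_xiProc (hg : Measurable (Function.uncurry g)) {α : Type*}
    [MeasurableSpace α] {c : α → Config d} (hc : Measurable c) {Φ : α → E d → ℝ≥0∞}
    (hΦ : Measurable (Function.uncurry Φ)) :
    Measurable fun a => ∫⁻ z, Φ a z ∂(xiProc t g (c a)) := by
  simp only [lintegral_xiProc]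
  refine Measurable.const_mul (measurable_facSum (F := fun a y μ' =>
    selection t g y μ' * Φ a (center y)) hc ?_) _
  exact (measurable_uncurry_comp (measurable_selection hg) (by fun_prop) (by fun_prop)).mul
    (measurable_uncurry_comp hΦ (by fun_prop) (measurable_center.comp (by fun_prop)))

/-- Mecke's formula for `ξ_t`. -/
theorem IsMecke.lintegral_xiProc [IsProbabilityMeasure Q] [SigmaFinite lam] (hM : IsMecke Q lam) (hg : Measurable (Function.uncurry g))
    {Φ : E d → Config d → ℝ≥0∞} (hΦ : Measurable (Function.uncurry Φ)) :
    ∫⁻ μ, ∫⁻ z, Φ z μ ∂(xiProc t g μ) ∂Q = (m.factorial : ℝ≥0∞)⁻¹ *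
      ∫⁻ x, ∫⁻ μ, selection t g x μ * Φ (center x) (μ.addPts x) ∂Q
        ∂(Measure.pi fun _ : Fin m => lam) := by
  have e1 : ∀ μ : Config d, ∫⁻ z, Φ z μ ∂(xiProc t g μ) = (m.factorial : ℝ≥0∞)⁻¹ *
      facSum m μ fun y μ' => selection t g y μ' * Φ (center y) (μ'.addPts y) := by
    intro μ
    rw [_root_.lintegral_xiProc]
    congr 1
    exact facSum_congr fun y μ' hy => by rw [hy]
  have hF : Measurable (Function.uncurry fun (y : Fin m → E d) (μ' : Config d) =>
      selection t g y μ' * Φ (center y) (μ'.addPts y)) :=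
    (measurable_selection hg).mul (measurable_uncurry_comp hΦ (measurable_center.comp measurable_fst)
      (measurable_addPts measurable_snd measurable_fst))
  have e2 := hM.lintegral_facSum (F := fun y μ' => selection t g y μ' *
    Φ (center y) (μ'.addPts y)) hF
  simp only [e1]
  rw [lintegral_const_mul (f := fun μ : Config d => facSum m μ fun y μ' => selection t g y μ' *
    Φ (center y) (μ'.addPts y)), e2]
  exact measurable_facSum (F := fun (_ : Config d) y μ' => selection t g y μ' *
    Φ (center y) (μ'.addPts y)) measurable_id (hF.comp measurable_snd)

theorem lintegral_intensity_xiProc (hg : Measurable (Function.uncurry g)) {G : E d → ℝ≥0∞}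
    (hG : Measurable G) : ∫⁻ z, G z ∂(intensity Q (xiProc t g)) =
      ∫⁻ μ, ∫⁻ z, G z ∂(xiProc t g μ) ∂Q :=
  Measure.lintegral_bind (measurable_xiProc hg).aemeasurable hG.aemeasurable

end Campbell

/-! ### Mixed tuples and tuples with possible interaction -/

section Mixed
open Config
variable {d m : ℕ}

/-- `m`-tuples built from `𝐱` and `ζ` in terms of the remaining configuration. -/
theorem mixedSum_eq {h : (Fin m → E d) → Config d → ℝ≥0∞}
    {j : ∀ l, (Fin (m - l) ↪ Fin m) → Fin l → Fin m}
    (hj : ∀ l ≤ m, ∀ i : Fin (m - l) ↪ Fin m, Function.Bijective (Sum.elim (j l i) i))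
    (x : Fin m → E d) (ζ : Config d) : mixedSum h x ζ =
      ∑ l ∈ Finset.Ico 1 m, (m.choose l : ℝ≥0∞) * ∑ i : Fin (m - l) ↪ Fin m,
        facSum l ζ fun y μ' => h (join y (x ∘ i)) (μ'.addPts (x ∘ j l i)) := by
  refine Finset.sum_congr rfl fun l hl => ?_
  congr 1
  have hl' : l ≤ m := (Finset.mem_Ico.1 hl).2.le
  refine Finset.sum_congr rfl fun i _ => facSum_congr fun y μ' hy => ?_
  congr 1
  have hsum : ∑ k, Measure.dirac (x k) = ∑ a, Measure.dirac (x (j l i a)) +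
      ∑ b, Measure.dirac (x (i b)) := by
    rw [← (Equiv.ofBijective _ (hj l hl' i)).sum_comp, Fintype.sum_sum_type]
    rfl
  have hsum' : ∑ k, Measure.dirac ((join y (x ∘ i) : Fin m → E d) k) =
      ∑ a, Measure.dirac (y a) + ∑ b, Measure.dirac (x (i b)) := by
    have e := join_comp_joinEquiv hl' y (x ∘ i)
    rw [← (joinEquiv hl').sum_comp, Fintype.sum_sum_type]
    congr 1
    · exact Finset.sum_congr rfl fun a _ => congrArg Measure.dirac (congrFun e (Sum.inl a))
    · exact Finset.sum_congr rfl fun b _ => congrArg Measure.dirac (congrFun e (Sum.inr b))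
  have : ζ.addPts x = (μ'.addPts (x ∘ j l i)).addPts (join y (x ∘ i) : Fin m → E d) := by
    rw [← hy]
    refine Subtype.ext ?_
    simp only [addPts, Function.comp_apply]
    rw [hsum, hsum']
    abel
  rw [this, removePts_addPts]

end Mixed

namespace Config
variable {d m : ℕ}

theorem restr_add_restr_compl_left (μ μ' : Config d) {B : Set (E d)} (hB : MeasurableSet B) :
    ((μ.restr B).add (μ'.restr Bᶜ)).restr B = μ.restr B := by
  ext A hA
  simp only [restr, add, Measure.restrict_apply hA, Measure.add_apply,
    Measure.restrict_apply (hA.inter hB)]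
  rw [Set.inter_assoc, Set.inter_assoc, Set.inter_self, Set.inter_compl_self]
  simp

theorem restr_add_restr_compl_right (μ μ' : Config d) {B : Set (E d)} (hB : MeasurableSet B) :
    ((μ.restr B).add (μ'.restr Bᶜ)).restr Bᶜ = μ'.restr Bᶜ := by
  ext A hA
  simp only [restr, add, Measure.restrict_apply hA, Measure.add_apply,
    Measure.restrict_apply (hA.inter hB.compl)]
  rw [Set.inter_assoc, Set.inter_assoc, Set.inter_self, Set.compl_inter_self]
  simp

end Config

section CloseSum
open Config
variable {d m : ℕ}

/-- The contribution of the `m`-tuples of points of `ζ` that may interact with `𝐱`. -/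
noncomputable def closeSum (h : (Fin m → E d) → Config d → ℝ≥0∞) (R : E d → Config d → ℝ≥0∞)
    (b : E d → ℝ≥0) (x : Fin m → E d) (ζ : Config d) : ℝ≥0∞ :=
  facSum m ζ fun y μ' => h y (μ'.addPts x) *
    (ind (dist (center x) (center y) ≤ b (center x) + b (center y)) +
      ind ((b (center x) : ℝ≥0∞) < R (center x) ((μ'.addPts x).addPts y)) +
      ind ((b (center y) : ℝ≥0∞) < R (center y) ((μ'.addPts x).addPts y)))

/-- The points `w` of `ξ_t(μ')` that may interact with `z`. -/
noncomputable def farSum (t : ℝ) (g : (Fin m → E d) → Config d → ℝ≥0) (R : E d → Config d → ℝ≥0∞)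
    (b : E d → ℝ≥0) (z : E d) (μ μ' : Config d) : ℝ≥0∞ :=
  ∫⁻ w, (ind (dist z w ≤ b z + b w) + ind ((b z : ℝ≥0∞) < R z μ) +
    ind ((b w : ℝ≥0∞) < R w μ')) ∂(xiProc t g μ')

variable {t : ℝ} {g : (Fin m → E d) → Config d → ℝ≥0} {R : E d → Config d → ℝ≥0∞} {b : E d → ℝ≥0}

theorem measurable_ind_dist (hb : Measurable b) {α : Type*} [MeasurableSpace α] {z w : α → E d}
    (hz : Measurable z) (hw : Measurable w) :
    Measurable fun a => ind (dist (z a) (w a) ≤ b (z a) + b (w a)) := by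
  refine measurable_ind (measurableSet_le (hz.dist hw) ?_)
  exact ((hb.comp hz).coe_nnreal_real).add ((hb.comp hw).coe_nnreal_real)

theorem measurable_ind_radius (hb : Measurable b) (hR : Measurable (Function.uncurry R))
    {α : Type*} [MeasurableSpace α] {z : α → E d} (hz : Measurable z) {c : α → Config d}
    (hc : Measurable c) : Measurable fun a => ind ((b (z a) : ℝ≥0∞) < R (z a) (c a)) :=
  measurable_ind (measurableSet_lt (hb.comp hz).coe_nnreal_ennreal
    (measurable_uncurry_comp hR hz hc))

theorem measurable_closeSum {h : (Fin m → E d) → Config d → ℝ≥0∞}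
    (hh : Measurable (Function.uncurry h)) (hR : Measurable (Function.uncurry R))
    (hb : Measurable b) : Measurable (Function.uncurry (closeSum h R b)) := by
  refine measurable_facSum (c := fun q : (Fin m → E d) × Config d => q.2)
    (F := fun q y μ' => h y (μ'.addPts q.1) *
    (ind (dist (center q.1) (center y) ≤ b (center q.1) + b (center y)) +
      ind ((b (center q.1) : ℝ≥0∞) < R (center q.1) ((μ'.addPts q.1).addPts y)) +
      ind ((b (center y) : ℝ≥0∞) < R (center y) ((μ'.addPts q.1).addPts y)))) measurable_snd ?_
  have m1 : Measurable fun q : ((Fin m → E d) × Config d) × (Fin m → E d) × Config d =>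
      q.2.2.addPts q.1.1 := measurable_addPts (by fun_prop) (by fun_prop)
  have m2 : Measurable fun q : ((Fin m → E d) × Config d) × (Fin m → E d) × Config d =>
      (q.2.2.addPts q.1.1).addPts q.2.1 := measurable_addPts m1 (by fun_prop)
  have mx : Measurable fun q : ((Fin m → E d) × Config d) × (Fin m → E d) × Config d =>
      center q.1.1 := measurable_center.comp (by fun_prop)
  have my : Measurable fun q : ((Fin m → E d) × Config d) × (Fin m → E d) × Config d =>
      center q.2.1 := measurable_center.comp (by fun_prop)
  exact (measurable_uncurry_comp hh (by fun_prop) m1).mul (((measurable_ind_dist hb mx my).add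
    (measurable_ind_radius hb hR mx m2)).add (measurable_ind_radius hb hR my m2))

theorem measurable_farSum (hg : Measurable (Function.uncurry g))
    (hR : Measurable (Function.uncurry R)) (hb : Measurable b) :
    Measurable fun q : E d × Config d × Config d => farSum t g R b q.1 q.2.1 q.2.2 := by
  refine measurable_lintegral_xiProc hg (c := fun q : E d × Config d × Config d => q.2.2)
    (by fun_prop) (Φ := fun q w => ind (dist q.1 w ≤ b q.1 + b w) +
      ind ((b q.1 : ℝ≥0∞) < R q.1 q.2.1) + ind ((b w : ℝ≥0∞) < R w q.2.2)) ?_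
  exact ((measurable_ind_dist hb (α := (E d × Config d × Config d) × E d) (by fun_prop)
    (by fun_prop)).add (measurable_ind_radius hb hR (by fun_prop) (by fun_prop))).add
    (measurable_ind_radius hb hR (by fun_prop) (by fun_prop))

theorem measurable_join {α : Type*} [MeasurableSpace α] {l : ℕ} {x : α → Fin l → E d}
    {u : α → Fin (m - l) → E d} (hx : Measurable x) (hu : Measurable u) :
    Measurable fun a => (join (x a) (u a) : Fin m → E d) := by
  refine measurable_pi_iff.2 fun k => ?_
  by_cases hk : (k : ℕ) < l
  · simp only [join, hk, dif_pos]
    fun_prop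
  · simp only [join, hk, dif_neg, not_false_iff]
    fun_prop

theorem measurable_mixedSum (hm : 1 ≤ m) {h : (Fin m → E d) → Config d → ℝ≥0∞}
    (hh : Measurable (Function.uncurry h)) : Measurable (Function.uncurry (mixedSum h)) := by
  obtain ⟨j, hj⟩ := exists_complementary hm
  have e : Function.uncurry (mixedSum h) = fun q => ∑ l ∈ Finset.Ico 1 m, (m.choose l : ℝ≥0∞) *
      ∑ i : Fin (m - l) ↪ Fin m,
        facSum l q.2 fun y μ' => h (join y (q.1 ∘ i)) (μ'.addPts (q.1 ∘ j l i)) := by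
    funext q
    exact mixedSum_eq hj q.1 q.2
  rw [e]
  refine Finset.measurable_fun_sum _ fun l _ => Measurable.const_mul
    (Finset.measurable_fun_sum _ fun i _ => ?_) _
  refine measurable_facSum (F := fun (q : (Fin m → E d) × Config d) (y : Fin l → E d) μ' =>
    h (join y (q.1 ∘ i)) (μ'.addPts (q.1 ∘ j l i))) measurable_snd ?_
  refine measurable_uncurry_comp hh (measurable_join (by fun_prop) ?_)
    (measurable_addPts (by fun_prop) ?_)
  · exact measurable_pi_iff.2 fun k => by simp only [Function.comp_apply]; fun_prop
  · exact measurable_pi_iff.2 fun k => by simp only [Function.comp_apply]; fun_prop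

end CloseSum

/-! ### The core estimate for fixed `𝐱` -/

section Core
open Config
variable {d m : ℕ} {Q : Measure (Config d)} [IsProbabilityMeasure Q] {lam : Measure (E d)}
  [IsLocallyFiniteMeasure lam] {t : ℝ} {g : (Fin m → E d) → Config d → ℝ≥0}
  {hg : ∀ x μ, g x μ = 0 ∨ g x μ = 1}
  {hg' : ∀ (x : Fin m → E d) (μ : Config d) (σ : Equiv.Perm (Fin m)), g (x ∘ σ) μ = g x μ}
  {R : E d → Config d → ℝ≥0∞} {b : E d → ℝ≥0}

theorem isBounded_cball {z : E d} {r : ℝ≥0∞} (hr : r < ∞) :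
    Bornology.IsBounded (cball z r : Set (E d)) := by
  have : (cball z r : Set (E d)) ⊆ Metric.closedBall z r.toReal := fun y hy => by
    rw [mem_cball, edist_dist] at hy
    rw [Metric.mem_closedBall]
    exact (ENNReal.ofReal_le_iff_le_toReal hr.ne).1 hy
  exact Metric.isBounded_closedBall.subset this

theorem stabBall_comp_perm (R : E d → Config d → ℝ≥0∞) (y : Fin m → E d) (σ : Equiv.Perm (Fin m))
    (μ : Config d) : stabBall R (y ∘ σ) μ = stabBall R y μ := by
  rw [stabBall, stabBall, center_comp_perm, addPts_comp_perm]

/-- The core estimate: comparison of the process with the points `𝐱` added and an independent copy,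
after resampling outside of the stabilization ball of `𝐱`. -/
theorem ae_lintegral_stein_le (hm : 1 ≤ m) (hM : IsMecke Q lam)
    (hgm : Measurable (Function.uncurry g)) (hR : Measurable (Function.uncurry R))
    (hb : Measurable b)
    (hS_eq : ∀ (y : Fin m → E d) μ μ', μ'.restr (stabBall R y μ) = μ.restr (stabBall R y μ) →
      stabBall R y μ' = stabBall R y μ)
    (hgS : ∀ y μ μ', μ'.restr (stabBall R y μ) = μ.restr (stabBall R y μ) → g y μ' = g y μ)
    (hmem : ∀ᵐ x ∂(Measure.pi fun _ : Fin m => lam), ∀ᵐ μ ∂Q, ∀ i, x i ∈ stabBall R x μ)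
    (hfin : ∀ᵐ x ∂(Measure.pi fun _ : Fin m => lam), ∀ᵐ μ ∂Q, R (center x) (μ.addPts x) < ∞)
    (hξ : ∀ᵐ μ ∂Q, xiProc t g μ Set.univ < ∞)
    {Ψ : E d → Config d → ℝ≥0∞} (hΨ : Measurable (Function.uncurry Ψ))
    (hΨL : ∀ (x : E d) (μ₁ μ₂ : Config d) (α β γ : Measure (E d)), μ₁.1 Set.univ < ∞ →
      μ₂.1 Set.univ < ∞ → μ₁.1 = α + β → μ₂.1 = α + γ →
      Ψ x μ₁ ≤ Ψ x μ₂ + β Set.univ + γ Set.univ) :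
    ∀ᵐ x ∂(Measure.pi fun _ : Fin m => lam),
      ∫⁻ ζ, selection t g x ζ *
        Ψ (center x) ((xiConfig t g hg hg' (ζ.addPts x)).removePts fun _ : Fin 1 => center x) ∂Q ≤
      ∫⁻ ζ, selection t g x ζ * ((m.factorial : ℝ≥0∞)⁻¹ *
        (mixedSum (selection t g) x ζ + closeSum (selection t g) R b x ζ)) ∂Q +
      ∫⁻ μ, ∫⁻ μ', selection t g x μ * (Ψ (center x) (xiConfig t g hg hg' μ') +
        farSum t g R b (center x) (μ.addPts x) μ') ∂Q ∂Q := by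
  have hsm := measurable_selection (t := t) hgm
  -- the points of tuples belong to their stabilization balls
  have hIm : Measurable (Function.uncurry fun (y : Fin m → E d) (μ' : Config d) =>
      ind (¬∀ i, y i ∈ (stabBall R y μ' : Set (E d)))) :=
    measurable_ind (measurableSet_forall fun i => IsStabilizing.measurableSet_stabBall hR
      (α := (Fin m → E d) × Config d) measurable_fst measurable_snd
      ((measurable_pi_apply i).comp measurable_fst)).compl
  have hD : ∀ᵐ μ ∂Q, facSum m μ (fun y μ' =>
      ind (¬∀ i, y i ∈ (stabBall R y μ' : Set (E d)))) = 0 := by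
    refine hM.ae_facSum_eq_zero hIm ?_
    filter_upwards [hmem] with x hx
    filter_upwards [hx] with μ hμ
    exact ind_neg (not_not.2 hμ)
  have hDm : Measurable fun μ : Config d => facSum m μ (fun y μ' =>
      ind (¬∀ i, y i ∈ (stabBall R y μ' : Set (E d)))) :=
    measurable_facSum (F := fun (_ : Config d) y μ' =>
      ind (¬∀ i, y i ∈ (stabBall R y μ' : Set (E d)))) measurable_id (hIm.comp measurable_snd)
  have hDx := hM.ae_addPts (measurableSet_eq_fun hDm measurable_const) hD m
  have hξx := hM.ae_addPts (measurableSet_lt (measurable_xiProc_apply (t := t) hgm .univ)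
    measurable_const) hξ m
  filter_upwards [hmem, hfin, hDx, hξx] with x hx1 hx2 hx3 hx4
  have hSm : ∀ μ, MeasurableSet (stabBall R x μ : Set (E d)) := fun μ =>
    (stabBall R x μ).isClosed.measurableSet
  have hres := hM.measurePreserving_resample (S := fun μ => (stabBall R x μ : Set (E d))) hSm
    (IsStabilizing.measurableSet_stabBall hR (α := Config d × E d) measurable_const measurable_fst
      measurable_snd)
    (fun μ μ' h => congrArg SetLike.coe (hS_eq x μ μ' h))
    (by
      -- Almost surely the ball is bounded and contains finitely many points. The next alternative
      -- covers an infinite radius, where the ball is the whole space.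
      filter_upwards [hx2] with μ hμ
      exact μ.lt_top_of_isBounded (isBounded_cball hμ))
    (fun μ => by
      by_cases h : R (center x) (μ.addPts x) < ∞
      · exact Or.inl (isBounded_cball h).measure_lt_top.ne
      · refine Or.inr (Set.eq_univ_of_forall fun y => ?_)
        rw [stabBall, mem_cball, not_lt_top_iff.1 h]
        exact le_top)
  -- The first configuration is used inside the stabilization ball of `𝐱`, the second one outside.
  set rs : Config d × Config d → Config d := fun q =>
    (q.1.restr (stabBall R x q.1)).add (q.2.restr (stabBall R x q.1 : Set (E d))ᶜ) with hrs
  have mA : Measurable fun ζ => selection t g x ζ *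
      Ψ (center x) ((xiConfig t g hg hg' (ζ.addPts x)).removePts fun _ : Fin 1 => center x) := by
    refine (measurable_uncurry_comp hsm measurable_const measurable_id).mul
      (measurable_uncurry_comp hΨ measurable_const (measurable_removePt
        ((measurable_xiConfig hgm).comp (measurable_addPts measurable_id measurable_const))
        measurable_const))
  have mB : Measurable fun ζ => selection t g x ζ * ((m.factorial : ℝ≥0∞)⁻¹ *
      (mixedSum (selection t g) x ζ + closeSum (selection t g) R b x ζ)) :=
    (measurable_uncurry_comp hsm measurable_const measurable_id).mul (Measurable.const_mul
      ((measurable_uncurry_comp (measurable_mixedSum hm hsm) measurable_const measurable_id).add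
      (measurable_uncurry_comp (measurable_closeSum hsm hR hb) measurable_const measurable_id)) _)
  have mC : Measurable fun q : Config d × Config d => selection t g x q.1 *
      (Ψ (center x) (xiConfig t g hg hg' q.2) +
        farSum t g R b (center x) (q.1.addPts x) q.2) :=
    (measurable_uncurry_comp hsm measurable_const measurable_fst).mul
      ((measurable_uncurry_comp hΨ measurable_const
        ((measurable_xiConfig hgm).comp measurable_snd)).add
      ((measurable_farSum hgm hR hb).comp (f := fun q : Config d × Config d =>
        (center x, q.1.addPts x, q.2)) (measurable_const.prodMk
          ((measurable_addPts measurable_fst measurable_const).prodMk measurable_snd))))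
  -- The two terms in `ζ` are evaluated at the resampled configuration, which has law `Q`; the last
  -- term keeps the independent pair. The inequality then holds almost surely under `Q.prod Q`.
  rw [← hres.lintegral_comp mA, ← hres.lintegral_comp mB,
    ← lintegral_prod (f := fun q : Config d × Config d => selection t g x q.1 *
      (Ψ (center x) (xiConfig t g hg hg' q.2) +
        farSum t g R b (center x) (q.1.addPts x) q.2)) mC.aemeasurable,
    ← lintegral_add_right _ mC]
  refine lintegral_mono_ae ?_
  filter_upwards [hres.quasiMeasurePreserving.ae hx1, hres.quasiMeasurePreserving.ae hx3,
    hres.quasiMeasurePreserving.ae hx4,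
    (Measure.quasiMeasurePreserving_snd (μ := Q) (ν := Q)).ae hD,
    (Measure.quasiMeasurePreserving_snd (μ := Q) (ν := Q)).ae hξ] with q h1 h2 h3 h4 h5
  have r1 : (rs q).restr (stabBall R x q.1) = q.1.restr (stabBall R x q.1) :=
    restr_add_restr_compl_left _ _ (hSm _)
  have r2 : (rs q).restr (stabBall R x q.1 : Set (E d))ᶜ =
      q.2.restr (stabBall R x q.1 : Set (E d))ᶜ := restr_add_restr_compl_right _ _ (hSm _)
  have hSq : stabBall R x (rs q) = stabBall R x q.1 := hS_eq x _ _ r1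
  have hsel : selection t g x (rs q) = selection t g x q.1 := by
    rw [selection, selection, hgS x _ _ r1]
  rw [hSq] at h1
  -- The exceptional sum over all tuples of points of `ζ_𝐱` vanishes, hence so does its part over
  -- tuples of points of `ζ` alone, as required by `stein_le`.
  rw [facSum_addPts_eq hm (h := fun (y : Fin m → E d) (μ' : Config d) =>
    ind (¬∀ i, y i ∈ (stabBall R y μ' : Set (E d)))) (fun y μ' σ => by
      rw [stabBall_comp_perm]
      congr 1
      exact propext (not_congr ⟨fun h i => by simpa using h (σ.symm i), fun h i => h (σ i)⟩)),
    add_eq_zero] at h2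
  rcases selection_eq (t := t) hg x (rs q) with h0 | h0
  · rw [h0, zero_mul]
    exact zero_le
  · rw [← hsel, h0, one_mul, one_mul, one_mul]
    have key := stein_le (t := t) (hg := hg) (hg' := hg') hm
      (S := fun y μ => (stabBall R y μ : Set (E d)))
      (fun y μ μ' h => congrArg SetLike.coe (hS_eq y μ μ' h)) hgS (hΨL (center x)) (hSm q.1) r2 h1
      h2.2 h4 h3 h5 h0
    refine key.trans ?_
    -- The ball of `𝐱` is expressed through the resampled configuration, so that this bound is a
    -- function of `ζ` alone and can be integrated under `Q`.
    have b1 : facSum m (rs q) (fun y μ' => selection t g y (μ'.addPts x) *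
        ind (¬Disjoint (stabBall R y (μ'.addPts x) : Set (E d)) (stabBall R x q.1))) ≤
        closeSum (selection t g) R b x (rs q) := by
      rw [← hSq]
      refine facSum_mono fun y μ' hy => mul_le_mul_right ?_ _
      have := ind_not_disjoint_cball_le (center y) (center x)
        (R (center y) ((μ'.addPts x).addPts y)) (R (center x) ((rs q).addPts x))
        (b (center y)) (b (center x))
      rw [← hy, addPts_comm μ' y x] at this
      rw [stabBall, stabBall, ← hy, addPts_comm μ' y x]
      exact this
    -- Here the ball of `𝐱` is kept as a function of the first configuration, so that it is
    -- independent of the tuples of the second one.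
    have b2 : (m.factorial : ℝ≥0∞)⁻¹ * facSum m q.2 (fun y μ' => selection t g y μ' *
        ind (¬Disjoint (stabBall R y μ' : Set (E d)) (stabBall R x q.1))) ≤
        farSum t g R b (center x) (q.1.addPts x) q.2 := by
      rw [farSum, lintegral_xiProc]
      refine mul_le_mul_right (facSum_mono fun y μ' hy => mul_le_mul_right ?_ _) _
      have := ind_not_disjoint_cball_le (center y) (center x)
        (R (center y) (μ'.addPts y)) (R (center x) (q.1.addPts x)) (b (center y)) (b (center x))
      rw [← hy]
      exact this
    calc _ ≤ Ψ (center x) (xiConfig t g hg hg' q.2) + (m.factorial : ℝ≥0∞)⁻¹ *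
          (mixedSum (selection t g) x (rs q) + closeSum (selection t g) R b x (rs q)) +
          farSum t g R b (center x) (q.1.addPts x) q.2 := by
          refine add_le_add (add_le_add_right (mul_le_mul_right (add_le_add_right b1 _) _) _) b2
      _ = _ := by ring

end Core

/-! ### Integrating the mixed and the close tuples -/

section Terms
open Config
variable {d m : ℕ} {Q : Measure (Config d)} [IsProbabilityMeasure Q] {lam : Measure (E d)}
  [SigmaFinite lam] {h : (Fin m → E d) → Config d → ℝ≥0∞}

/-- The factor `h x ζ` is moved into the sum, where `ζ` is the remaining configuration with `y`
added; then Mecke's formula applies. -/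
theorem lintegral_mul_facSum (hM : IsMecke Q lam) (hh : Measurable (Function.uncurry h)) {l : ℕ}
    {G : (Fin m → E d) → (Fin l → E d) → Config d → ℝ≥0∞}
    (hG : Measurable fun q : (Fin m → E d) × (Fin l → E d) × Config d => G q.1 q.2.1 q.2.2)
    (x : Fin m → E d) :
    ∫⁻ ζ, h x ζ * facSum l ζ (G x) ∂Q =
      ∫⁻ y, ∫⁻ μ, h x (μ.addPts y) * G x y μ ∂Q ∂(Measure.pi fun _ => lam) := by
  have hF : Measurable (Function.uncurry fun (y : Fin l → E d) (μ : Config d) =>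
      h x (μ.addPts y) * G x y μ) :=
    (measurable_uncurry_comp hh measurable_const (measurable_addPts measurable_snd
      measurable_fst)).mul (hG.comp (f := fun q : (Fin l → E d) × Config d => (x, q.1, q.2))
        (by fun_prop))
  rw [← hM.lintegral_facSum (F := fun (y : Fin l → E d) (μ : Config d) =>
    h x (μ.addPts y) * G x y μ) hF]
  refine lintegral_congr fun ζ => ?_
  rw [mul_comm, ← facSum_mul_const]
  exact facSum_congr fun y μ' hy => by rw [hy, mul_comm]

/-- The pairs of tuples that share `m - l` points. -/
theorem lintegral_mul_mixedSum (hm : 1 ≤ m) (hM : IsMecke Q lam)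
    (hh : Measurable (Function.uncurry h))
    (hs : ∀ (x : Fin m → E d) (μ : Config d) (σ : Equiv.Perm (Fin m)), h (x ∘ σ) μ = h x μ) :
    ∫⁻ x, ∫⁻ ζ, h x ζ * mixedSum h x ζ ∂Q ∂(Measure.pi fun _ => lam) =
      ∑ l ∈ Finset.Ico 1 m, (m.choose l : ℝ≥0∞) * ((m.descFactorial (m - l) : ℝ≥0∞) *
        ∫⁻ μ, ∫⁻ x : Fin l → E d, ∫⁻ u : Fin (m - l) → E d, ∫⁻ y : Fin l → E d,
          h (join x u) (μ.addPts y) * h (join y u) (μ.addPts x) ∂(Measure.pi fun _ => lam)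
          ∂(Measure.pi fun _ => lam) ∂(Measure.pi fun _ => lam) ∂Q) := by
  obtain ⟨j, hj⟩ := exists_complementary hm
  simp only [mixedSum_eq hj]
  have mG : ∀ l (i : Fin (m - l) ↪ Fin m), Measurable
      fun q : (Fin m → E d) × (Fin l → E d) × Config d =>
        h (join q.2.1 (q.1 ∘ i)) (q.2.2.addPts (q.1 ∘ j l i)) := by
    intro l i
    refine measurable_uncurry_comp hh (measurable_join (by fun_prop) ?_)
      (measurable_addPts (by fun_prop) ?_)
    · exact measurable_pi_iff.2 fun k => by simp only [Function.comp_apply]; fun_prop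
    · exact measurable_pi_iff.2 fun k => by simp only [Function.comp_apply]; fun_prop
  have mF : ∀ l (i : Fin (m - l) ↪ Fin m), Measurable fun q : (Fin m → E d) × Config d =>
      h q.1 q.2 * facSum l q.2 fun y μ' => h (join y (q.1 ∘ i)) (μ'.addPts (q.1 ∘ j l i)) := by
    intro l i
    refine hh.mul (measurable_facSum (F := fun (q : (Fin m → E d) × Config d) (y : Fin l → E d) μ' =>
      h (join y (q.1 ∘ i)) (μ'.addPts (q.1 ∘ j l i))) measurable_snd ?_)
    exact (mG l i).comp (f := fun q : ((Fin m → E d) × Config d) × (Fin l → E d) × Config d =>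
      (q.1.1, q.2.1, q.2.2)) (by fun_prop)
  have mF' : ∀ l (i : Fin (m - l) ↪ Fin m) (x : Fin m → E d), Measurable fun ζ : Config d =>
      h x ζ * facSum l ζ fun y μ' => h (join y (x ∘ i)) (μ'.addPts (x ∘ j l i)) := fun l i x =>
    (mF l i).comp (f := fun ζ : Config d => (x, ζ)) (by fun_prop)
  have e0 : ∀ (x : Fin m → E d) (ζ : Config d), h x ζ * ∑ l ∈ Finset.Ico 1 m, (m.choose l : ℝ≥0∞) *
      ∑ i : Fin (m - l) ↪ Fin m, facSum l ζ (fun y μ' =>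
        h (join y (x ∘ i)) (μ'.addPts (x ∘ j l i))) =
      ∑ l ∈ Finset.Ico 1 m, (m.choose l : ℝ≥0∞) * ∑ i : Fin (m - l) ↪ Fin m,
        (h x ζ * facSum l ζ fun y μ' => h (join y (x ∘ i)) (μ'.addPts (x ∘ j l i))) := by
    intro x ζ
    rw [Finset.mul_sum]
    refine Finset.sum_congr rfl fun l _ => ?_
    rw [mul_left_comm, Finset.mul_sum]
  have e1 : ∀ x : Fin m → E d, ∫⁻ ζ, (∑ l ∈ Finset.Ico 1 m, (m.choose l : ℝ≥0∞) *
      ∑ i : Fin (m - l) ↪ Fin m,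
        (h x ζ * facSum l ζ fun y μ' => h (join y (x ∘ i)) (μ'.addPts (x ∘ j l i)))) ∂Q =
      ∑ l ∈ Finset.Ico 1 m, (m.choose l : ℝ≥0∞) * ∑ i : Fin (m - l) ↪ Fin m,
        ∫⁻ ζ, (h x ζ * facSum l ζ fun y μ' => h (join y (x ∘ i)) (μ'.addPts (x ∘ j l i))) ∂Q := by
    intro x
    rw [lintegral_finsetSum _ fun l _ => (Finset.measurable_fun_sum _ fun i _ =>
      mF' l i x).const_mul _]
    refine Finset.sum_congr rfl fun l _ => ?_
    rw [lintegral_const_mul _ (Finset.measurable_fun_sum _ fun i _ => mF' l i x),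
      lintegral_finsetSum _ fun i _ => mF' l i x]
  simp only [e0, e1]
  have mI : ∀ l (i : Fin (m - l) ↪ Fin m), Measurable fun x : Fin m → E d => ∫⁻ ζ, (h x ζ *
      facSum l ζ fun y μ' => h (join y (x ∘ i)) (μ'.addPts (x ∘ j l i))) ∂Q := fun l i =>
    (mF l i).lintegral_prod_right'
  rw [lintegral_finsetSum _ fun l _ => (Finset.measurable_fun_sum _ fun i _ =>
      mI l i).const_mul _]
  refine Finset.sum_congr rfl fun l hl => ?_
  have hl' : l ≤ m := (Finset.mem_Ico.1 hl).2.le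
  rw [lintegral_const_mul _ (Finset.measurable_fun_sum _ fun i _ => mI l i),
    lintegral_finsetSum _ fun i _ => mI l i]
  congr 1
  -- Call the coordinates selected by `i` `u` and the other ones `x`. By symmetry of `h` the
  -- integral does not depend on `i`, so the sum over `i` only counts the embeddings.
  have e2 : ∀ i : Fin (m - l) ↪ Fin m, ∫⁻ x, ∫⁻ ζ, (h x ζ *
      facSum l ζ fun y μ' => h (join y (x ∘ i)) (μ'.addPts (x ∘ j l i))) ∂Q
        ∂(Measure.pi fun _ => lam) =
      ∫⁻ μ, ∫⁻ x : Fin l → E d, ∫⁻ u : Fin (m - l) → E d, ∫⁻ y : Fin l → E d,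
          h (join x u) (μ.addPts y) * h (join y u) (μ.addPts x) ∂(Measure.pi fun _ => lam)
          ∂(Measure.pi fun _ => lam) ∂(Measure.pi fun _ => lam) ∂Q := by
    intro i
    let e : Fin l ⊕ Fin (m - l) ≃ Fin m := Equiv.ofBijective _ (hj l hl' i)
    rw [lintegral_pi_split lam e (mI l i)]
    have mJ : Measurable fun q : (Fin l → E d) × (Fin (m - l) → E d) × Config d × (Fin l → E d) =>
        h (join q.1 q.2.1) (q.2.2.1.addPts q.2.2.2) *
          h (join q.2.2.2 q.2.1) (q.2.2.1.addPts q.1) :=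
      (measurable_uncurry_comp hh (measurable_join (by fun_prop) (by fun_prop))
        (measurable_addPts (by fun_prop) (by fun_prop))).mul
      (measurable_uncurry_comp hh (measurable_join (by fun_prop) (by fun_prop))
        (measurable_addPts (by fun_prop) (by fun_prop)))
    rw [lintegral_rotate (Measure.pi fun _ : Fin l => lam)
      (Measure.pi fun _ : Fin (m - l) => lam) Q (F := fun (x : Fin l → E d) (u : Fin (m - l) → E d) (μ : Config d) =>
      ∫⁻ y : Fin l → E d, h (join x u) (μ.addPts y) * h (join y u) (μ.addPts x)
        ∂(Measure.pi fun _ => lam))]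
    · refine lintegral_congr fun x => lintegral_congr fun u => ?_
      have ei : (Sum.elim x u ∘ e.symm) ∘ i = u := by
        funext k
        have : e (Sum.inr k) = i k := rfl
        simp only [Function.comp_apply, ← this, Equiv.symm_apply_apply, Sum.elim_inr]
      have ej : (Sum.elim x u ∘ e.symm) ∘ j l i = x := by
        funext k
        have : e (Sum.inl k) = j l i k := rfl
        simp only [Function.comp_apply, ← this, Equiv.symm_apply_apply, Sum.elim_inl]
      have eh : ∀ μ, h (Sum.elim x u ∘ e.symm) μ = h (join x u) μ := by
        intro μ
        rw [← join_comp_joinEquiv hl', Function.comp_assoc]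
        exact hs (join x u) μ (e.symm.trans (joinEquiv hl'))
      refine (lintegral_mul_facSum hM hh (G := fun (x : Fin m → E d) (y : Fin l → E d) μ' =>
        h (join y (x ∘ i)) (μ'.addPts (x ∘ j l i))) (mG l i) (Sum.elim x u ∘ e.symm)).trans ?_
      simp only [ei, ej, eh]
      rw [lintegral_lintegral_swap]
      exact (mJ.comp (f := fun q : (Fin l → E d) × Config d => (x, u, q.2, q.1))
        (by fun_prop)).aemeasurable
    · exact Measurable.lintegral_prod_right' (f := fun q : ((Fin l → E d) × (Fin (m - l) → E d) ×
        Config d) × (Fin l → E d) => h (join q.1.1 q.1.2.1) (q.1.2.2.addPts q.2) *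
          h (join q.2 q.1.2.1) (q.1.2.2.addPts q.1.1))
        (mJ.comp (f := fun q : ((Fin l → E d) × (Fin (m - l) → E d) × Config d) × (Fin l → E d) =>
          (q.1.1, q.1.2.1, q.1.2.2, q.2)) (by fun_prop))
  simp only [e2]
  rw [Finset.sum_const, Finset.card_univ, Fintype.card_embedding_eq, Fintype.card_fin,
    Fintype.card_fin, nsmul_eq_mul]

variable {R : E d → Config d → ℝ≥0∞} {b : E d → ℝ≥0}

/-- The pairs of disjoint tuples. -/
theorem lintegral_mul_closeSum (hM : IsMecke Q lam) (hh : Measurable (Function.uncurry h))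
    (hR : Measurable (Function.uncurry R)) (hb : Measurable b) :
    ∫⁻ x, ∫⁻ ζ, h x ζ * closeSum h R b x ζ ∂Q ∂(Measure.pi fun _ => lam) =
      ∫⁻ μ, ∫⁻ x : Fin m → E d, ∫⁻ y : Fin m → E d, h x (μ.addPts y) * h y (μ.addPts x) *
        ind (dist (center x) (center y) ≤ b (center x) + b (center y))
        ∂(Measure.pi fun _ => lam) ∂(Measure.pi fun _ => lam) ∂Q +
      2 * ∫⁻ μ, ∫⁻ x : Fin m → E d, ∫⁻ y : Fin m → E d, h x (μ.addPts y) * h y (μ.addPts x) *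
        ind ((b (center x) : ℝ≥0∞) < R (center x) ((μ.addPts x).addPts y))
        ∂(Measure.pi fun _ => lam) ∂(Measure.pi fun _ => lam) ∂Q := by
  have m1 : Measurable fun q : (Fin m → E d) × (Fin m → E d) × Config d => q.2.2.addPts q.1 :=
    measurable_addPts (by fun_prop) (by fun_prop)
  have m1' : Measurable fun q : (Fin m → E d) × (Fin m → E d) × Config d => q.2.2.addPts q.2.1 :=
    measurable_addPts (by fun_prop) (by fun_prop)
  have m2 : Measurable fun q : (Fin m → E d) × (Fin m → E d) × Config d =>
      (q.2.2.addPts q.1).addPts q.2.1 := measurable_addPts m1 (by fun_prop)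
  have mx : Measurable fun q : (Fin m → E d) × (Fin m → E d) × Config d => center q.1 :=
    measurable_center.comp (by fun_prop)
  have my : Measurable fun q : (Fin m → E d) × (Fin m → E d) × Config d => center q.2.1 :=
    measurable_center.comp (by fun_prop)
  have mhh : Measurable fun q : (Fin m → E d) × (Fin m → E d) × Config d =>
      h q.1 (q.2.2.addPts q.2.1) * h q.2.1 (q.2.2.addPts q.1) :=
    (measurable_uncurry_comp hh (by fun_prop) m1').mul (measurable_uncurry_comp hh (by fun_prop) m1)
  have d1 := measurable_ind_dist hb mx my
  have d2 := measurable_ind_radius hb hR mx m2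
  have d3 := measurable_ind_radius hb hR my m2
  have e1 : ∀ x : Fin m → E d, ∫⁻ ζ, h x ζ * closeSum h R b x ζ ∂Q =
      ∫⁻ y, ∫⁻ μ, (h x (μ.addPts y) * h y (μ.addPts x) *
          ind (dist (center x) (center y) ≤ b (center x) + b (center y)) +
        h x (μ.addPts y) * h y (μ.addPts x) *
          ind ((b (center x) : ℝ≥0∞) < R (center x) ((μ.addPts x).addPts y)) +
        h x (μ.addPts y) * h y (μ.addPts x) *
          ind ((b (center y) : ℝ≥0∞) < R (center y) ((μ.addPts x).addPts y))) ∂Q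
        ∂(Measure.pi fun _ => lam) := by
    intro x
    refine (lintegral_mul_facSum hM hh (G := fun (x y : Fin m → E d) μ' => h y (μ'.addPts x) *
      (ind (dist (center x) (center y) ≤ b (center x) + b (center y)) +
        ind ((b (center x) : ℝ≥0∞) < R (center x) ((μ'.addPts x).addPts y)) +
        ind ((b (center y) : ℝ≥0∞) < R (center y) ((μ'.addPts x).addPts y))))
      ((measurable_uncurry_comp hh (by fun_prop) m1).mul ((d1.add d2).add d3)) x).trans ?_
    refine lintegral_congr fun y => lintegral_congr fun μ => ?_
    ring
  simp only [e1]
  rw [← lintegral_rotate (Measure.pi fun _ : Fin m => lam) (Measure.pi fun _ : Fin m => lam) Q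
    (F := fun (x y : Fin m → E d) (μ : Config d) =>
    h x (μ.addPts y) * h y (μ.addPts x) *
          ind (dist (center x) (center y) ≤ b (center x) + b (center y)) +
        h x (μ.addPts y) * h y (μ.addPts x) *
          ind ((b (center x) : ℝ≥0∞) < R (center x) ((μ.addPts x).addPts y)) +
        h x (μ.addPts y) * h y (μ.addPts x) *
          ind ((b (center y) : ℝ≥0∞) < R (center y) ((μ.addPts x).addPts y)))
    (((mhh.mul d1).add (mhh.mul d2)).add (mhh.mul d3))]
  have sp : ∀ {F G : (Fin m → E d) → (Fin m → E d) → Config d → ℝ≥0∞},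
      (Measurable fun q : (Fin m → E d) × (Fin m → E d) × Config d => F q.1 q.2.1 q.2.2) →
      ∫⁻ μ, ∫⁻ x, ∫⁻ y, F x y μ + G x y μ ∂(Measure.pi fun _ => lam) ∂(Measure.pi fun _ => lam) ∂Q =
      ∫⁻ μ, ∫⁻ x, ∫⁻ y, F x y μ ∂(Measure.pi fun _ => lam) ∂(Measure.pi fun _ => lam) ∂Q +
      ∫⁻ μ, ∫⁻ x, ∫⁻ y, G x y μ ∂(Measure.pi fun _ => lam) ∂(Measure.pi fun _ => lam) ∂Q := by
    intro F G hF
    have hF1 : Measurable fun q : Config d × (Fin m → E d) => ∫⁻ y, F q.2 y q.1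
        ∂(Measure.pi fun _ => lam) :=
      Measurable.lintegral_prod_right' (f := fun q : (Config d × (Fin m → E d)) × (Fin m → E d) =>
        F q.1.2 q.2 q.1.1) (hF.comp (f := fun q : (Config d × (Fin m → E d)) × (Fin m → E d) =>
        (q.1.2, q.2, q.1.1)) (by fun_prop))
    rw [← lintegral_add_left hF1.lintegral_prod_right']
    refine lintegral_congr fun μ => ?_
    have hF2 : Measurable fun x : Fin m → E d => ∫⁻ y, F x y μ ∂(Measure.pi fun _ => lam) :=
      hF1.comp (f := fun x : Fin m → E d => (μ, x)) (by fun_prop)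
    dsimp only
    rw [← lintegral_add_left hF2]
    refine lintegral_congr fun x => ?_
    exact lintegral_add_left (hF.comp (f := fun y : Fin m → E d => (x, y, μ)) (by fun_prop)) _
  -- Exchanging `x` and `y` turns the event of a large radius at `y` into the one at `x`; this is
  -- the factor `2` in `C_3`.
  rw [sp ((mhh.mul d1).add (mhh.mul d2)), sp (mhh.mul d1), add_assoc, two_mul]
  congr 2
  refine lintegral_congr fun μ => ?_
  rw [lintegral_lintegral_swap]
  · refine lintegral_congr fun y => lintegral_congr fun x => ?_
    rw [mul_comm (h x _), addPts_comm]
  · exact ((mhh.mul d3).comp (f := fun q : (Fin m → E d) × (Fin m → E d) => (q.1, q.2, μ))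
      (by fun_prop)).aemeasurable

end Terms

/-! ### Identification of the error terms -/

section Collect
open Config
variable {d m : ℕ} {Q : Measure (Config d)} {lam : Measure (E d)} {t : ℝ}
  {g : (Fin m → E d) → Config d → ℝ≥0} {R : E d → Config d → ℝ≥0∞} {b : E d → ℝ≥0}

theorem selection_mul_selection (x y : Fin m → E d) (μ ν : Config d) :
    selection t g x μ * selection t g y ν =
      ind (center x ∈ window d t) * ind (center y ∈ window d t) * (g x μ : ℝ≥0∞) *
        (g y ν : ℝ≥0∞) := by
  unfold selection
  ring

/-- One factor `1 / m!` comes from Mecke's formula for `ξ_t`, the other from the normalization of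
the second process. The number of embeddings is `m! / l!`, which leaves `1 / (m! l!)`. -/
theorem termC1_eq : termC1 Q id lam t g = (m.factorial : ℝ≥0∞)⁻¹ * ((m.factorial : ℝ≥0∞)⁻¹ *
    ∑ l ∈ Finset.Ico 1 m, (m.choose l : ℝ≥0∞) * ((m.descFactorial (m - l) : ℝ≥0∞) *
        ∫⁻ μ, ∫⁻ x : Fin l → E d, ∫⁻ u : Fin (m - l) → E d, ∫⁻ y : Fin l → E d,
          selection t g (join x u) (μ.addPts y) * selection t g (join y u) (μ.addPts x)
          ∂(Measure.pi fun _ => lam) ∂(Measure.pi fun _ => lam) ∂(Measure.pi fun _ => lam) ∂Q)) := by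
  rw [termC1, Finset.mul_sum, Finset.mul_sum]
  refine Finset.sum_congr rfl fun l hl => ?_
  simp only [selection_mul_selection, id]
  have hl' : l ≤ m := (Finset.mem_Ico.1 hl).2.le
  have h1 : (l.factorial : ℝ≥0∞) * (m.descFactorial (m - l) : ℝ≥0∞) = m.factorial := by
    have := Nat.factorial_mul_descFactorial (Nat.sub_le m l)
    rw [Nat.sub_sub_self hl'] at this
    exact_mod_cast this
  have hm0 : (m.factorial : ℝ≥0∞) ≠ 0 := by exact_mod_cast m.factorial_ne_zero
  have hl0 : (l.factorial : ℝ≥0∞) ≠ 0 := by exact_mod_cast l.factorial_ne_zero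
  have h2 : (m.descFactorial (m - l) : ℝ≥0∞) = m.factorial * (l.factorial : ℝ≥0∞)⁻¹ := by
    rw [← h1, mul_comm, ← mul_assoc, ENNReal.inv_mul_cancel hl0 (by simp), one_mul]
  have h3 : (m.choose l : ℝ≥0∞) / ((m.factorial : ℝ≥0∞) * (l.factorial : ℝ≥0∞)) =
      (m.factorial : ℝ≥0∞)⁻¹ * ((m.factorial : ℝ≥0∞)⁻¹ * ((m.choose l : ℝ≥0∞) *
        (m.descFactorial (m - l) : ℝ≥0∞))) := by
    rw [h2, div_eq_mul_inv, ENNReal.mul_inv (Or.inl hm0) (Or.inl (by simp))]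
    calc _ = ((m.factorial : ℝ≥0∞)⁻¹ * m.factorial) * ((m.choose l : ℝ≥0∞) *
          ((m.factorial : ℝ≥0∞)⁻¹ * (l.factorial : ℝ≥0∞)⁻¹)) := by
          rw [ENNReal.inv_mul_cancel hm0 (by simp), one_mul]
      _ = _ := by ring
  rw [h3]
  simp only [mul_assoc]

theorem termC2_eq : termC2 Q id lam t g b = (m.factorial : ℝ≥0∞)⁻¹ * ((m.factorial : ℝ≥0∞)⁻¹ *
    ∫⁻ μ, ∫⁻ x : Fin m → E d, ∫⁻ y : Fin m → E d,
      selection t g x (μ.addPts y) * selection t g y (μ.addPts x) *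
        ind (dist (center x) (center y) ≤ b (center x) + b (center y))
        ∂(Measure.pi fun _ => lam) ∂(Measure.pi fun _ => lam) ∂Q) := by
  simp only [termC2, selection_mul_selection, id]
  rw [one_div, ENNReal.inv_pow, sq, mul_assoc]

theorem termC3_eq : termC3 Q id lam t g R b = (m.factorial : ℝ≥0∞)⁻¹ * ((m.factorial : ℝ≥0∞)⁻¹ *
    (2 * ∫⁻ μ, ∫⁻ x : Fin m → E d, ∫⁻ y : Fin m → E d,
      selection t g x (μ.addPts y) * selection t g y (μ.addPts x) *
        ind ((b (center x) : ℝ≥0∞) < R (center x) ((μ.addPts x).addPts y))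
        ∂(Measure.pi fun _ => lam) ∂(Measure.pi fun _ => lam) ∂Q)) := by
  simp only [termC3, selection_mul_selection, id]
  rw [div_eq_mul_inv, ENNReal.inv_pow, sq]
  ring

theorem lintegral_ind_eq {α : Type*} [MeasurableSpace α] (μ : Measure α) {p : α → Prop}
    (hp : MeasurableSet {a | p a}) : ∫⁻ a, ind (p a) ∂μ = μ {a | p a} := by
  rw [← lintegral_indicator_one hp]
  refine lintegral_congr fun a => ?_
  by_cases h : p a
  · rw [ind_pos h, Set.indicator_of_mem (show a ∈ {a | p a} from h)]; rfl
  · rw [ind_neg h, Set.indicator_of_notMem (show a ∉ {a | p a} from h)]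

/-- The integral of the interactions of `ξ_t` with an independent copy. -/
theorem lintegral_farSum [IsProbabilityMeasure Q] (hg : Measurable (Function.uncurry g))
    (hR : Measurable (Function.uncurry R)) (hb : Measurable b)
    [IsFiniteMeasure (intensity Q (xiProc t g))] {κ : Kernel (E d) (Config d)}
    (hκ : IsPalmKernel Q id (xiProc t g) κ) :
    ∫⁻ μ, ∫⁻ z, ∫⁻ μ', farSum t g R b z μ μ' ∂Q ∂(xiProc t g μ) ∂Q =
      termPalm κ (intensity Q (xiProc t g)) R b := by
  have := hκ.1
  have hset : MeasurableSet {q : E d × Config d | (b q.1 : ℝ≥0∞) < R q.1 q.2} :=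
    measurableSet_lt (hb.comp measurable_fst).coe_nnreal_ennreal hR
  have hsz : ∀ z, MeasurableSet {μ : Config d | (b z : ℝ≥0∞) < R z μ} := fun z =>
    (show Measurable fun μ : Config d => (z, μ) by fun_prop) hset
  have mB : Measurable fun q : E d × Config d => ind ((b q.1 : ℝ≥0∞) < R q.1 q.2) :=
    measurable_ind hset
  set M := intensity Q (xiProc t g) with hMdef
  set K : E d → ℝ≥0∞ := fun z => κ z {μ | (b z : ℝ≥0∞) < R z μ} with hK
  have hKi : ∀ z, ∫⁻ μ, ind ((b z : ℝ≥0∞) < R z μ) ∂(κ z) = K z := fun z =>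
    lintegral_ind_eq _ (hsz z)
  have mK : Measurable K := by
    have h := Measurable.lintegral_kernel_prod_right' (κ := κ) (f := fun q : E d × Config d =>
      ind ((b q.1 : ℝ≥0∞) < R q.1 q.2)) mB
    simpa only [hKi] using h
  have mD : Measurable fun q : E d × E d => ind (dist q.1 q.2 ≤ b q.1 + b q.2) :=
    measurable_ind_dist hb measurable_fst measurable_snd
  have mDz : ∀ z, Measurable fun w : E d => ind (dist z w ≤ b z + b w) := fun z =>
    measurable_ind_dist hb measurable_const measurable_id
  -- The independent copy is integrated out first: the Palm kernel turns its radius event at `w`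
  -- into `K w`. The radius event at `z` is handled by the Palm kernel in `h2`.
  have e1 : ∀ (z : E d) (μ : Config d), ∫⁻ μ', farSum t g R b z μ μ' ∂Q =
      ∫⁻ w, (ind (dist z w ≤ b z + b w) + K w) ∂M + ind ((b z : ℝ≥0∞) < R z μ) * M Set.univ := by
    intro z μ
    have a1 : ∀ μ', farSum t g R b z μ μ' =
        ∫⁻ w, (ind (dist z w ≤ b z + b w) + ind ((b z : ℝ≥0∞) < R z μ)) ∂(xiProc t g μ') +
        ∫⁻ w, ind ((b w : ℝ≥0∞) < R w μ') ∂(xiProc t g μ') := fun μ' =>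
      lintegral_add_left ((mDz z).add measurable_const) _
    have a2 : Measurable fun μ' : Config d => ∫⁻ w, (ind (dist z w ≤ b z + b w) +
        ind ((b z : ℝ≥0∞) < R z μ)) ∂(xiProc t g μ') :=
      measurable_lintegral_xiProc hg measurable_id (Φ := fun (_ : Config d) w =>
        ind (dist z w ≤ b z + b w) + ind ((b z : ℝ≥0∞) < R z μ))
        (((mDz z).comp measurable_snd).add measurable_const)
    have a3 := hκ.2 (fun q => ind ((b q.1 : ℝ≥0∞) < R q.1 q.2)) mB
    simp only [id, hKi] at a3
    rw [← hMdef] at a3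
    simp only [a1]
    rw [lintegral_add_left a2, a3, ← lintegral_intensity_xiProc (Q := Q) hg ((mDz z).fun_add
      measurable_const), ← hMdef, lintegral_add_left (mDz z), lintegral_const,
      lintegral_add_left (mDz z)]
    ring
  simp only [e1]
  have mI : Measurable fun z => ∫⁻ w, (ind (dist z w ≤ b z + b w) + K w) ∂M :=
    Measurable.lintegral_prod_right' (f := fun q : E d × E d =>
      ind (dist q.1 q.2 ≤ b q.1 + b q.2) + K q.2) (mD.add (mK.comp measurable_snd))
  have h2 := hκ.2 (fun q => ∫⁻ w, (ind (dist q.1 w ≤ b q.1 + b w) + K w) ∂M +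
    ind ((b q.1 : ℝ≥0∞) < R q.1 q.2) * M Set.univ)
    ((mI.comp measurable_fst).add (mB.mul_const _))
  simp only [id] at h2
  rw [h2, ← hMdef]
  have e2 : ∀ z, ∫⁻ μ, (∫⁻ w, (ind (dist z w ≤ b z + b w) + K w) ∂M +
      ind ((b z : ℝ≥0∞) < R z μ) * M Set.univ) ∂(κ z) =
      ∫⁻ w, ind (dist z w ≤ b z + b w) ∂M + ∫⁻ w, K w ∂M + K z * M Set.univ := by
    intro z
    rw [lintegral_add_left measurable_const, lintegral_const, measure_univ, mul_one,
      lintegral_mul_const _ (measurable_ind (hsz z)), hKi, lintegral_add_left (mDz z)]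
  -- The terms with `K w` and `K z` have the same double integral with respect to `M`, namely the
  -- integral of `K` times the total mass; together they form `2 K z`.
  have e3 : ∀ z, ∫⁻ w, (2 * K z + ind (dist w z ≤ b w + b z)) ∂M =
      ∫⁻ w, ind (dist z w ≤ b z + b w) ∂M + 2 * K z * M Set.univ := by
    intro z
    rw [lintegral_add_left measurable_const, lintegral_const, add_comm]
    congr 1
    exact lintegral_congr fun w => by rw [dist_comm, add_comm]
  have mID : Measurable fun z => ∫⁻ w, ind (dist z w ≤ b z + b w) ∂M :=
    mD.lintegral_prod_right'
  rw [termPalm]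
  refine Eq.trans ?_ (lintegral_congr e3).symm
  simp only [e2]
  rw [lintegral_add_left (mID.fun_add measurable_const), lintegral_add_left mID,
    lintegral_add_left mID, lintegral_const, lintegral_mul_const _ mK,
    lintegral_mul_const _ (mK.const_mul 2), lintegral_const_mul _ mK]
  ring

/-- The Stein-Mecke estimate for the point process `ξ_t`. -/
theorem lintegral_stein_le [IsProbabilityMeasure Q] [IsLocallyFiniteMeasure lam]
    {hg : ∀ x μ, g x μ = 0 ∨ g x μ = 1}
    {hg' : ∀ (x : Fin m → E d) (μ : Config d) (σ : Equiv.Perm (Fin m)), g (x ∘ σ) μ = g x μ}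
    (hm : 1 ≤ m) (hM : IsMecke Q lam)
    (hgm : Measurable (Function.uncurry g)) (hR : Measurable (Function.uncurry R))
    (hb : Measurable b)
    (hS_eq : ∀ (y : Fin m → E d) μ μ', μ'.restr (stabBall R y μ) = μ.restr (stabBall R y μ) →
      stabBall R y μ' = stabBall R y μ)
    (hgS : ∀ y μ μ', μ'.restr (stabBall R y μ) = μ.restr (stabBall R y μ) → g y μ' = g y μ)
    (hmem : ∀ᵐ x ∂(Measure.pi fun _ : Fin m => lam), ∀ᵐ μ ∂Q, ∀ i, x i ∈ stabBall R x μ)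
    (hfin : ∀ᵐ x ∂(Measure.pi fun _ : Fin m => lam), ∀ᵐ μ ∂Q, R (center x) (μ.addPts x) < ∞)
    (hξ : ∀ᵐ μ ∂Q, xiProc t g μ Set.univ < ∞)
    [IsFiniteMeasure (intensity Q (xiProc t g))] {κ : Kernel (E d) (Config d)}
    (hκ : IsPalmKernel Q id (xiProc t g) κ)
    {Ψ : E d → Config d → ℝ≥0∞} (hΨ : Measurable (Function.uncurry Ψ))
    (hΨL : ∀ (x : E d) (μ₁ μ₂ : Config d) (α β γ : Measure (E d)), μ₁.1 Set.univ < ∞ →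
      μ₂.1 Set.univ < ∞ → μ₁.1 = α + β → μ₂.1 = α + γ →
      Ψ x μ₁ ≤ Ψ x μ₂ + β Set.univ + γ Set.univ) :
    ∫⁻ μ, ∫⁻ z, Ψ z ((xiConfig t g hg hg' μ).removePts fun _ : Fin 1 => z) ∂(xiProc t g μ) ∂Q ≤
      ∫⁻ z, ∫⁻ μ, Ψ z (xiConfig t g hg hg' μ) ∂Q ∂(intensity Q (xiProc t g)) +
        (termC1 Q id lam t g + termC2 Q id lam t g b + termC3 Q id lam t g R b +
          termPalm κ (intensity Q (xiProc t g)) R b) := by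
  have hsm := measurable_selection (t := t) hgm
  have hXm : Measurable (xiConfig t g hg hg') := measurable_xiConfig hgm
  have mA : Measurable fun z => ∫⁻ μ, Ψ z (xiConfig t g hg hg' μ) ∂Q :=
    Measurable.lintegral_prod_right' (f := fun q : E d × Config d => Ψ q.1 (xiConfig t g hg hg' q.2))
      (measurable_uncurry_comp hΨ measurable_fst (hXm.comp measurable_snd))
  have mΨX : ∀ z, Measurable fun μ => Ψ z (xiConfig t g hg hg' μ) := fun z =>
    measurable_uncurry_comp hΨ measurable_const hXm
  have mfar := measurable_farSum (t := t) hgm hR hb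
  have mfar1 : Measurable fun q : E d × Config d => ∫⁻ μ', farSum t g R b q.1 q.2 μ' ∂Q :=
    Measurable.lintegral_prod_right' (f := fun q : (E d × Config d) × Config d =>
      farSum t g R b q.1.1 q.1.2 q.2) (mfar.comp (f := fun q : (E d × Config d) × Config d =>
        (q.1.1, q.1.2, q.2)) (by fun_prop))
  have mfar0 : ∀ z μ, Measurable fun μ' => farSum t g R b z μ μ' := fun z μ =>
    mfar.comp (f := fun μ' : Config d => (z, μ, μ')) (by fun_prop)
  have hcore := ae_lintegral_stein_le (t := t) (hg := hg) (hg' := hg') hm hM hgm hR hb hS_eq hgS hmem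
    hfin hξ hΨ hΨL
  have hcl : Measurable (Function.uncurry (closeSum (selection t g) R b)) :=
    measurable_closeSum hsm hR hb
  have hmx : Measurable (Function.uncurry (mixedSum (selection t g))) := measurable_mixedSum hm hsm
  have mT1 : Measurable fun x => ∫⁻ ζ, selection t g x ζ * mixedSum (selection t g) x ζ ∂Q :=
    (hsm.mul hmx).lintegral_prod_right'
  have mT1' : Measurable fun x => ∫⁻ ζ, selection t g x ζ * closeSum (selection t g) R b x ζ ∂Q :=
    (hsm.mul hcl).lintegral_prod_right'
  have eT1 : ∀ x, ∫⁻ ζ, selection t g x ζ * ((m.factorial : ℝ≥0∞)⁻¹ *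
        (mixedSum (selection t g) x ζ + closeSum (selection t g) R b x ζ)) ∂Q =
      (m.factorial : ℝ≥0∞)⁻¹ * (∫⁻ ζ, selection t g x ζ * mixedSum (selection t g) x ζ ∂Q +
        ∫⁻ ζ, selection t g x ζ * closeSum (selection t g) R b x ζ ∂Q) := by
    intro x
    have m1 : Measurable fun ζ => selection t g x ζ * mixedSum (selection t g) x ζ :=
      (hsm.mul hmx).comp (f := fun ζ : Config d => (x, ζ)) (by fun_prop)
    have m2 : Measurable fun ζ => selection t g x ζ * closeSum (selection t g) R b x ζ :=
      (hsm.mul hcl).comp (f := fun ζ : Config d => (x, ζ)) (by fun_prop)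
    rw [← lintegral_add_left m1, ← lintegral_const_mul _ (m1.fun_add m2)]
    exact lintegral_congr fun ζ => by ring
  have eT2 : ∀ x, ∫⁻ μ, ∫⁻ μ', selection t g x μ * (Ψ (center x) (xiConfig t g hg hg' μ') +
        farSum t g R b (center x) (μ.addPts x) μ') ∂Q ∂Q =
      ∫⁻ μ, selection t g x μ * (∫⁻ μ', Ψ (center x) (xiConfig t g hg hg' μ') ∂Q +
        ∫⁻ μ', farSum t g R b (center x) (μ.addPts x) μ' ∂Q) ∂Q := by
    intro x
    refine lintegral_congr fun μ => ?_
    rw [lintegral_const_mul _ ((mΨX _).fun_add (mfar0 _ _)), lintegral_add_left (mΨX _)]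
  -- Mecke's formula for the independent pair, to be read from right to left: the integral over `𝐱`
  -- becomes an integral over the points of `ξ_t`, giving the main term and the Palm term.
  have e3 := hM.lintegral_xiProc (t := t) hgm (Φ := fun z μ => ∫⁻ μ', Ψ z (xiConfig t g hg hg' μ') ∂Q +
    ∫⁻ μ', farSum t g R b z μ μ' ∂Q) ((mA.comp measurable_fst).add mfar1)
  have e4 : ∀ μ, ∫⁻ z, (∫⁻ μ', Ψ z (xiConfig t g hg hg' μ') ∂Q +
      ∫⁻ μ', farSum t g R b z μ μ' ∂Q) ∂(xiProc t g μ) =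
      ∫⁻ z, ∫⁻ μ', Ψ z (xiConfig t g hg hg' μ') ∂Q ∂(xiProc t g μ) +
      ∫⁻ z, ∫⁻ μ', farSum t g R b z μ μ' ∂Q ∂(xiProc t g μ) := fun μ => lintegral_add_left mA _
  have m5 : Measurable fun μ : Config d =>
      ∫⁻ z, ∫⁻ μ', Ψ z (xiConfig t g hg hg' μ') ∂Q ∂(xiProc t g μ) :=
    measurable_lintegral_xiProc hgm measurable_id (Φ := fun (_ : Config d) z =>
      ∫⁻ μ', Ψ z (xiConfig t g hg hg' μ') ∂Q) (mA.comp measurable_snd)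
  simp only [e4] at e3
  rw [lintegral_add_left m5, lintegral_farSum hgm hR hb hκ, ← lintegral_intensity_xiProc hgm mA] at e3
  have mΦ : Measurable (Function.uncurry fun (z : E d) (μ : Config d) =>
      Ψ z ((xiConfig t g hg hg' μ).removePts fun _ : Fin 1 => z)) :=
    measurable_uncurry_comp hΨ measurable_fst (measurable_removePt (hXm.comp measurable_snd)
      measurable_fst)
  rw [hM.lintegral_xiProc hgm mΦ]
  refine (mul_le_mul_right (lintegral_mono_ae hcore) _).trans ?_
  simp only [eT1, eT2]
  rw [lintegral_add_left ((mT1.fun_add mT1').const_mul _), mul_add, ← e3,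
    lintegral_const_mul _ (mT1.fun_add mT1'), lintegral_add_left mT1,
    lintegral_mul_mixedSum hm hM hsm (fun x μ σ => selection_comp_perm hg' x μ σ),
    lintegral_mul_closeSum hM hsm hR hb, termC1_eq, termC2_eq, termC3_eq]
  refine le_of_eq ?_
  ring

end Collect

/-! ### Dilations -/

namespace Config
variable {d : ℕ}

theorem measurable_dilation (c : ℝ) : Measurable fun z : E d => c • z :=
  (continuous_const_smul c).measurable

/-- The image of a configuration under the dilation by `c`. -/
noncomputable def dilate {c : ℝ} (hc : c ≠ 0) (μ : Config d) : Config d :=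
  ⟨μ.1.map fun z => c • z, fun K hK => by
    rw [Measure.map_apply (measurable_dilation c) hK.measurableSet]
    exact μ.2.1 _ ((Homeomorph.smulOfNeZero c hc).isCompact_preimage.2 hK), fun B hB => by
    rw [Measure.map_apply (measurable_dilation c) hB]
    exact μ.exists_enat _⟩

variable {c : ℝ} {hc : c ≠ 0}

theorem dilate_apply (μ : Config d) {B : Set (E d)} (hB : MeasurableSet B) :
    (dilate hc μ).1 B = μ.1 ((fun z => c • z) ⁻¹' B) :=
  Measure.map_apply (measurable_dilation c) hB

theorem measurable_dilate : Measurable (dilate (d := d) hc) :=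
  measurable_of_apply fun B hB => by
    simp only [dilate_apply _ hB]
    exact measurable_apply measurable_id (measurable_dilation c hB)

theorem dilate_addPts {k : ℕ} (μ : Config d) (x : Fin k → E d) :
    dilate hc (μ.addPts x) = (dilate hc μ).addPts fun i => c • x i := by
  ext B hB
  rw [dilate_apply _ hB, addPts_apply _ _ (measurable_dilation c hB), addPts_apply _ _ hB,
    dilate_apply _ hB]
  rfl

theorem dilate_removePt (μ : Config d) (x : E d) :
    (dilate hc μ).removePts (fun _ : Fin 1 => c • x) =
      dilate hc (μ.removePts fun _ : Fin 1 => x) := by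
  by_cases h : ∑ i : Fin 1, Measure.dirac ((fun _ : Fin 1 => x) i) ≤ μ.1
  · nth_rewrite 1 [← addPts_removePts μ _ h]
    rw [dilate_addPts, removePts_addPts]
  · have h' : ¬∑ i : Fin 1, Measure.dirac ((fun _ : Fin 1 => c • x) i) ≤ (dilate hc μ).1 := by
      rw [sum_dirac_le_one_iff, dilate_apply _ (measurableSet_singleton _)]
      rw [sum_dirac_le_one_iff] at h
      have : (fun z : E d => c • z) ⁻¹' {c • x} = {x} := by
        ext z
        simp only [Set.mem_preimage, Set.mem_singleton_iff]
        exact (smul_right_injective (E d) hc).eq_iff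
      rwa [this]
    rw [removePts, dif_neg h', removePts, dif_neg h]

end Config

/-! ### Transfer to the law of `η` on the space of configurations -/

section Transfer
open Config
variable {d m : ℕ} {Ω : Type*} [MeasurableSpace Ω] {P : Measure Ω} {η : Ω → Config d}
  {lam : Measure (E d)} [SigmaFinite lam] {t : ℝ} {g : (Fin m → E d) → Config d → ℝ≥0}
  {R : E d → Config d → ℝ≥0∞} {b : E d → ℝ≥0}

theorem lintegral_map_pair {α β : Type*} [MeasurableSpace α] [MeasurableSpace β] (A : Measure α)
    (B : Measure β) [SFinite A] [SFinite B] (hη : Measurable η) {F : α → β → Config d → ℝ≥0∞}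
    (hF : Measurable fun q : α × β × Config d => F q.1 q.2.1 q.2.2) :
    ∫⁻ ω, ∫⁻ a, ∫⁻ b, F a b (η ω) ∂B ∂A ∂P = ∫⁻ μ, ∫⁻ a, ∫⁻ b, F a b μ ∂B ∂A ∂(P.map η) := by
  have h1 : Measurable fun q : Config d × α => ∫⁻ b, F q.2 b q.1 ∂B :=
    Measurable.lintegral_prod_right' (f := fun q : (Config d × α) × β => F q.1.2 q.2 q.1.1)
      (hF.comp (f := fun q : (Config d × α) × β => (q.1.2, q.2, q.1.1)) (by fun_prop))
  rw [lintegral_map (f := fun μ : Config d => ∫⁻ a, ∫⁻ b, F a b μ ∂B ∂A)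
    h1.lintegral_prod_right' hη]

theorem termC1_map (hη : Measurable η) (hg : Measurable (Function.uncurry g)) :
    termC1 P η lam t g = termC1 (P.map η) id lam t g := by
  have hs := measurable_selection (t := t) hg
  unfold termC1
  refine Finset.sum_congr rfl fun l _ => ?_
  congr 1
  simp only [← selection_mul_selection, id]
  refine lintegral_map_pair (Measure.pi fun _ : Fin l => lam) (Measure.pi fun _ : Fin (m - l) => lam)
    hη (F := fun x u μ => ∫⁻ y : Fin l → E d, selection t g (join x u) (μ.addPts y) *
      selection t g (join y u) (μ.addPts x) ∂(Measure.pi fun _ => lam)) ?_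
  refine Measurable.lintegral_prod_right' (f := fun q : ((Fin l → E d) × (Fin (m - l) → E d) ×
    Config d) × (Fin l → E d) => selection t g (join q.1.1 q.1.2.1) (q.1.2.2.addPts q.2) *
      selection t g (join q.2 q.1.2.1) (q.1.2.2.addPts q.1.1)) ?_
  exact (measurable_uncurry_comp hs (measurable_join (by fun_prop) (by fun_prop))
      (measurable_addPts (by fun_prop) (by fun_prop))).mul
    (measurable_uncurry_comp hs (measurable_join (by fun_prop) (by fun_prop))
      (measurable_addPts (by fun_prop) (by fun_prop)))

theorem termC2_map (hη : Measurable η) (hg : Measurable (Function.uncurry g)) (hb : Measurable b) :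
    termC2 P η lam t g b = termC2 (P.map η) id lam t g b := by
  have hs := measurable_selection (t := t) hg
  unfold termC2
  congr 1
  simp only [← selection_mul_selection, id]
  refine lintegral_map_pair (Measure.pi fun _ : Fin m => lam) (Measure.pi fun _ : Fin m => lam)
    hη (F := fun x y μ => selection t g x (μ.addPts y) * selection t g y (μ.addPts x) *
      ind (dist (center x) (center y) ≤ b (center x) + b (center y))) ?_
  exact ((measurable_uncurry_comp hs (by fun_prop) (measurable_addPts (by fun_prop)
    (by fun_prop))).mul (measurable_uncurry_comp hs (by fun_prop) (measurable_addPts (by fun_prop)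
    (by fun_prop)))).mul (measurable_ind_dist hb (measurable_center.comp (by fun_prop))
      (measurable_center.comp (by fun_prop)))

theorem termC3_map (hη : Measurable η) (hg : Measurable (Function.uncurry g))
    (hR : Measurable (Function.uncurry R)) (hb : Measurable b) :
    termC3 P η lam t g R b = termC3 (P.map η) id lam t g R b := by
  have hs := measurable_selection (t := t) hg
  unfold termC3
  congr 1
  simp only [← selection_mul_selection, id]
  refine lintegral_map_pair (Measure.pi fun _ : Fin m => lam) (Measure.pi fun _ : Fin m => lam)
    hη (F := fun x y μ => selection t g x (μ.addPts y) * selection t g y (μ.addPts x) *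
      ind ((b (center x) : ℝ≥0∞) < R (center x) ((μ.addPts x).addPts y))) ?_
  exact ((measurable_uncurry_comp hs (by fun_prop) (measurable_addPts (by fun_prop)
    (by fun_prop))).mul (measurable_uncurry_comp hs (by fun_prop) (measurable_addPts (by fun_prop)
    (by fun_prop)))).mul (measurable_ind_radius hb hR (measurable_center.comp (by fun_prop))
      (measurable_addPts (measurable_addPts (by fun_prop) (by fun_prop)) (by fun_prop)))

theorem intensity_xiProc_map (hη : Measurable η) (hg : Measurable (Function.uncurry g)) :
    intensity P (fun ω => xiProc t g (η ω)) = intensity (P.map η) (xiProc t g) := by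
  have h1 : Measurable fun ω => xiProc t g (η ω) := (measurable_xiProc hg).comp hη
  ext B hB
  rw [intensity, intensity, Measure.bind_apply hB h1.aemeasurable,
    Measure.bind_apply hB (measurable_xiProc hg).aemeasurable,
    lintegral_map (f := fun μ : Config d => xiProc t g μ B) (measurable_xiProc_apply hg hB) hη]

theorem intensity_rescale (hη : Measurable η) (hg : Measurable (Function.uncurry g)) :
    intensity P (fun ω => rescale t (xiProc t g (η ω))) =
      (intensity (P.map η) (xiProc t g)).map fun z => (t ^ (-(1 / (d : ℝ)))) • z := by
  have h1 : Measurable fun ω => xiProc t g (η ω) := (measurable_xiProc hg).comp hη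
  rw [← intensity_xiProc_map hη hg]
  ext B hB
  have h2 : Measurable fun ω => rescale t (xiProc t g (η ω)) :=
    (Measure.measurable_map _ (measurable_dilation _)).comp h1
  rw [Measure.map_apply (measurable_dilation _) hB, intensity, intensity,
    Measure.bind_apply hB h2.aemeasurable,
    Measure.bind_apply (measurable_dilation _ hB) h1.aemeasurable]
  exact lintegral_congr fun ω => Measure.map_apply (measurable_dilation _) hB

theorem IsPalmKernel.map (hη : Measurable η) (hg : Measurable (Function.uncurry g))
    {κ : Kernel (E d) (Config d)} (hκ : IsPalmKernel P η (fun ω => xiProc t g (η ω)) κ) :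
    IsPalmKernel (P.map η) id (xiProc t g) κ := by
  refine ⟨hκ.1, fun f hf => ?_⟩
  rw [← intensity_xiProc_map hη hg, ← hκ.2 f hf]
  exact lintegral_map (f := fun μ : Config d => ∫⁻ z, f (z, μ) ∂(xiProc t g μ))
    (measurable_lintegral_xiProc hg measurable_id (Φ := fun μ z => f (z, μ))
      (hf.comp measurable_swap)) hη

end Transfer

/-! ### Proof of the main estimate -/

/-- If the total variation norm is finite, then a measure that is concentrated on a bounded set and a
locally finite measure are both finite. -/
theorem measure_univ_lt_top_of_tvNorm {d : ℕ} {M Λ : Measure (E d)} [IsLocallyFiniteMeasure Λ]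
    (h : tvNorm M Λ ≠ ∞) {B : Set (E d)} (hB : MeasurableSet B) (hb : Bornology.IsBounded B)
    (h0 : M Bᶜ = 0) : M Set.univ < ∞ ∧ Λ Set.univ < ∞ := by
  rw [tvNorm, ENNReal.add_ne_top] at h
  have hB' : M B < ∞ := by
    have h1 : M B - Λ B ≤ ⨆ (B : Set (E d)) (_ : MeasurableSet B), (M B - Λ B) :=
      le_iSup₂_of_le B hB le_rfl
    exact (tsub_le_iff_right.1 h1).trans_lt
      (ENNReal.add_lt_top.2 ⟨lt_top_iff_ne_top.2 h.1, hb.measure_lt_top⟩)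
  have hM : M Set.univ < ∞ := by
    rw [← measure_add_measure_compl hB, h0, add_zero]
    exact hB'
  refine ⟨hM, ?_⟩
  have h1 : Λ Set.univ - M Set.univ ≤ ⨆ (B : Set (E d)) (_ : MeasurableSet B), (Λ B - M B) :=
    le_iSup₂_of_le Set.univ .univ le_rfl
  exact (tsub_le_iff_right.1 h1).trans_lt (ENNReal.add_lt_top.2 ⟨lt_top_iff_ne_top.2 h.2, hM⟩)

theorem theorem3p2 {d m : ℕ} (hd : 2 ≤ d) (hm : 1 ≤ m) (hmd : m ≤ d + 1)
    {Ω Ω' : Type*} [MeasurableSpace Ω] [MeasurableSpace Ω']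
    (P : Measure Ω) [IsProbabilityMeasure P] (P' : Measure Ω') [IsProbabilityMeasure P']
    -- the Poisson process `η`
    (lam : Measure (E d)) [IsLocallyFiniteMeasure lam]
    (η : Ω → Config d) (hη : IsPoissonProcess P η lam)
    -- the selection function `g`, its stabilization radius `R` and the threshold function `b`
    (t : ℝ) (ht : 0 < t)
    (g : (Fin m → E d) → Config d → ℝ≥0)
    (hg_meas : Measurable (Function.uncurry g))
    (hg_val : ∀ x μ, g x μ = 0 ∨ g x μ = 1)
    (hg_symm : ∀ (x : Fin m → E d) (μ : Config d) (σ : Equiv.Perm (Fin m)), g (x ∘ σ) μ = g x μ)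
    (R : E d → Config d → ℝ≥0∞) (hR : IsStabilizing P η lam g R)
    (b : E d → ℝ≥0) (hb : Measurable b)
    -- the Palm processes of `η` with respect to `ξ_t`
    (κ : Kernel (E d) (Config d)) (hκ : IsPalmKernel P η (fun ω => xiProc t g (η ω)) κ)
    -- the approximating Poisson process `ν`
    (Eν : Measure (E d)) [IsLocallyFiniteMeasure Eν]
    (ν : Ω' → Config d) (hν : IsPoissonProcess P' ν Eν) :
    dTV P P' (fun ω => rescale t (xiProc t g (η ω))) (fun ω => (ν ω).1) ≤
      tvNorm (intensity P fun ω => rescale t (xiProc t g (η ω))) Eν +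
        termC1 P η lam t g + termC2 P η lam t g b + termC3 P η lam t g R b +
        termPalm κ (intensity P fun ω => xiProc t g (η ω)) R b := by
  have hmeas := hη.measurable
  have hR0 := hR.measurable_radius
  have hQ : IsProbabilityMeasure (P.map η) := hη.isProbabilityMeasure_map
  have hQ' : IsProbabilityMeasure (P'.map ν) := hν.isProbabilityMeasure_map
  have hc : t ^ (-(1 / (d : ℝ))) ≠ 0 := (Real.rpow_pos_of_pos ht _).ne'
  rw [termC1_map hmeas hg_meas, termC2_map hmeas hg_meas hb, termC3_map hmeas hg_meas hR0 hb,
    intensity_xiProc_map hmeas hg_meas, intensity_rescale hmeas hg_meas]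
  set Q := P.map η with hQdef
  set M := intensity Q (xiProc t g) with hMdef
  set err := termC1 Q id lam t g + termC2 Q id lam t g b + termC3 Q id lam t g R b +
    termPalm κ M R b with herr
  -- The bound is trivial if the norm is infinite. Otherwise both intensity measures are finite, as
  -- needed for the Stein equation.
  by_cases htv : tvNorm (M.map fun z => (t ^ (-(1 / (d : ℝ)))) • z) Eν = ∞
  · rw [htv]
    simp
  -- both intensity measures are finite
  obtain ⟨hMfin', hEν⟩ : (M.map fun z => (t ^ (-(1 / (d : ℝ)))) • z) Set.univ < ∞ ∧
      Eν Set.univ < ∞ := by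
    -- The rescaled window, which is bounded and carries the rescaled process.
    let B : Set (E d) := (fun z => (t ^ (-(1 / (d : ℝ))))⁻¹ • z) ⁻¹' window d t
    have hB : MeasurableSet B := Config.measurable_dilation _ (measurableSet_window d t)
    refine measure_univ_lt_top_of_tvNorm htv hB ?_ ?_
    · have : B ⊆ (fun z => (t ^ (-(1 / (d : ℝ)))) • z) '' window d t := fun z hz =>
        ⟨_, hz, smul_inv_smul₀ hc z⟩
      exact ((isBounded_window d t).smul₀ (t ^ (-(1 / (d : ℝ))))).subset this
    · rw [Measure.map_apply (Config.measurable_dilation _) hB.compl]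
      have : (fun z : E d => (t ^ (-(1 / (d : ℝ)))) • z) ⁻¹' Bᶜ = (window d t)ᶜ := by
        ext z
        simp only [B, Set.mem_preimage, Set.mem_compl_iff, inv_smul_smul₀ hc]
      rw [this, hMdef, intensity, Measure.bind_apply (measurableSet_window d t).compl
        (measurable_xiProc hg_meas).aemeasurable]
      simp [xiProc_compl_window]
  have hMfin : M Set.univ < ∞ := by
    rwa [Measure.map_apply (Config.measurable_dilation _) .univ] at hMfin'
  have i1 : IsFiniteMeasure M := ⟨hMfin⟩
  have i2 : IsFiniteMeasure Eν := ⟨hEν⟩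
  have hMξ : ∫⁻ μ, xiProc t g μ Set.univ ∂Q = M Set.univ := by
    rw [hMdef, intensity, Measure.bind_apply .univ (measurable_xiProc hg_meas).aemeasurable]
  have hξ : ∀ᵐ μ ∂Q, xiProc t g μ Set.univ < ∞ :=
    ae_lt_top (measurable_xiProc_apply hg_meas .univ) (by rw [hMξ]; exact hMfin.ne)
  have hmem : ∀ᵐ x ∂(Measure.pi fun _ : Fin m => lam), ∀ᵐ μ ∂Q, ∀ i, x i ∈ stabBall R x μ := by
    filter_upwards [hR.points_mem] with x hx
    exact (ae_map_iff hmeas.aemeasurable (measurableSet_forall fun i =>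
      IsStabilizing.measurableSet_stabBall hR0 (x := fun _ : Config d => x) measurable_const
        measurable_id measurable_const)).2 hx
  have hRfin : ∀ᵐ x ∂(Measure.pi fun _ : Fin m => lam), ∀ᵐ μ ∂Q,
      R (center x) (μ.addPts x) < ∞ := by
    filter_upwards [hR.radius_finite] with x hx
    exact (ae_map_iff hmeas.aemeasurable (measurableSet_lt (measurable_uncurry_comp hR0
      measurable_const (Config.measurable_addPts measurable_id measurable_const))
      measurable_const)).2 hx
  -- A version of the rescaled process that is always a finite configuration.
  set X : Config d → Config d := fun μ =>
    Config.dilate hc (xiConfig t g hg_val hg_symm μ) with hX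
  have mX : Measurable X := Config.measurable_dilate.comp (measurable_xiConfig hg_meas)
  have hXfin : ∀ μ, (X μ).1 Set.univ < ∞ := fun μ => by
    rw [hX, Config.dilate_apply _ .univ]
    exact xiConfig_univ_lt_top μ
  have hXξ : ∀ᵐ μ ∂Q, (X μ).1 = rescale t (xiProc t g μ) := by
    filter_upwards [hξ] with μ hμ
    change (xiConfig t g hg_val hg_symm μ).1.map _ = _
    rw [xiConfig_val hμ]
    rfl
  have mres : Measurable fun ω => rescale t (xiProc t g (η ω)) :=
    (Measure.measurable_map _ (Config.measurable_dilation _)).comp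
      ((measurable_xiProc hg_meas).comp hmeas)
  have mν : Measurable fun ω => (ν ω).1 := Config.measurable_val hν.measurable
  -- the one-sided estimate
  have main : ∀ A : Set (Measure (E d)), MeasurableSet A →
      P ((fun ω => rescale t (xiProc t g (η ω))) ⁻¹' A) ≤ P' ((fun ω => (ν ω).1) ⁻¹' A) +
        (tvNorm (M.map fun z => (t ^ (-(1 / (d : ℝ)))) • z) Eν + err) := by
    intro A hA
    have mf : Measurable fun μ : Config d => A.indicator (1 : Measure (E d) → ℝ≥0∞) μ.1 :=
      (measurable_one.indicator hA).comp (Config.measurable_val measurable_id)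
    obtain ⟨Ψ, hΨ, hΨ2, hΨL, hΨS⟩ := hν.isMecke.exists_stein mf fun μ =>
      Set.indicator_le_self' (fun _ _ => zero_le_one) _
    set M' := M.map fun z => (t ^ (-(1 / (d : ℝ)))) • z with hM'
    have i3 : IsFiniteMeasure M' := ⟨hMfin'⟩
    let ψ : E d → ℝ≥0∞ := fun y => ∫⁻ μ, Ψ y (X μ) ∂Q
    have mψ : Measurable ψ := Measurable.lintegral_prod_right' (f := fun q : E d × Config d =>
      Ψ q.1 (X q.2)) (measurable_uncurry_comp hΨ measurable_fst (mX.comp measurable_snd))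
    have hψ2 : ∀ y, ψ y ≤ 2 := fun y => by
      calc ψ y ≤ ∫⁻ _, 2 ∂Q := lintegral_mono fun μ => hΨ2 _ _
        _ = 2 := by simp
    have htvψ := lintegral_add_le_tvNorm M' Eν hψ2
    have hPA : ∫⁻ μ, A.indicator (1 : Measure (E d) → ℝ≥0∞) (X μ).1 ∂Q =
        P ((fun ω => rescale t (xiProc t g (η ω))) ⁻¹' A) := by
      have e1 : ∫⁻ μ, A.indicator (1 : Measure (E d) → ℝ≥0∞) (X μ).1 ∂Q =
          ∫⁻ μ, A.indicator (1 : Measure (E d) → ℝ≥0∞) (rescale t (xiProc t g μ)) ∂Q := by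
        refine lintegral_congr_ae ?_
        filter_upwards [hXξ] with μ hμ
        rw [hμ]
      have m1 : Measurable fun μ : Config d =>
          A.indicator (1 : Measure (E d) → ℝ≥0∞) (rescale t (xiProc t g μ)) :=
        (measurable_one.indicator hA).comp ((Measure.measurable_map _
          (Config.measurable_dilation _)).comp (measurable_xiProc hg_meas))
      rw [e1, hQdef, lintegral_map m1 hmeas, ← lintegral_indicator_one (mres hA)]
      rfl
    have hPB : ∫⁻ μ, A.indicator (1 : Measure (E d) → ℝ≥0∞) μ.1 ∂(P'.map ν) =
        P' ((fun ω => (ν ω).1) ⁻¹' A) := by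
      rw [lintegral_map mf hν.measurable, ← lintegral_indicator_one (mν hA)]
      rfl
    have hXu : ∫⁻ μ, (X μ).1 Set.univ ∂Q = M' Set.univ := by
      rw [hM', Measure.map_apply (Config.measurable_dilation _) .univ, Set.preimage_univ, ← hMξ]
      refine lintegral_congr_ae ?_
      filter_upwards [hXξ] with μ hμ
      rw [hμ, rescale, Measure.map_apply (Config.measurable_dilation _) .univ, Set.preimage_univ]
    have hJ : ∫⁻ μ, ∫⁻ y, Ψ y (X μ) ∂Eν ∂Q = ∫⁻ y, ψ y ∂Eν :=
      lintegral_lintegral_swap (measurable_uncurry_comp hΨ measurable_snd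
        (mX.comp measurable_fst)).aemeasurable
    -- The Stein solution is pulled back to the original scale instead of rescaling `η`, `g` and
    -- `R`. Dilations preserve total masses, so the Lipschitz bound is inherited.
    let Ψ' : E d → Config d → ℝ≥0∞ := fun z μ =>
      Ψ ((t ^ (-(1 / (d : ℝ)))) • z) (Config.dilate hc μ)
    have mΨ' : Measurable (Function.uncurry Ψ') := measurable_uncurry_comp hΨ
      ((Config.measurable_dilation _).comp measurable_fst)
      (Config.measurable_dilate.comp measurable_snd)
    have hI : ∫⁻ μ, ∫⁻ x, Ψ x ((X μ).removePts fun _ : Fin 1 => x) ∂(X μ).1 ∂Q ≤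
        ∫⁻ y, ψ y ∂M' + err := by
      have e1 : ∫⁻ μ, ∫⁻ x, Ψ x ((X μ).removePts fun _ : Fin 1 => x) ∂(X μ).1 ∂Q =
          ∫⁻ μ, ∫⁻ z, Ψ' z ((xiConfig t g hg_val hg_symm μ).removePts fun _ : Fin 1 => z)
            ∂(xiProc t g μ) ∂Q := by
        refine lintegral_congr_ae ?_
        filter_upwards [hξ] with μ hμ
        have m1 : Measurable fun x => Ψ x ((X μ).removePts fun _ : Fin 1 => x) :=
          measurable_uncurry_comp hΨ measurable_id
            (Config.measurable_removePt measurable_const measurable_id)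
        have e2 : (X μ).1 = (xiProc t g μ).map fun z => (t ^ (-(1 / (d : ℝ)))) • z := by
          change (xiConfig t g hg_val hg_symm μ).1.map _ = _
          rw [xiConfig_val hμ]
        rw [e2, lintegral_map m1 (Config.measurable_dilation _)]
        refine lintegral_congr fun z => ?_
        simp only [hX, Config.dilate_removePt, Ψ']
      have e3 : ∫⁻ y, ψ y ∂M' = ∫⁻ z, ∫⁻ μ, Ψ' z (xiConfig t g hg_val hg_symm μ) ∂Q ∂M := by
        rw [hM', lintegral_map mψ (Config.measurable_dilation _)]
      rw [e1, e3, herr]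
      refine lintegral_stein_le hm hη.isMecke hg_meas hR0 hb
        (fun y μ μ' h => hR.stabBall_eq y h) (fun y μ μ' h => hR.eq_of_restr_eq y h) hmem hRfin hξ
        (hκ.map hmeas hg_meas) mΨ' fun x μ₁ μ₂ α β γ h1 h2 e1 e2 => ?_
      have u : ∀ ρ : Measure (E d), ρ.map (fun z => (t ^ (-(1 / (d : ℝ)))) • z) Set.univ =
          ρ Set.univ := fun ρ => by
        rw [Measure.map_apply (Config.measurable_dilation _) .univ, Set.preimage_univ]
      rw [← u β, ← u γ]
      refine hΨL _ _ _ (α.map fun z => (t ^ (-(1 / (d : ℝ)))) • z) _ _ ?_ ?_ ?_ ?_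
      · exact (u _).trans_lt h1
      · exact (u _).trans_lt h2
      · rw [← Measure.map_add _ _ (Config.measurable_dilation _), ← e1]
        rfl
      · rw [← Measure.map_add _ _ (Config.measurable_dilation _), ← e2]
        rfl
    have hS := lintegral_congr (μ := Q) fun μ => hΨS (X μ) (hXfin μ)
    have m2 : Measurable fun μ => A.indicator (1 : Measure (E d) → ℝ≥0∞) (X μ).1 := mf.comp mX
    have m3 : Measurable fun μ => (X μ).1 Set.univ := Config.measurable_apply mX .univ
    rw [lintegral_add_right _ m3, lintegral_add_left m2, lintegral_add_right _ measurable_const,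
      lintegral_add_left measurable_const, lintegral_const, lintegral_const, measure_univ, mul_one,
      mul_one, hPA, hPB, hXu, hJ] at hS
    have hfin : ∫⁻ y, ψ y ∂Eν + M' Set.univ ≠ ∞ := by
      refine ENNReal.add_ne_top.2 ⟨ne_top_of_le_ne_top ?_ (lintegral_mono hψ2), hMfin'.ne⟩
      rw [lintegral_const]
      exact ENNReal.mul_ne_top (by simp) hEν.ne
    -- The integrated Stein equation `hS` has no subtractions. The finite term from its left-hand
    -- side is added to both sides and cancelled at the end.
    rw [← ENNReal.add_le_add_iff_right hfin]
    calc _ = P ((fun ω => rescale t (xiProc t g (η ω))) ⁻¹' A) + ∫⁻ y, ψ y ∂Eν + M' Set.univ := by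
          ring
      _ ≤ P' ((fun ω => (ν ω).1) ⁻¹' A) + (∫⁻ y, ψ y ∂M' + err) + Eν Set.univ := by
          rw [hS]
          exact add_le_add_left (add_le_add_right hI _) _
      _ = P' ((fun ω => (ν ω).1) ⁻¹' A) + err + (∫⁻ y, ψ y ∂M' + Eν Set.univ) := by ring
      _ ≤ P' ((fun ω => (ν ω).1) ⁻¹' A) + err +
          (∫⁻ y, ψ y ∂Eν + M' Set.univ + tvNorm M' Eν) := add_le_add_right htvψ _
      _ = _ := by ring
  refine (iSup₂_le fun A hA => ?_).trans_eq (show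
    tvNorm (M.map fun z => (t ^ (-(1 / (d : ℝ)))) • z) Eν + err = _ by rw [herr]; ring)
  rcases le_total (P'.real ((fun ω => (ν ω).1) ⁻¹' A))
    (P.real ((fun ω => rescale t (xiProc t g (η ω))) ⁻¹' A)) with hle | hle
  · rw [abs_of_nonneg (sub_nonneg.2 hle), ENNReal.ofReal_sub _ measureReal_nonneg,
      ofReal_measureReal, ofReal_measureReal, tsub_le_iff_left]
    exact main A hA
  · rw [abs_sub_comm, abs_of_nonneg (sub_nonneg.2 hle), ENNReal.ofReal_sub _ measureReal_nonneg,
      ofReal_measureReal, ofReal_measureReal, tsub_le_iff_left]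
    -- The reverse inequality is the one-sided estimate for the complementary event.
    have h1 := main Aᶜ hA.compl
    have h2 := prob_add_prob_compl (μ := P) (mres hA)
    have h3 := prob_add_prob_compl (μ := P') (mν hA)
    rw [Set.preimage_compl, Set.preimage_compl] at h1
    rw [← ENNReal.add_le_add_iff_right (measure_ne_top P
      ((fun ω => rescale t (xiProc t g (η ω))) ⁻¹' A)ᶜ)]
    calc _ ≤ P' ((fun ω => (ν ω).1) ⁻¹' A) + (P' ((fun ω => (ν ω).1) ⁻¹' A)ᶜ +
          (tvNorm (M.map fun z => (t ^ (-(1 / (d : ℝ)))) • z) Eν + err)) := add_le_add_right h1 _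
      _ = 1 + (tvNorm (M.map fun z => (t ^ (-(1 / (d : ℝ)))) • z) Eν + err) := by
          rw [← add_assoc, h3]
      _ = _ := by rw [← h2]; ring
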